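/- **Setting.** Let $H$ be a complex Hilbert space (scalar product antilinear in the first argument) with a complex conjugation $J$ (antilinear isometric involution), and let $Q$ be an orthogonal projection commuting with $J$, with $Q^\perp=1-Q$. Assume that $QH$ has finite even dimension $2n$ and that $Q^\perp H$ is infinite-dimensional. Put $H_Q=H\oplus Q^\perp H$ with the conjugation $J_Q(f\oplus h)=(QJf+Jh)\oplus Q^\perp Jf$. Let $\mathfrak A$ be the CAR algebra of $(H_Q,J_Q)$: a nonzero C*-algebra generated by operators $B(x)$, linear in $x\in H_Q$, with $B(x)^*=B(J_Qx)$ and $B(x)B(y)+B(y)B(x)=\langle J_Qx,y\rangle 1$. Put $G(f)=B(f\oplus 0)$ for $f\in H$. The *GAR algebra* $\mathfrak G$, its *fermionic part* $\mathfrak F$ and its *Grassmann part* $\Lambda$ are the norm-closed subalgebras of $\mathfrak A$ generated by $G(f)$ with $f\in H$, $f\in QH$, $f\in Q^\perp H$ respectively. $\Lambda$ carries the $\mathbb Z_2$-grading by the parity of products of generators, and the continuous antilinear, product-reversing involution $\star$ with $G(f)^\star=G(Jf)$. **Phase space.** For $\xi$ in the even phase space $\Xi_0=QH\otimes\Lambda_1$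 let $\xi\mapsto\xi^\star$ be the antilinear map with $(f\otimes\lambda)^\star=Jf\otimes\lambda^\star$. Let $\langle f\otimes\lambda,h\otimes\mu\rangle_Q=\langle f,h\rangle\lambda^\star\mu\in\Lambda$, let $A(f\otimes\lambda)=Af\otimes\lambda$ for an operator $A$ on $QH$, let $\Phi(f\otimes\lambda)=G(f)\lambda$, and let $w(\xi)=\exp\Phi(\xi)\in\mathfrak G$. **States.** A *covariance operator* is an operator $S$ on $QH$ with $0\le S\le 1$ and $S+JSJ=1$. The *quasifree state* $\omega_S$ is the state on $\mathfrak F$ with $\omega_S(G(f)G(h))=\langle Jf,Sh\rangle$ for $f,h\in QH$ whose higher correlation functions are given by Wick's theorem, i.e. $\omega_S(G(f_0)G(f_1)\cdots G(f_m))=\sum_{j=1}^m(-1)^{j-1}\omega_S(G(f_0)G(f_j))\,\omega_S\big(\prod_{i\neq 0,j}G(f_i)\big)$. The *G-extension* of a functional $\omega$ on $\mathfrak F$ is the bounded linear map $\boldsymbol\omega:\mathfrak G\to\Lambda$ with $\boldsymbol\omega(A\lambda)=\omega(A)\lambda$ for $A\in\mathfrak F$, $\lambda\in\Lambda$. A *basis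 projection* $P$ is a covariance operator that is a projection; $E_P\in\mathfrak F$ is the support projection of $\omega_P$ (the smallest projection $E$ with $\omega_P(E)=1$). **Forms, integral, Fourier transform.** Let $\bigwedge QH$ be the Grassmann algebra with its usual scalar product and with the antilinear product-reversing involution $\star$ extending $J$. Let $v\in\bigwedge^{2n}QH$ with $v=v^\star$ and $\langle v,v\rangle=1$. For an orthonormal basis $e^1,\dots,e^{2n}$ of $QH$ with $Je^i=e^i$, write $v=v_N\,e^1\wedge\cdots\wedge e^{2n}$ and $\xi_i=\langle e^i\otimes 1,\xi\rangle_Q$. If $F:\Xi_0\to\Lambda$ has the form $F(\xi)=\sum_{I}F^I\xi_I$ with $F^I\in\Lambda$ and $\xi_I=\xi_{i_1}\cdots\xi_{i_k}$ for $I=\{i_1<\dots<i_k\}$, then $\int_Q v(\xi)F(\xi)=v_N F^{\{1,\dots,2n\}}$. For such a function $f$ put $(\mathcal F f)(\xi)=\int_Q v(\eta)\,f(\eta)\,e^{\langle\xi^\star,\eta\rangle_Q}$. For a bounded linear map $\boldsymbol\varphi:\mathfrak G\to\Lambda$ and $A\in\mathfrak G$ put $(\mathcal F\boldsymbol\varphi)(\xi)=\boldsymbol\varphi(w(\xi))$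 and $(\boldsymbol\varphi*A)(\xi)=\boldsymbol\varphi(w(-\xi)Aw(\xi))$. For an operator $A$ on $QH$ with $A=-JA^*J$ let $a\in\bigwedge^2QH$ be the two-form with $\langle a^\star,f\wedge h\rangle=\langle Jf,Ah\rangle$, and let $\mathrm{Pf}_{[v,J]}(A)=(n!)^{-1}\langle v,a^n\rangle$. **Theorem.** (i) For each covariance operator $S$ on $QH$ and each $\xi\in\Xi_0$, $$(\mathcal F\boldsymbol\omega_S)(\xi)=\exp\!\big(-\tfrac12\langle\xi^\star,S\xi\rangle_Q\big).$$ (ii) For each basis projection $P$ on $QH$ and each $v$ as above, the number $\epsilon_{[v,P]}=\mathrm{Pf}_{[v,J]}(1-2P)$ is $1$ or $-1$, and for each $\xi\in\Xi_0$, $$\mathcal F(\boldsymbol\omega_P*E_P)(\xi)=\epsilon_{[v,P]}\,\exp\!\big(-\langle\xi^\star,P\xi\rangle_Q\big).$$ -/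

import Mathlib

open scoped TensorProduct InnerProductSpace ComplexOrder Nat

noncomputable section

namespace GAR

/-! ### Complex conjugations and the selfdual CAR algebra -/

/-- A complex conjugation on a Hilbert space: an antilinear isometric involution. -/
structure Conjugation (E : Type*) [NormedAddCommGroup E] [InnerProductSpace ℂ E] where
  map : E →ₗᵢ⋆[ℂ] E
  involutive : ∀ f, map (map f) = f

namespace Conjugation

variable {E : Type*} [NormedAddCommGroup E] [InnerProductSpace ℂ E]

instance : CoeFun (Conjugation E) (fun _ => E → E) := ⟨fun J => J.map⟩

/-- The conjugation as an antilinear map. -/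
def lin (J : Conjugation E) : E →ₗ⋆[ℂ] E := J.map.toLinearMap

/-- The restriction of a conjugation to an invariant subspace. -/
def restrict (J : Conjugation E) (V : Submodule ℂ E) (hV : ∀ f ∈ V, J f ∈ V) :
    Conjugation V where
  map :=
    { toFun := fun f => ⟨J f, hV f f.2⟩
      map_add' := fun f g => Subtype.ext (J.map.map_add f g)
      map_smul' := fun c f => Subtype.ext (J.map.map_smulₛₗ c (f : E))
      norm_map' := fun f => J.map.norm_map (f : E) }
  involutive := fun f => Subtype.ext (J.involutive f)

theorem inner_left (J : Conjugation E) (f g : E) : ⟪J f, g⟫_ℂ = ⟪J g, f⟫_ℂ := by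
  have key : ∀ x y : E, ⟪J x, J y⟫_ℂ = ⟪y, x⟫_ℂ := by
    intro x y
    rw [inner_eq_sum_norm_sq_div_four (𝕜 := ℂ), inner_eq_sum_norm_sq_div_four (𝕜 := ℂ) y x]
    have h1 : ‖J x + J y‖ = ‖y + x‖ := by
      rw [← map_add, J.map.norm_map, add_comm]
    have h2 : ‖J x - J y‖ = ‖y - x‖ := by
      rw [← map_sub, J.map.norm_map, norm_sub_rev]
    have h3 : ‖J x - (RCLike.I : ℂ) • J y‖ = ‖y - (RCLike.I : ℂ) • x‖ := by
      have : J x - (RCLike.I : ℂ) • J y = J (x + (RCLike.I : ℂ) • y) := by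
        rw [map_add, map_smulₛₗ]; simp [sub_eq_add_neg]
      rw [this, J.map.norm_map]
      have : x + (RCLike.I : ℂ) • y = (RCLike.I : ℂ) • (y - (RCLike.I : ℂ) • x) := by
        rw [smul_sub, smul_smul]; simp [add_comm]
      rw [this, norm_smul]; simp
    have h4 : ‖J x + (RCLike.I : ℂ) • J y‖ = ‖y + (RCLike.I : ℂ) • x‖ := by
      have : J x + (RCLike.I : ℂ) • J y = J (x - (RCLike.I : ℂ) • y) := by
        rw [map_sub, map_smulₛₗ]; simp [sub_eq_add_neg]
      rw [this, J.map.norm_map]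
      have : x - (RCLike.I : ℂ) • y = -((RCLike.I : ℂ) • (y + (RCLike.I : ℂ) • x)) := by
        rw [smul_add, smul_smul]; simp [sub_eq_add_neg]
      rw [this, norm_neg, norm_smul]; simp
    rw [h1, h2, h3, h4]
  have := key f (J g)
  rwa [J.involutive] at this

end Conjugation

/-- `CARAlgebra J 𝔄`: the C*-algebra `𝔄` is (a realization of) the selfdual CAR algebra over the
Hilbert space `K` with complex conjugation `J`, i.e. a nonzero C*-algebra that is generated by
operators `B f`, linear in `f`, with `(B f)* = B (J f)` and `{B f, B g} = ⟨J f, g⟩ 1`. Existence is proved in `Construction.exists_carAlgebra`. -/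
structure CARAlgebra {K : Type*} [NormedAddCommGroup K] [InnerProductSpace ℂ K]
    (J : Conjugation K) (𝔄 : Type*) [CStarAlgebra 𝔄] where
  B : K →ₗ[ℂ] 𝔄
  star_B : ∀ f, star (B f) = B (J f)
  anticomm : ∀ f g, B f * B g + B g * B f = algebraMap ℂ 𝔄 ⟪J f, g⟫_ℂ
  generates : (Algebra.adjoin ℂ (Set.range B)).topologicalClosure = ⊤
  nontrivial : Nontrivial 𝔄

/-! ### Forms and Pfaffians -/

/-- The Grassmann algebra over `E` with complex conjugated scalar multiplication. -/
def ConjExterior (E : Type*) [NormedAddCommGroup E] [InnerProductSpace ℂ E] : Type _ :=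
  ExteriorAlgebra ℂ E

instance {E : Type*} [NormedAddCommGroup E] [InnerProductSpace ℂ E] : Ring (ConjExterior E) :=
  inferInstanceAs (Ring (ExteriorAlgebra ℂ E))

instance {E : Type*} [NormedAddCommGroup E] [InnerProductSpace ℂ E] :
    Algebra ℂ (ConjExterior E) :=
  Algebra.compHom (ExteriorAlgebra ℂ E) (starRingEnd ℂ)

namespace Conjugation

open ExteriorAlgebra

variable {E : Type*} [NormedAddCommGroup E] [InnerProductSpace ℂ E] (J : Conjugation E)

/-- The antilinear ring endomorphism of the Grassmann algebra with `f ↦ J f`. -/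
def extMap : ExteriorAlgebra ℂ E →ₐ[ℂ] ConjExterior E :=
  ExteriorAlgebra.lift ℂ
    ⟨{ toFun := fun f => (ι ℂ (J f) : ExteriorAlgebra ℂ E)
       map_add' := fun f g => by
        change ι ℂ (J (f + g)) = ι ℂ (J f) + ι ℂ (J g)
        rw [map_add, map_add]
       map_smul' := fun c f => by
        change ι ℂ (J (c • f)) = (starRingEnd ℂ c) • ι ℂ (J f)
        rw [map_smulₛₗ, map_smul] },
      fun f => ι_sq_zero (J f)⟩

/-- The adjoint `⋆` on the Grassmann algebra over `E`: the antilinear involution that reverses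
products, with `(ι f)⋆ = ι (J f)`. -/
def extStar (a : ExteriorAlgebra ℂ E) : ExteriorAlgebra ℂ E := CliffordAlgebra.reverse (J.extMap a)

/-- The algebra homomorphism that sends `f` to the contraction with `⟨J f, ·⟩`. -/
def contraction : ExteriorAlgebra ℂ E →ₐ[ℂ] Module.End ℂ (ExteriorAlgebra ℂ E) :=
  ExteriorAlgebra.lift ℂ
    ⟨CliffordAlgebra.contractLeft ∘ₗ ((innerₛₗ ℂ).comp J.lin : E →ₗ[ℂ] E →ₗ[ℂ] ℂ),
      fun _ => LinearMap.ext fun x => CliffordAlgebra.contractLeft_contractLeft _ x⟩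

/-- The scalar product of the Grassmann algebra (antilinear in `a`): forms of different degrees
are orthogonal, and `⟨f₁ ∧ ⋯ ∧ fₖ, h₁ ∧ ⋯ ∧ hₖ⟩ = det ⟨fᵢ, hⱼ⟩`. The operator of left
multiplication with `f` has contraction with `⟨f, ·⟩` as its adjoint, so that `⟨a, b⟩` is the
component of degree `0` of `contraction a⋆` applied to `b`. -/
def extInner (a b : ExteriorAlgebra ℂ E) : ℂ := algebraMapInv (J.contraction (J.extStar a) b)

/-- The defining property of the two-form `a` of an operator `A`: `⟨a⋆, f ∧ h⟩ = ⟨J f, A h⟩`. -/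
def IsTwoForm (A : E →L[ℂ] E) (a : ExteriorAlgebra ℂ E) : Prop :=
  a ∈ ⋀[ℂ]^2 E ∧ ∀ f h, J.extInner (J.extStar a) (ι ℂ f * ι ℂ h) = ⟪J f, A h⟫_ℂ

/-- The two-form of a `J`-antisymmetric operator. -/
def twoForm (A : E →L[ℂ] E) : ExteriorAlgebra ℂ E := Classical.epsilon (J.IsTwoForm A)

/-- The Pfaffian `Pf_{[v,J]}(A) = (n!)⁻¹ ⟨v, aⁿ⟩`, where `a` is the two-form of `A` and
`2n = dim E`. -/
def pfaffian (v : ExteriorAlgebra ℂ E) (A : E →L[ℂ] E) : ℂ :=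
  ((Module.finrank ℂ E / 2)! : ℂ)⁻¹ * J.extInner v (J.twoForm A ^ (Module.finrank ℂ E / 2))

/-- A normalized selfadjoint form of highest degree. -/
structure IsVolumeForm (v : ExteriorAlgebra ℂ E) : Prop where
  mem : v ∈ ⋀[ℂ]^(Module.finrank ℂ E) E
  selfadjoint : J.extStar v = v
  normalized : J.extInner v v = 1

/-- A covariance operator: `0 ≤ S ≤ 1` and `S + J S J = 1`. -/
structure IsCovariance (S : E →L[ℂ] E) : Prop where
  pos : S.IsPositive
  le_one : (1 - S).IsPositive
  add_conj : ∀ f, S f + J (S (J f)) = f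

/-- A basis projection: a covariance operator that is a projection. -/
structure IsBasisProjection (P : E →L[ℂ] E) : Prop extends J.IsCovariance P where
  idem : P * P = P

end Conjugation

/-! ### The GAR algebra -/

/-- The data `(H, Q, J)`: a conjugation `J` and an orthogonal projection `Q` commuting with `J`.
The projection is given by its range `QH`, a `J`-invariant subspace that has an orthogonal
projection. -/
structure Triple (H : Type*) [NormedAddCommGroup H] [InnerProductSpace ℂ H] where
  J : Conjugation H
  QH : Submodule ℂ H
  hasProj : QH.HasOrthogonalProjection
  J_mem : ∀ f ∈ QH, J f ∈ QH

attribute [instance] Triple.hasProj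

namespace Triple

variable {H : Type*} [NormedAddCommGroup H] [InnerProductSpace ℂ H] (T : Triple H)

theorem J_mem_perp (f : H) (hf : f ∈ T.QHᗮ) : T.J f ∈ T.QHᗮ := by
  rw [Submodule.mem_orthogonal'] at hf ⊢
  intro u hu
  rw [T.J.inner_left, ← inner_conj_symm, hf _ (T.J_mem u hu), map_zero]

/-- The restriction `QJ` of `J` to `QH`. -/
def JQ : Conjugation T.QH := T.J.restrict T.QH T.J_mem

/-- The Hilbert space `H_Q = H ⊕ Q^⊥H`. -/
abbrev Space : Type _ := WithLp 2 (H × T.QHᗮ)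

/-- The underlying antilinear map of `J_Q`, namely
`f ⊕ h ↦ (Q J f + J h) ⊕ Q^⊥ J f`. -/
def conjFun (x : T.Space) : T.Space :=
  WithLp.toLp 2 (T.QH.starProjection (T.J x.fst) + T.J (x.snd : H),
    T.QHᗮ.orthogonalProjectionOnto (T.J x.fst))

theorem starProjection_J (f : H) :
    T.J (T.QH.starProjection f) = T.QH.starProjection (T.J f) := by
  refine (Submodule.eq_starProjection_of_mem_orthogonal (T.J_mem _ (by simp)) ?_).symm
  rw [← map_sub]
  exact T.J_mem_perp _ (T.QH.sub_starProjection_mem_orthogonal f)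

theorem conjFun_fst (x : T.Space) :
    (T.conjFun x).fst = T.QH.starProjection (T.J x.fst) + T.J (x.snd : H) := rfl

theorem conjFun_snd (x : T.Space) :
    ((T.conjFun x).snd : H) = T.J x.fst - T.QH.starProjection (T.J x.fst) := by
  simp [conjFun, Submodule.starProjection_orthogonal]

theorem starProjection_perp (h : T.QHᗮ) : T.QH.starProjection (h : H) = 0 :=
  (Submodule.starProjection_apply_eq_zero_iff _).2 h.2

theorem conjFun_conjFun (x : T.Space) : T.conjFun (T.conjFun x) = x := by
  refine WithLp.ofLp_injective 2 (Prod.ext ?_ (Subtype.ext ?_))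
  · change (T.conjFun (T.conjFun x)).fst = x.fst
    rw [conjFun_fst, conjFun_fst, conjFun_snd, map_add, map_add, map_sub, T.J.involutive,
      T.J.involutive, T.starProjection_J, T.J.involutive, T.starProjection_perp,
      Submodule.starProjection_eq_self_iff.2 (Submodule.starProjection_apply_mem _ _)]
    abel
  · change ((T.conjFun (T.conjFun x)).snd : H) = x.snd
    rw [conjFun_snd, conjFun_fst, map_add, map_add, T.J.involutive, T.starProjection_J,
      T.J.involutive, T.starProjection_perp,
      Submodule.starProjection_eq_self_iff.2 (Submodule.starProjection_apply_mem _ _)]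
    abel

theorem norm_conjFun (x : T.Space) : ‖T.conjFun x‖ = ‖x‖ := by
  have h1 : ‖T.QH.starProjection (T.J x.fst) + T.J (x.snd : H)‖ ^ 2
      = ‖T.QH.starProjection (T.J x.fst)‖ ^ 2 + ‖(x.snd : H)‖ ^ 2 := by
    rw [sq, sq, sq, norm_add_sq_eq_norm_sq_add_norm_sq_of_inner_eq_zero (𝕜 := ℂ) _ _
      ((T.J_mem_perp _ x.snd.2) _ (Submodule.starProjection_apply_mem _ _)), T.J.map.norm_map]
  have h2 : ‖x.fst‖ ^ 2 = ‖T.QH.starProjection (T.J x.fst)‖ ^ 2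
      + ‖T.J x.fst - T.QH.starProjection (T.J x.fst)‖ ^ 2 := by
    rw [← T.J.map.norm_map x.fst]
    conv_lhs => rw [← add_sub_cancel (T.QH.starProjection (T.J x.fst)) (T.J x.fst)]
    rw [sq, sq, sq]
    exact norm_add_sq_eq_norm_sq_add_norm_sq_of_inner_eq_zero (𝕜 := ℂ) _ _
      ((T.QH.sub_starProjection_mem_orthogonal _) _ (Submodule.starProjection_apply_mem _ _))
  refine (sq_eq_sq₀ (norm_nonneg _) (norm_nonneg _)).1 ?_
  have h3 : ‖(T.conjFun x).snd‖ = ‖T.J x.fst - T.QH.starProjection (T.J x.fst)‖ := by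
    rw [← conjFun_snd]; rfl
  rw [WithLp.prod_norm_sq_eq_of_L2, WithLp.prod_norm_sq_eq_of_L2, conjFun_fst, h1, h3, h2,
    Submodule.coe_norm]
  ring

/-- The complex conjugation `J_Q = R_Q (J ⊕ Q^⊥J)` on `H_Q`, where
`R_Q (f ⊕ h) = (Q f + h) ⊕ Q^⊥ f`. -/
def conjQ : Conjugation T.Space where
  map :=
    { toFun := T.conjFun
      map_add' := fun x y => by
        refine WithLp.ofLp_injective 2 (Prod.ext ?_ (Subtype.ext ?_))
        · change (T.conjFun (x + y)).fst = (T.conjFun x).fst + (T.conjFun y).fst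
          simp only [conjFun_fst, WithLp.add_fst, WithLp.add_snd, Submodule.coe_add, map_add]
          abel
        · change ((T.conjFun (x + y)).snd : H) = (T.conjFun x).snd + (T.conjFun y).snd
          simp only [conjFun_snd, WithLp.add_fst, map_add]
          abel
      map_smul' := fun c x => by
        refine WithLp.ofLp_injective 2 (Prod.ext ?_ (Subtype.ext ?_))
        · change (T.conjFun (c • x)).fst = (starRingEnd ℂ c) • (T.conjFun x).fst
          simp only [conjFun_fst, WithLp.smul_fst, WithLp.smul_snd, Submodule.coe_smul,
            map_smulₛₗ, smul_add, RingHom.id_apply]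
        · change ((T.conjFun (c • x)).snd : H) = (starRingEnd ℂ c) • ((T.conjFun x).snd : H)
          simp only [conjFun_snd, WithLp.smul_fst, map_smulₛₗ, smul_sub, RingHom.id_apply]
      norm_map' := T.norm_conjFun }
  involutive := T.conjFun_conjFun

end Triple

namespace CARAlgebra

variable {H : Type*} [NormedAddCommGroup H] [InnerProductSpace ℂ H] {T : Triple H}
  {𝔄 : Type*} [CStarAlgebra 𝔄] (C : CARAlgebra T.conjQ 𝔄)

/-- The Grassmann-Fermi field operators `G f = B (f ⊕ 0)`. -/
def G : H →ₗ[ℂ] 𝔄 :=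
  C.B ∘ₗ (WithLp.linearEquiv 2 ℂ (H × T.QHᗮ)).symm.toLinearMap ∘ₗ LinearMap.inl ℂ H T.QHᗮ

/-- The GAR algebra: the norm-closed subalgebra generated by all `G f`. -/
def gar : Subalgebra ℂ 𝔄 := (Algebra.adjoin ℂ (Set.range C.G)).topologicalClosure

theorem star_G (f : H) (hf : f ∈ T.QH) : star (C.G f) = C.G (T.J f) := by
  have : T.conjQ (WithLp.toLp 2 (f, 0)) = WithLp.toLp 2 (T.J f, 0) := by
    refine WithLp.ofLp_injective 2 (Prod.ext ?_ (Subtype.ext ?_))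
    · change (T.conjFun (WithLp.toLp 2 (f, 0))).fst = T.J f
      rw [Triple.conjFun_fst]
      simp [Submodule.starProjection_eq_self_iff.2 (T.J_mem f hf)]
    · change ((T.conjFun (WithLp.toLp 2 (f, 0))).snd : H) = ((0 : T.QHᗮ) : H)
      rw [Triple.conjFun_snd]
      simp [Submodule.starProjection_eq_self_iff.2 (T.J_mem f hf)]
  change star (C.B (WithLp.toLp 2 (f, 0))) = C.B (WithLp.toLp 2 (T.J f, 0))
  rw [C.star_B, this]

/-- The fermionic part: the norm-closed subalgebra generated by `G f`, `f ∈ QH`. It is stable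
under the C*-adjoint. -/
def ferm : StarSubalgebra ℂ 𝔄 where
  toSubalgebra := (Algebra.adjoin ℂ (C.G '' (T.QH : Set H))).topologicalClosure
  star_mem' := by
    intro a ha
    have h1 : star (C.G '' (T.QH : Set H)) = C.G '' (T.QH : Set H) := by
      have key : ∀ x ∈ C.G '' (T.QH : Set H), star x ∈ C.G '' (T.QH : Set H) := by
        rintro _ ⟨f, hf, rfl⟩
        exact ⟨T.J f, T.J_mem f hf, (C.star_G f hf).symm⟩
      ext x
      refine ⟨fun hx => ?_, fun hx => key x hx⟩
      have := key _ hx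
      rwa [star_star] at this
    have h2 := Subalgebra.topologicalClosure_star_comm
      (Algebra.adjoin ℂ (C.G '' (T.QH : Set H)))
    rw [Subalgebra.star_adjoin_comm, h1] at h2
    have h3 : a ∈ star (Algebra.adjoin ℂ (C.G '' (T.QH : Set H))).topologicalClosure := by
      rw [← h2]; exact ha
    exact h3

/-- The Grassmann part: the norm-closed subalgebra generated by `G f`, `f ∈ Q^⊥H`. -/
def grass : Subalgebra ℂ 𝔄 := (Algebra.adjoin ℂ (C.G '' (T.QHᗮ : Set H))).topologicalClosure

theorem ferm_le : C.ferm.toSubalgebra ≤ C.gar :=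
  Subalgebra.topologicalClosure_mono (Algebra.adjoin_mono (Set.image_subset_range _ _))

theorem grass_le : C.grass ≤ C.gar :=
  Subalgebra.topologicalClosure_mono (Algebra.adjoin_mono (Set.image_subset_range _ _))

/-- The inclusion of the fermionic part into the GAR algebra. -/
def fermIncl : C.ferm →ₐ[ℂ] C.gar := Subalgebra.inclusion C.ferm_le

/-- The inclusion of the Grassmann part into the GAR algebra. -/
def grassIncl : C.grass →ₐ[ℂ] C.gar := Subalgebra.inclusion C.grass_le

/-- `G f` as an element of the GAR algebra. -/
def garField : H →ₗ[ℂ] C.gar :=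
  C.G.codRestrict (Subalgebra.toSubmodule C.gar) fun f =>
    Subalgebra.le_topologicalClosure _ (Algebra.subset_adjoin ⟨f, rfl⟩)

/-- `B f = G f`, `f ∈ QH`, as an element of the fermionic part. -/
def fermField : T.QH →ₗ[ℂ] C.ferm :=
  (C.G ∘ₗ T.QH.subtype).codRestrict (Subalgebra.toSubmodule C.ferm.toSubalgebra) fun f =>
    Subalgebra.le_topologicalClosure _ (Algebra.subset_adjoin ⟨f, f.2, rfl⟩)

/-- `Λ f = G f`, `f ∈ Q^⊥H`, as an element of the Grassmann part. -/
def grassField : T.QHᗮ →ₗ[ℂ] C.grass :=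
  (C.G ∘ₗ T.QHᗮ.subtype).codRestrict (Subalgebra.toSubmodule C.grass) fun f =>
    Subalgebra.le_topologicalClosure _ (Algebra.subset_adjoin ⟨f, f.2, rfl⟩)

/-- The `ℤ/2`-grading of the Grassmann part: the closed span of the products of `k` generators
with `k ≡ p` modulo `2`. -/
def grassGraded (p : ℕ) : Submodule ℂ C.grass :=
  (Submodule.span ℂ {a | ∃ l : List T.QHᗮ, l.length ≡ p [MOD 2] ∧
    a = (l.map C.grassField).prod}).topologicalClosure

/-- The properties that determine the adjoint `⋆` on the Grassmann part: a continuous antilinear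
involution that reverses products, with `(Λ f)⋆ = Λ (J f)`. -/
structure IsGrassAdjoint (s : C.grass →ₗ⋆[ℂ] C.grass) : Prop where
  continuous : Continuous s
  involutive : ∀ a, s (s a) = a
  mul : ∀ a b, s (a * b) = s b * s a
  field : ∀ f : T.QHᗮ, s (C.grassField f) = C.grassField ⟨T.J f, T.J_mem_perp f f.2⟩

/-- The adjoint `⋆` on the Grassmann part, chosen by its characterizing properties (likewise for
the quasifree state, the support projection, the G-extension and the integral below). -/
def grassAdjoint : C.grass →ₗ⋆[ℂ] C.grass := Classical.epsilon C.IsGrassAdjoint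

/-! ### Anticommutative phase space -/

/-- The anticommutative phase space `QH ⊗ Gr(Q^⊥H)`. As it is used for finite-dimensional `QH`
only, the algebraic tensor product is complete. -/
abbrev PhaseSpace : Type _ := T.QH ⊗[ℂ] C.grass

/-- The even part of the phase space, `QH ⊗ Gr(Q^⊥H)₁`. -/
abbrev EvenPhaseSpace : Type _ := T.QH ⊗[ℂ] C.grassGraded 1

/-- The inclusion of the even part into the phase space. -/
def evenIncl : C.EvenPhaseSpace →ₗ[ℂ] C.PhaseSpace :=
  LinearMap.lTensor T.QH (C.grassGraded 1).subtype

/-- The complex conjugation `(f ⊗ λ)⋆ = (-1)^(p+1) J f ⊗ λ⋆` for `λ` of degree `p`. -/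
def phaseConj (p : ℕ) : (T.QH ⊗[ℂ] C.grassGraded p) →ₗ⋆[ℂ] C.PhaseSpace :=
  (-1 : ℂ) ^ (p + 1) •
    TensorProduct.map T.JQ.lin (C.grassAdjoint.comp (C.grassGraded p).subtype)

/-- The rigging map `⟨f ⊗ λ, h ⊗ μ⟩_Q = ⟨f, h⟩ λ⋆ μ`. -/
def rigging : C.PhaseSpace →ₗ⋆[ℂ] C.PhaseSpace →ₗ[ℂ] C.grass :=
  (TensorProduct.map₂ (innerₛₗ ℂ) ((LinearMap.mul ℂ C.grass).comp C.grassAdjoint)).compr₂ₛₗ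
    (TensorProduct.lid ℂ C.grass).toLinearMap

/-- `⟨ξ⋆, η⟩_Q` for `ξ`, `η` in the even part of the phase space. -/
def form (ξ η : C.EvenPhaseSpace) : C.grass := C.rigging (C.phaseConj 1 ξ) (C.evenIncl η)

/-- The action `ξ ↦ A ξ` of an operator `A` on `QH` on phase space. -/
def act (A : T.QH →L[ℂ] T.QH) : C.EvenPhaseSpace →ₗ[ℂ] C.EvenPhaseSpace :=
  LinearMap.rTensor (C.grassGraded 1) A.toLinearMap

/-- The Grassmann-Bose field `Φ`, with `Φ (f ⊗ λ) = G f * λ`. -/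
def boseField : C.PhaseSpace →ₗ[ℂ] C.gar :=
  TensorProduct.lift ((LinearMap.mul ℂ C.gar).compl₁₂ (C.garField ∘ₗ T.QH.subtype)
    C.grassIncl.toLinearMap)

/-- The Grassmann-Weyl operator `w(ξ) = exp (Φ ξ)`. -/
def weyl (ξ : C.EvenPhaseSpace) : C.gar := NormedSpace.exp (C.boseField (C.evenIncl ξ))

/-! ### Quasifree states, support projections and G-extensions -/

/-- A state on the fermionic part: a positive linear functional with value `1` at `1`. -/
structure IsState (ω : C.ferm →ₗ[ℂ] ℂ) : Prop where
  map_one : ω 1 = 1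
  nonneg : ∀ A : C.ferm, 0 ≤ ω (star A * A)

/-- The quasifree state with covariance `S`: a state with two-point function
`ω (B f * B h) = ⟨J f, S h⟩` all of whose correlation functions are given by Wick's theorem.
The latter is stated as an expansion along the first field operator; iterating it gives the
signed sum over all pairings for an even number of fields, and `0` for an odd number. -/
structure IsQuasifree (S : T.QH →L[ℂ] T.QH) (ω : C.ferm →ₗ[ℂ] ℂ) : Prop where
  state : C.IsState ω
  two_point : ∀ f h, ω (C.fermField f * C.fermField h) = ⟪T.JQ f, S h⟫_ℂ
  wick : ∀ (f : T.QH) (l : List T.QH),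
    ω (C.fermField f * (l.map C.fermField).prod) =
      ∑ j : Fin l.length, (-1 : ℂ) ^ (j : ℕ) * ω (C.fermField f * C.fermField (l.get j)) *
        ω ((l.eraseIdx j).map C.fermField).prod

/-- The quasifree state `ω_S`. -/
def quasifree (S : T.QH →L[ℂ] T.QH) : C.ferm →ₗ[ℂ] ℂ := Classical.epsilon (C.IsQuasifree S)

/-- `E` is the support projection of `ω`: the smallest projection in the fermionic part with
`ω E = 1`. -/
structure IsSupport (ω : C.ferm →ₗ[ℂ] ℂ) (E : C.ferm) : Prop where
  proj : IsStarProjection E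
  one : ω E = 1
  le : ∀ F : C.ferm, IsStarProjection F → ω F = 1 → E * F = E

/-- The support projection of `ω`. -/
def support (ω : C.ferm →ₗ[ℂ] ℂ) : C.ferm := Classical.epsilon (C.IsSupport ω)

/-- The G-extension of `ω`: the bounded linear map from the GAR algebra to its Grassmann part with
`Φ (A λ) = ω A λ` for `A` in the fermionic and `λ` in the Grassmann part. -/
def IsGExtension (ω : C.ferm →ₗ[ℂ] ℂ) (Φ : C.gar →L[ℂ] C.grass) : Prop :=
  ∀ (A : C.ferm) (a : C.grass), Φ (C.fermIncl A * C.grassIncl a) = ω A • a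

/-- The G-extension of `ω`. -/
def gExtension (ω : C.ferm →ₗ[ℂ] ℂ) : C.gar →L[ℂ] C.grass := Classical.epsilon (C.IsGExtension ω)

/-- The Fourier transform `(F φ)(ξ) = φ (w ξ)` of a map from the GAR algebra to its Grassmann
part. -/
def fourierHom (Φ : C.gar →L[ℂ] C.grass) (ξ : C.EvenPhaseSpace) : C.grass := Φ (C.weyl ξ)

/-- The convolution `(φ ∗ A)(ξ) = φ (α_ξ A)`, where `α_ξ A = w(-ξ) A w(ξ)`. -/
def convolution (Φ : C.gar →L[ℂ] C.grass) (A : C.gar) (ξ : C.EvenPhaseSpace) : C.grass :=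
  Φ (C.weyl (-ξ) * A * C.weyl ξ)

/-! ### The Grassmann integral -/

/-- The component `ξ_u = ⟨u ⊗ 1, ξ⟩_Q` of a phase space vector. -/
def component (u : T.QH) (ξ : C.EvenPhaseSpace) : C.grass :=
  C.rigging (u ⊗ₜ[ℂ] (1 : C.grass)) (C.evenIncl ξ)

/-- The monomial `ξ_I = ξ_{i₁} ⋯ ξ_{iₖ}` for `I = {i₁ < ⋯ < iₖ}`. -/
def monomial {N : ℕ} (e : Fin N → T.QH) (I : Finset (Fin N)) (ξ : C.EvenPhaseSpace) : C.grass :=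
  ((I.sort).map fun i => C.component (e i) ξ).prod

/-- `X` is the Grassmann integral of `F` over the form `v` of highest degree, computed from a
polynomial representation: there are a real orthonormal basis `e` of `QH` and coefficients with
`v = v_N e¹ ∧ ⋯ ∧ e^{2n}`, `F(ξ) = ∑_I F^I ξ_I` for all `ξ`, and `X = v_N F^N`. -/
def HasIntegral (v : ExteriorAlgebra ℂ T.QH) (F : C.EvenPhaseSpace → C.grass) (X : C.grass) :
    Prop :=
  ∃ (e : OrthonormalBasis (Fin (Module.finrank ℂ T.QH)) ℂ T.QH) (c : ℂ)
    (coeff : Finset (Fin (Module.finrank ℂ T.QH)) → C.grass),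
    (∀ i, T.JQ (e i) = e i) ∧ v = c • ExteriorAlgebra.ιMulti ℂ _ e ∧
    (∀ ξ, F ξ = ∑ I, coeff I * C.monomial e I ξ) ∧ X = c • coeff Finset.univ

/-- The Grassmann integral `∫_Q v(ξ) F(ξ)` of a Grassmann-valued G-holomorphic function. -/
def integral (v : ExteriorAlgebra ℂ T.QH) (F : C.EvenPhaseSpace → C.grass) : C.grass :=
  Classical.epsilon (C.HasIntegral v F)

/-- The Fourier transform `(F f)(ξ) = ∫_Q v(η) f(η) exp ⟨ξ⋆, η⟩_Q` of a G-holomorphic function. -/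
def fourierFun (v : ExteriorAlgebra ℂ T.QH) (f : C.EvenPhaseSpace → C.grass)
    (ξ : C.EvenPhaseSpace) : C.grass :=
  C.integral v fun η => f η * NormedSpace.exp (C.form ξ η)

end CARAlgebra
/-! ### Existence of the selfdual CAR algebra -/

namespace Construction

open Finset

section Sign

variable {ι : Type*} [LinearOrder ι]

/-- The sign `(-1)^{#{j ∈ s | j < i}}`. -/
def sgn (i : ι) (s : Finset ι) : ℂ := (-1) ^ (s.filter (· < i)).card

theorem sgn_mul_self (i : ι) (s : Finset ι) : sgn i s * sgn i s = 1 := by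
  rw [sgn, ← mul_pow]; simp

theorem sgn_symmDiff_of_lt {i j : ι} (h : j < i) (s : Finset ι) :
    sgn i (symmDiff s {j}) = -sgn i s := by
  unfold sgn
  by_cases hj : j ∈ s
  · have h1 : s.filter (· < i) = insert j ((symmDiff s {j}).filter (· < i)) := by
      ext x
      simp only [mem_filter, mem_insert, mem_symmDiff, mem_singleton]
      by_cases hx : x = j <;> simp_all
    have h2 : j ∉ (symmDiff s {j}).filter (· < i) := by simp [mem_symmDiff, hj]
    rw [h1, card_insert_of_notMem h2, pow_succ]; ring
  · have h1 : (symmDiff s {j}).filter (· < i) = insert j (s.filter (· < i)) := by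
      ext x
      simp only [mem_filter, mem_insert, mem_symmDiff, mem_singleton]
      by_cases hx : x = j <;> simp_all
    have h2 : j ∉ s.filter (· < i) := by simp [hj]
    rw [h1, card_insert_of_notMem h2, pow_succ]; ring

theorem sgn_symmDiff_of_le {i j : ι} (h : i ≤ j) (s : Finset ι) :
    sgn i (symmDiff s {j}) = sgn i s := by
  unfold sgn
  congr 2
  ext x
  simp only [mem_filter, mem_symmDiff, mem_singleton]
  constructor
  · rintro ⟨h1 | h1, h2⟩
    · exact ⟨h1.1, h2⟩
    · exact absurd (h1.1 ▸ h2) (not_lt.2 h)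
  · rintro ⟨h1, h2⟩
    exact ⟨Or.inl ⟨h1, fun h3 => absurd (h3 ▸ h2) (not_lt.2 h)⟩, h2⟩

theorem symmDiff_cancel (s t : Finset ι) : symmDiff (symmDiff s t) t = s := by
  rw [symmDiff_assoc, symmDiff_self]; exact symmDiff_bot s

/-- The Hilbert space with an orthonormal basis indexed by the finite subsets of `ι`. -/
abbrev Fock (ι : Type*) : Type _ := lp (fun _ : Finset ι => ℂ) 2

/-- The standard basis. -/
def stdBasis (ι : Type*) : HilbertBasis (Finset ι) ℂ (Fock ι) :=
  HilbertBasis.ofRepr (LinearIsometryEquiv.refl ℂ _)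

theorem op_ext {κ : Type*} {A B : Fock κ →L[ℂ] Fock κ}
    (h : ∀ s, A (stdBasis κ s) = B (stdBasis κ s)) : A = B := by
  refine ContinuousLinearMap.ext_on (s := Set.range (stdBasis κ)) ?_ ?_
  · have := (stdBasis κ).dense_span
    rw [Submodule.dense_iff_topologicalClosure_eq_top]
    exact this
  · rintro _ ⟨s, rfl⟩; exact h s

/-- The standard basis, permuted by `s ↦ s ∆ {i}` and multiplied with signs. -/
def vec (i : ι) (s : Finset ι) : Fock ι := sgn i s • stdBasis ι (symmDiff s {i})

theorem vec_orthonormal (i : ι) : Orthonormal ℂ (vec i) := by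
  rw [orthonormal_iff_ite]
  intro s t
  have h := orthonormal_iff_ite.1 (stdBasis ι).orthonormal (symmDiff s {i}) (symmDiff t {i})
  rw [vec, vec, inner_smul_left, inner_smul_right, h]
  by_cases hst : s = t
  · subst hst
    simp [sgn]
    rw [← mul_pow]; simp
  · have : symmDiff s {i} ≠ symmDiff t {i} := fun h' => hst (by
      rw [← symmDiff_cancel s {i}, h', symmDiff_cancel])
    simp [hst]

theorem vec_dense (i : ι) : ⊤ ≤ (Submodule.span ℂ (Set.range (vec i))).topologicalClosure := by
  rw [← (stdBasis ι).dense_span]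
  refine Submodule.topologicalClosure_mono (Submodule.span_le.2 ?_)
  rintro _ ⟨s, rfl⟩
  have : stdBasis ι s = sgn i s • vec i (symmDiff s {i}) := by
    rw [vec, sgn_symmDiff_of_le le_rfl, smul_smul, sgn_mul_self, one_smul, symmDiff_cancel]
  rw [this]
  exact Submodule.smul_mem _ _ (Submodule.subset_span ⟨_, rfl⟩)

/-- The unitary involution `e_s ↦ ± e_{s ∆ {i}}`. -/
def majoranaEquiv (i : ι) : Fock ι ≃ₗᵢ[ℂ] Fock ι :=
  (stdBasis ι).repr.trans (HilbertBasis.mk (vec_orthonormal i) (vec_dense i)).repr.symm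

theorem majoranaEquiv_basis (i : ι) (s : Finset ι) :
    majoranaEquiv i (stdBasis ι s) = vec i s := by
  change (HilbertBasis.mk (vec_orthonormal i) (vec_dense i)).repr.symm
    ((stdBasis ι).repr (stdBasis ι s)) = vec i s
  rw [HilbertBasis.repr_self, HilbertBasis.repr_symm_single, HilbertBasis.coe_mk]

/-- The operator `e_s ↦ ± e_{s ∆ {i}}`. -/
def majorana (i : ι) : Fock ι →L[ℂ] Fock ι := (majoranaEquiv i).toContinuousLinearEquiv

theorem majorana_basis (i : ι) (s : Finset ι) :
    majorana i (stdBasis ι s) = sgn i s • stdBasis ι (symmDiff s {i}) :=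
  majoranaEquiv_basis i s

theorem majorana_sq (i : ι) : majorana i * majorana i = 1 := by
  refine op_ext fun s => ?_
  rw [mul_apply_eq_comp, majorana_basis, map_smul, majorana_basis, smul_smul,
    sgn_symmDiff_of_le le_rfl, sgn_mul_self, symmDiff_cancel, one_smul]
  rfl

theorem majorana_anticomm {i j : ι} (hij : i ≠ j) :
    majorana i * majorana j + majorana j * majorana i = 0 := by
  refine op_ext fun s => ?_
  rw [add_apply, mul_apply_eq_comp, mul_apply_eq_comp,
    majorana_basis, map_smul, majorana_basis, majorana_basis, map_smul, majorana_basis,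
    smul_smul, smul_smul, symmDiff_right_comm s {i} {j}, ← add_smul]
  have : sgn j s * sgn i (symmDiff s {j}) + sgn i s * sgn j (symmDiff s {i}) = 0 := by
    rcases lt_or_gt_of_ne hij with h | h
    · rw [sgn_symmDiff_of_le h.le, sgn_symmDiff_of_lt h]; ring
    · rw [sgn_symmDiff_of_le h.le, sgn_symmDiff_of_lt h]; ring
  rw [this, zero_smul]; rfl

theorem majorana_star (i : ι) : star (majorana i) = majorana i := by
  have h1 : star (majorana i) * majorana i = 1 := by
    refine ContinuousLinearMap.ext fun x => ext_inner_left ℂ fun y => ?_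
    rw [mul_apply_eq_comp, ContinuousLinearMap.star_eq_adjoint,
      ContinuousLinearMap.adjoint_inner_right]
    exact (majoranaEquiv i).inner_map_map y x
  calc star (majorana i) = star (majorana i) * (majorana i * majorana i) := by
        rw [majorana_sq, mul_one]
    _ = majorana i := by rw [← mul_assoc, h1, one_mul]

end Sign

section Real

variable {K : Type*} [NormedAddCommGroup K] [InnerProductSpace ℂ K]

theorem inner_conj (J : Conjugation K) (f g : K) : ⟪J f, J g⟫_ℂ = ⟪g, f⟫_ℂ := by
  rw [J.inner_left, J.involutive]

theorem exists_real_basis [CompleteSpace K] (J : Conjugation K) : ∃ (w : Set K) (b : HilbertBasis w ℂ K),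
    ∀ i, J (b i) = b i := by
  -- a maximal orthonormal set of real vectors
  obtain ⟨w, hw⟩ := zorn_subset {s : Set K | Orthonormal ℂ ((↑) : s → K) ∧ ∀ f ∈ s, J f = f} (by
    intro c hc hchain
    refine ⟨⋃₀ c, ⟨orthonormal_sUnion_of_directed hchain.directedOn fun s hs => (hc hs).1, ?_⟩,
      fun s hs => Set.subset_sUnion_of_mem hs⟩
    rintro f ⟨s, hs, hf⟩
    exact (hc hs).2 f hf)
  have real_zero : ∀ f : K, J f = f → (∀ u ∈ w, ⟪u, f⟫_ℂ = 0) → f = 0 := by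
    intro f hf hperp
    by_contra hne
    set g : K := ((‖f‖⁻¹ : ℝ) : ℂ) • f with hg
    have hgn : ‖g‖ = 1 := by
      rw [hg, norm_smul, Complex.norm_real, norm_inv, norm_norm,
        inv_mul_cancel₀ (norm_ne_zero_iff.2 hne)]
    have hgJ : J g = g := by rw [hg, map_smulₛₗ, hf, Complex.conj_ofReal]
    have hgp : ∀ u ∈ w, ⟪u, g⟫_ℂ = 0 := fun u hu => by
      rw [hg, inner_smul_right, hperp u hu, mul_zero]
    have hgw : g ∉ w := fun h => by
      have := hgp g h
      rw [inner_self_eq_zero] at this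
      rw [this, norm_zero] at hgn
      exact zero_ne_one hgn
    refine hgw (hw.2 (y := insert g w) ⟨?_, ?_⟩ (Set.subset_insert _ _) (Set.mem_insert _ _))
    · refine ⟨?_, ?_⟩
      · rintro ⟨u, rfl | hu⟩
        · exact hgn
        · exact hw.1.1.1 ⟨u, hu⟩
      · rintro ⟨u, hu⟩ ⟨x, hx⟩ hne
        have hne' : u ≠ x := fun h => hne (Subtype.ext h)
        change ⟪u, x⟫_ℂ = 0
        rcases hu with rfl | hu <;> rcases hx with rfl | hx
        · exact absurd rfl hne'
        · rw [← inner_conj_symm, hgp x hx, map_zero]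
        · exact hgp u hu
        · exact hw.1.1.2 (i := ⟨u, hu⟩) (j := ⟨x, hx⟩) (fun h => hne' (congrArg Subtype.val h))
    · rintro u (rfl | hu)
      · exact hgJ
      · exact hw.1.2 u hu
  have hperp : (Submodule.span ℂ (Set.range ((↑) : w → K)))ᗮ = ⊥ := by
    rw [eq_bot_iff]
    intro f hf
    have h0 : ∀ u ∈ w, ⟪u, f⟫_ℂ = 0 := fun u hu =>
      hf u (Submodule.subset_span ⟨⟨u, hu⟩, rfl⟩)
    have h0' : ∀ u ∈ w, ⟪u, J f⟫_ℂ = 0 := fun u hu => by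
      rw [← hw.1.2 u hu, inner_conj, ← inner_conj_symm, h0 u hu, map_zero]
    have h1 : f + J f = 0 := by
      refine real_zero _ (by rw [map_add, J.involutive, add_comm]) fun u hu => ?_
      rw [inner_add_right, h0 u hu, h0' u hu, add_zero]
    have h2 : Complex.I • (f - J f) = 0 := by
      refine real_zero _ ?_ fun u hu => ?_
      · rw [map_smulₛₗ, map_sub, J.involutive, Complex.conj_I, neg_smul, ← smul_neg, neg_sub]
      · rw [inner_smul_right, inner_sub_right, h0 u hu, h0' u hu, sub_zero, mul_zero]
    have h3 : f - J f = 0 := (smul_eq_zero.1 h2).resolve_left Complex.I_ne_zero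
    have h4 : (2 : ℂ) • f = 0 := by
      rw [two_smul]
      nth_rewrite 2 [sub_eq_zero.1 h3]
      exact h1
    exact (smul_eq_zero.1 h4).resolve_left two_ne_zero
  refine ⟨w, HilbertBasis.mkOfOrthogonalEqBot hw.1.1 hperp, fun i => ?_⟩
  rw [HilbertBasis.coe_mkOfOrthogonalEqBot]
  exact hw.1.2 i i.2

/-- Complex conjugation of the coefficients. -/
def conjCoeff {ι : Type*} (c : ι →₀ ℂ) : ι →₀ ℂ := c.mapRange (starRingEnd ℂ) (map_zero _)

section Field

variable {ι : Type*} [LinearOrder ι]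

/-- The field operator on finite linear combinations of basis vectors. -/
def preField : (ι →₀ ℂ) →ₗ[ℂ] (Fock ι →L[ℂ] Fock ι) :=
  Finsupp.linearCombination ℂ fun i => (((√2)⁻¹ : ℝ) : ℂ) • majorana i

theorem preField_single (i : ι) (a : ℂ) :
    preField (Finsupp.single i a) = a • (((√2)⁻¹ : ℝ) : ℂ) • majorana i :=
  Finsupp.linearCombination_single _ _ _

theorem conjCoeff_add {ι : Type*} (c d : ι →₀ ℂ) :
    conjCoeff (c + d) = conjCoeff c + conjCoeff d :=
  Finsupp.mapRange_add (fun x y => map_add _ x y) c d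

theorem star_preField (c : ι →₀ ℂ) : star (preField c) = preField (conjCoeff c) := by
  induction c using Finsupp.induction_linear with
  | zero => simp [conjCoeff]
  | add c d hc hd => rw [map_add, star_add, hc, hd, conjCoeff_add, map_add]
  | single i a =>
    rw [conjCoeff, Finsupp.mapRange_single, preField_single, preField_single, star_smul, star_smul,
      majorana_star]
    simp

theorem conj_combination {κ : Type*} (J : Conjugation K) (b : κ → K) (hb : ∀ i, J (b i) = b i)
    (c : κ →₀ ℂ) :
    J (Finsupp.linearCombination ℂ b c) = Finsupp.linearCombination ℂ b (conjCoeff c) := by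
  induction c using Finsupp.induction_linear with
  | zero => simp [conjCoeff]
  | add c d hc hd => rw [map_add, map_add, hc, hd, conjCoeff_add, map_add]
  | single i a =>
    rw [conjCoeff, Finsupp.mapRange_single, Finsupp.linearCombination_single,
      Finsupp.linearCombination_single, map_smulₛₗ, hb]

theorem preField_anticomm (J : Conjugation K) (b : ι → K) (hb : ∀ i, J (b i) = b i)
    (ho : Orthonormal ℂ b) (c d : ι →₀ ℂ) :
    preField c * preField d + preField d * preField c =
      ⟪J (Finsupp.linearCombination ℂ b c), Finsupp.linearCombination ℂ b d⟫_ℂ •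
        (1 : Fock ι →L[ℂ] Fock ι) := by
  induction c using Finsupp.induction_linear with
  | zero => simp
  | add c c' hc hc' =>
    rw [map_add, map_add, map_add, inner_add_left, add_smul, ← hc, ← hc']
    noncomm_ring
  | single i a =>
    induction d using Finsupp.induction_linear with
    | zero => simp
    | add d d' hd hd' =>
      rw [map_add, map_add, inner_add_right, add_smul, ← hd, ← hd']
      noncomm_ring
    | single j a' =>
      rw [preField_single, preField_single, Finsupp.linearCombination_single,
        Finsupp.linearCombination_single, map_smulₛₗ, hb, inner_smul_left, inner_smul_right,
        orthonormal_iff_ite.1 ho, Complex.conj_conj]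
      simp only [smul_mul_smul_comm, smul_smul]
      have hs : ((((√2)⁻¹ : ℝ) : ℂ)) * (((√2)⁻¹ : ℝ) : ℂ) = 1 / 2 := by
        rw [← Complex.ofReal_mul, ← mul_inv, Real.mul_self_sqrt (by norm_num)]
        norm_num
      have e1 : a * (((√2)⁻¹ : ℝ) : ℂ) * (a' * (((√2)⁻¹ : ℝ) : ℂ)) = a * a' / 2 := by
        rw [mul_mul_mul_comm, hs]; ring
      have e2 : a' * (((√2)⁻¹ : ℝ) : ℂ) * (a * (((√2)⁻¹ : ℝ) : ℂ)) = a * a' / 2 := by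
        rw [mul_mul_mul_comm, hs]; ring
      rw [e1, e2, ← smul_add]
      by_cases hij : i = j
      · subst hij
        rw [majorana_sq, ← two_smul ℂ, smul_smul, if_pos rfl]
        congr 1
        ring
      · rw [majorana_anticomm hij, if_neg hij]
        simp

theorem norm_preField_le (J : Conjugation K) (b : ι → K) (hb : ∀ i, J (b i) = b i)
    (ho : Orthonormal ℂ b) (c : ι →₀ ℂ) :
    ‖preField c‖ ≤ 1 * ‖Finsupp.linearCombination ℂ b c‖ := by
  rw [one_mul]
  refine ContinuousLinearMap.opNorm_le_bound _ (norm_nonneg _) fun x => ?_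
  have h := preField_anticomm J b hb ho (conjCoeff c) c
  rw [← star_preField, ← conj_combination J b hb, J.involutive] at h
  have h' := congrArg (fun A : Fock ι →L[ℂ] Fock ι => RCLike.re ⟪x, A x⟫_ℂ) h
  simp only [add_apply, mul_apply_eq_comp, smul_apply, inner_add_right, inner_smul_right,
    map_add, one_apply_eq_self] at h'
  rw [ContinuousLinearMap.star_eq_adjoint, ContinuousLinearMap.adjoint_inner_right,
    ← ContinuousLinearMap.adjoint_inner_left (preField c) _ x, inner_self_eq_norm_sq, inner_self_eq_norm_sq,
    inner_self_eq_norm_sq_to_K, inner_self_eq_norm_sq_to_K] at h'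
  have h2 : ‖preField c x‖ ^ 2 ≤ (‖Finsupp.linearCombination ℂ b c‖ * ‖x‖) ^ 2 := by
    have : RCLike.re (((‖Finsupp.linearCombination ℂ b c‖ : ℂ)) ^ 2 * ((‖x‖ : ℂ)) ^ 2 : ℂ)
        = (‖Finsupp.linearCombination ℂ b c‖ * ‖x‖) ^ 2 := by
      rw [← mul_pow, ← Complex.ofReal_mul, ← Complex.ofReal_pow]
      exact Complex.ofReal_re _
    rw [← this]
    refine le_trans (le_add_of_nonneg_right (sq_nonneg ‖(star (preField c)) x‖)) (le_of_eq ?_)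
    exact h'
  exact le_of_sq_le_sq h2 (by positivity)

end Field

/-- Every Hilbert space with a complex conjugation has a selfdual CAR algebra. -/
theorem exists_carAlgebra.{u} {K : Type u} [NormedAddCommGroup K] [InnerProductSpace ℂ K]
    [CompleteSpace K] (J : Conjugation K) :
    ∃ (𝔄 : Type u) (_ : CStarAlgebra 𝔄), Nonempty (CARAlgebra J 𝔄) := by
  obtain ⟨w, b, hb⟩ := exists_real_basis J
  classical
  let _ : LinearOrder w := linearOrderOfSTO WellOrderingRel
  have ho : Orthonormal ℂ b := b.orthonormal
  set e : (w →₀ ℂ) →ₗ[ℂ] K := Finsupp.linearCombination ℂ b with he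
  have hdense : DenseRange e := by
    have h := b.dense_span
    rw [← Submodule.dense_iff_topologicalClosure_eq_top] at h
    rw [DenseRange, ← LinearMap.coe_range, he, Finsupp.range_linearCombination]
    exact h
  have hnorm : ∃ C : ℝ, ∀ c, ‖(preField : (w →₀ ℂ) →ₗ[ℂ] _) c‖ ≤ C * ‖e c‖ :=
    ⟨1, norm_preField_le J b hb ho⟩
  set B : K →L[ℂ] (Fock w →L[ℂ] Fock w) := preField.extendOfNorm e with hB
  have hBe : ∀ c, B (e c) = preField c := fun c => LinearMap.extendOfNorm_eq hdense hnorm c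
  have hstar : ∀ f, star (B f) = B (J f) := by
    intro f
    refine hdense.induction_on (p := fun f => star (B f) = B (J f)) f ?_ fun c => ?_
    · exact isClosed_eq (continuous_star.comp B.continuous)
        (B.continuous.comp J.map.continuous)
    · rw [hBe, he, conj_combination J b hb, ← he, hBe, star_preField]
  have hanti : ∀ f g, B f * B g + B g * B f = ⟪J f, g⟫_ℂ • (1 : Fock w →L[ℂ] Fock w) := by
    intro f g
    refine hdense.induction_on₂
      (p := fun f g => B f * B g + B g * B f = ⟪J f, g⟫_ℂ • (1 : Fock w →L[ℂ] Fock w)) ?_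
      (fun c d => ?_) f g
    · refine isClosed_eq ?_ ?_
      · have h1 := B.continuous.comp (continuous_fst (X := K) (Y := K))
        have h2 := B.continuous.comp (continuous_snd (X := K) (Y := K))
        exact (h1.mul h2).add (h2.mul h1)
      · have h1 : Continuous fun q : K × K => ⟪J q.1, q.2⟫_ℂ :=
          (J.map.continuous.comp continuous_fst).inner continuous_snd
        exact h1.smul continuous_const
    · rw [hBe, hBe, he, preField_anticomm J b hb ho]
  -- the generated C*-algebra
  set A₀ : Subalgebra ℂ (Fock w →L[ℂ] Fock w) := Algebra.adjoin ℂ (Set.range B) with hA₀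
  let 𝔖 : StarSubalgebra ℂ (Fock w →L[ℂ] Fock w) :=
    { toSubalgebra := A₀.topologicalClosure
      star_mem' := by
        intro a ha
        have h1 : star (Set.range B) = Set.range B := by
          ext x
          constructor
          · rintro ⟨f, hf⟩
            exact ⟨J f, by rw [← hstar, hf, star_star]⟩
          · rintro ⟨f, rfl⟩
            exact ⟨J f, (hstar f).symm⟩
        have h2 := Subalgebra.topologicalClosure_star_comm A₀
        rw [hA₀, Subalgebra.star_adjoin_comm, h1] at h2
        have h3 : a ∈ star A₀.topologicalClosure := by
          rw [hA₀, ← h2]; exact ha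
        exact h3 }
  have hclosed : IsClosed (𝔖 : Set (Fock w →L[ℂ] Fock w)) := A₀.isClosed_topologicalClosure
  have := hclosed
  let inst : CStarAlgebra 𝔖 := StarSubalgebra.cstarAlgebra 𝔖
  have hmem : ∀ f, B f ∈ 𝔖 := fun f =>
    A₀.le_topologicalClosure (Algebra.subset_adjoin ⟨f, rfl⟩)
  refine ⟨𝔖, inst, ⟨{
    B := B.toLinearMap.codRestrict (Subalgebra.toSubmodule 𝔖.toSubalgebra) hmem
    star_B := fun f => Subtype.ext (hstar f)
    anticomm := fun f g => Subtype.ext ?_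
    generates := ?_
    nontrivial := ?_ }⟩⟩
  · exact (hanti f g).trans (Algebra.algebraMap_eq_smul_one _).symm
  · refine eq_top_iff.2 fun x _ => ?_
    change x ∈ closure (_ : Set 𝔖)
    rw [closure_subtype]
    refine closure_mono ?_ (show (x : Fock w →L[ℂ] Fock w) ∈ closure (A₀ : Set _) from x.2)
    intro y hy
    have hsub : A₀ ≤ (Algebra.adjoin ℂ (Set.range
        (B.toLinearMap.codRestrict (Subalgebra.toSubmodule 𝔖.toSubalgebra) hmem))).map
          𝔖.toSubalgebra.val := by
      rw [AlgHom.map_adjoin]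
      refine Algebra.adjoin_mono ?_
      rintro _ ⟨f, rfl⟩
      exact ⟨⟨B f, hmem f⟩, ⟨f, rfl⟩, rfl⟩
    obtain ⟨z, hz, rfl⟩ := hsub hy
    exact ⟨z, hz, rfl⟩
  · refine ⟨⟨0, 1, fun h => ?_⟩⟩
    have h1 : (0 : Fock w →L[ℂ] Fock w) = 1 := congrArg Subtype.val h
    have h2 := congrArg (fun A : Fock w →L[ℂ] Fock w => A (stdBasis w ∅)) h1
    have h3 : ‖stdBasis w ∅‖ = 1 := (stdBasis w).orthonormal.1 ∅
    have h4 : stdBasis w ∅ = 0 := h2.symm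
    rw [h4, norm_zero] at h3
    exact zero_ne_one h3

end Real

end Construction

end GAR

end

/-! Everything rests on an exchange relation and on minimality of the support projection. For a
quasifree state with covariance S, Wick's theorem together with J S = (1 - S) J gives a KMS-type
identity for the G-extension φ: φ(Φ(Sξ) X) = -φ(X Φ((1 - S)ξ)) (`IsGExtension.kms`). Put b = Φ(ξ) =
Φ(Sξ) + c with c = Φ((1 - S)ξ). Then φ(b^(m+2)) is φ of the commutator of c with b^(m+1). That
commutator is computed from the commutation relation `evenField_comm`, whose right-hand side is
central in the GAR algebra. The outcome is the Gaussian moment recursion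
`IsGExtension.map_evenField_pow`, and summing the exponential series gives part (i),
`IsGExtension.map_exp`.

For a basis projection P choose vectors f_i in its range such that the f_i and J f_i form an
orthonormal basis. The product E of the operators G(f_i)* G(f_i) is a minimal projection, E A E =
ω_P(A) E, and it is the support projection (`support_quasifree`). Hence φ(X E Y) = φ(X) φ(Y), and
the convolution with E is the product of two equal Gaussians, which removes the factor 1/2 from the
exponent (`convolution_quasifree`). The Fourier transform of this Gaussian is found by completing
the square: the integrand equals exp(-⟨ξ⋆, Pξ⟩) times a product of n factors 1 - (η_i - ξ_i)(η'_i +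
ξ'_i), where the prime marks the coordinates belonging to J f_i (`gaussian_eq_prod`). Its top
coefficient comes from the factors -η_i η'_i alone, that is from the product of the two-forms f_i ∧
J f_i up to (-1)^n. The sum of these two-forms is the two-form of 1 - 2P, so the integral produces
exactly the Pfaffian (`integral_gaussian`). Reality and normalization of both top forms make it ±1
(`exists_volume_coord`).

The involution, the states, the support projection, the G-extensions and the integral are chosen by
their characterizing properties, so existence has to be proved throughout, and uniqueness as far as
it is needed. Quasifree states arise from a pure state by transformations that install the KMS
condition one mode at a time. For the involution and the G-extensions the point is boundedness. An
element of the algebraic Grassmann algebra involves only finitely many vectors; as Q^⊥H is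
infinite-dimensional, there is a unit vector e orthogonal to them, and G(e) + G(e)* is a selfadjoint
unitary of the ambient C*-algebra that anticommutes with all fields concerned. Such unitaries give
the norm estimates. The same reserve of vectors shows that an element killed by all generators
vanishes, so top coefficients are unique. -/

namespace GAR

namespace CARAlgebra

variable {H : Type*} [NormedAddCommGroup H] [InnerProductSpace ℂ H] {T : Triple H}
  {𝔄 : Type*} [CStarAlgebra 𝔄] (C : CARAlgebra T.conjQ 𝔄)

/-! ### Anticommutation relations of the Grassmann-Fermi field -/

theorem G_apply (f : H) : C.G f = C.B (WithLp.toLp 2 (f, 0)) := rfl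

theorem conjQ_apply (x : T.Space) : T.conjQ x = T.conjFun x := rfl

/-- The conjugation sends f ⊕ 0 to QJf ⊕ Q^⊥Jf, and the scalar product with h ⊕ 0 sees only the
first summand. Hence fields from Q^⊥H anticommute with all fields, while those from QH satisfy the
usual relations. -/
theorem G_anticomm (f h : H) :
    C.G f * C.G h + C.G h * C.G f = algebraMap ℂ 𝔄 ⟪T.QH.starProjection (T.J f), h⟫_ℂ := by
  rw [G_apply, G_apply, C.anticomm, conjQ_apply, WithLp.prod_inner_apply]
  congr 1
  have h1 := T.conjFun_fst (WithLp.toLp 2 (f, 0))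
  have : T.J ((0 : T.QHᗮ) : H) = 0 := map_zero _
  change ⟪(T.conjFun (WithLp.toLp 2 (f, 0))).fst, h⟫_ℂ +
    ⟪(T.conjFun (WithLp.toLp 2 (f, 0))).snd, (0 : T.QHᗮ)⟫_ℂ = _
  rw [h1, inner_zero_right, add_zero]
  change ⟪T.QH.starProjection (T.J f) + T.J ((0 : T.QHᗮ) : H), h⟫_ℂ = _
  rw [this, add_zero]

theorem G_anticomm_ferm {f : H} (hf : f ∈ T.QH) (h : H) :
    C.G f * C.G h + C.G h * C.G f = algebraMap ℂ 𝔄 ⟪T.J f, h⟫_ℂ := by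
  rw [G_anticomm, Submodule.starProjection_eq_self_iff.2 (T.J_mem f hf)]

theorem G_anticomm_perp (f : H) {h : H} (hh : h ∈ T.QHᗮ) : C.G f * C.G h = -(C.G h * C.G f) := by
  rw [eq_neg_iff_add_eq_zero, G_anticomm,
    hh _ (Submodule.starProjection_apply_mem _ _), map_zero]

theorem G_sq_perp {h : H} (hh : h ∈ T.QHᗮ) : C.G h * C.G h = 0 := by
  have := C.G_anticomm h h
  rw [hh _ (Submodule.starProjection_apply_mem _ _), map_zero, ← two_smul ℂ] at this
  exact (smul_eq_zero.1 this).resolve_left two_ne_zero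

theorem star_G_perp {h : H} (hh : h ∈ T.QHᗮ) :
    star (C.G h) = C.B (WithLp.toLp 2 (0, ⟨T.J h, T.J_mem_perp h hh⟩)) := by
  rw [G_apply, C.star_B, conjQ_apply]
  congr 1
  refine WithLp.ofLp_injective 2 (Prod.ext ?_ (Subtype.ext ?_))
  · change (T.conjFun (WithLp.toLp 2 (h, 0))).fst = 0
    rw [Triple.conjFun_fst]
    simp [T.starProjection_perp ⟨T.J h, T.J_mem_perp h hh⟩]
  · change ((T.conjFun (WithLp.toLp 2 (h, 0))).snd : H) = T.J h
    rw [Triple.conjFun_snd]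
    simp [T.starProjection_perp ⟨T.J h, T.J_mem_perp h hh⟩]

/-- In the ambient C*-algebra a Grassmann field and its C*-adjoint satisfy nontrivial fermionic
relations. The norm estimates for the Grassmann part use these adjoints. -/
theorem G_anticomm_star (f : H) {h : H} (hh : h ∈ T.QHᗮ) :
    C.G f * star (C.G h) + star (C.G h) * C.G f = algebraMap ℂ 𝔄 ⟪h, f⟫_ℂ := by
  rw [star_G_perp C hh, G_apply, add_comm, C.anticomm, conjQ_apply, WithLp.prod_inner_apply]
  congr 1
  have h1 := T.conjFun_fst (WithLp.toLp 2 ((0 : H), ⟨T.J h, T.J_mem_perp h hh⟩))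
  change ⟪(T.conjFun (WithLp.toLp 2 ((0 : H), ⟨T.J h, T.J_mem_perp h hh⟩))).fst, f⟫_ℂ +
    ⟪(T.conjFun (WithLp.toLp 2 ((0 : H), ⟨T.J h, T.J_mem_perp h hh⟩))).snd, (0 : T.QHᗮ)⟫_ℂ = _
  rw [h1, inner_zero_right, add_zero]
  change ⟪T.QH.starProjection (T.J 0) + T.J (T.J h), f⟫_ℂ = _
  rw [T.J.involutive, map_zero, map_zero, zero_add]

/-! ### Gradings -/

@[simp] theorem coe_grassField (h : T.QHᗮ) : (C.grassField h : 𝔄) = C.G h := rfl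

@[simp] theorem coe_fermField (f : T.QH) : (C.fermField f : 𝔄) = C.G f := rfl

@[simp] theorem coe_garField (f : H) : (C.garField f : 𝔄) = C.G f := rfl

@[simp] theorem coe_fermIncl (A : C.ferm) : (C.fermIncl A : 𝔄) = A :=
  Subalgebra.coe_inclusion (h := C.ferm_le) A

@[simp] theorem coe_grassIncl (a : C.grass) : (C.grassIncl a : 𝔄) = a :=
  Subalgebra.coe_inclusion (h := C.grass_le) a

theorem coe_grass_list_prod (l : List T.QHᗮ) :
    (((l.map C.grassField).prod : C.grass) : 𝔄) = (l.map fun h : T.QHᗮ => C.G h).prod := by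
  change C.grass.val _ = _
  rw [map_list_prod, List.map_map]
  rfl

theorem coe_ferm_list_prod (l : List T.QH) :
    (((l.map C.fermField).prod : C.ferm) : 𝔄) = (l.map fun h : T.QH => C.G h).prod := by
  change C.ferm.subtype _ = _
  rw [map_list_prod, List.map_map]
  rfl

/-- An element that anticommutes with `y i`, moved through a product of such elements. -/
theorem anticomm_list_prod {R : Type*} [Ring R] [Algebra ℂ R] {ι : Type*} {x : R} {y : ι → R}
    (l : List ι) (hx : ∀ h ∈ l, x * y h = -(y h * x)) :
    x * (l.map y).prod = (-1 : ℂ) ^ l.length • ((l.map y).prod * x) := by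
  induction l with
  | nil => simp
  | cons a l ih =>
    rw [List.map_cons, List.prod_cons, ← mul_assoc, hx a (by simp), neg_mul, mul_assoc,
      ih fun h hh => hx h (by simp [hh]), List.length_cons, pow_succ, mul_smul_comm, mul_assoc]
    simp

theorem grassGraded_induction {p : ℕ} {P : C.grass → Prop}
    (hcl : IsClosed {a | P a}) (hadd : ∀ a b, P a → P b → P (a + b))
    (hsmul : ∀ (c : ℂ) a, P a → P (c • a))
    (hl : ∀ l : List T.QHᗮ, l.length ≡ p [MOD 2] → P (l.map C.grassField).prod)
    {a : C.grass} (ha : a ∈ C.grassGraded p) : P a := by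
  have h0 : P 0 := by
    have := hsmul 0 _ (hl (List.replicate p 0) (by simp [Nat.ModEq]))
    rwa [zero_smul] at this
  have key : C.grassGraded p ≤
      (⟨⟨⟨{a | P a}, fun {a b} => hadd a b⟩, h0⟩, fun c {a} => hsmul c a⟩ :
        Submodule ℂ C.grass) := by
    refine Submodule.topologicalClosure_minimal _ (Submodule.span_le.2 ?_) hcl
    rintro _ ⟨l, hl', rfl⟩
    exact hl l hl'
  exact key ha

/-- Products of generators span the generated algebra, which is dense in the Grassmann part; a
closed linear condition extends from there. -/
theorem grass_induction {P : C.grass → Prop}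
    (hcl : IsClosed {a | P a}) (hadd : ∀ a b, P a → P b → P (a + b))
    (hsmul : ∀ (c : ℂ) a, P a → P (c • a))
    (hl : ∀ l : List T.QHᗮ, P (l.map C.grassField).prod)
    (a : C.grass) : P a := by
  have h0 : P 0 := by
    have := hsmul 0 _ (hl [])
    rwa [zero_smul] at this
  have hspan : ∀ x ∈ Algebra.adjoin ℂ (C.G '' (T.QHᗮ : Set H)),
      x ∈ Submodule.span ℂ (Set.range fun l : List T.QHᗮ =>
        (((l.map C.grassField).prod : C.grass) : 𝔄)) := by
    intro x hx
    rw [← Subalgebra.mem_toSubmodule, Algebra.adjoin_eq_span] at hx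
    refine Submodule.span_mono ?_ hx
    intro y hy
    induction hy using Submonoid.closure_induction with
    | mem y hy => obtain ⟨f, hf, rfl⟩ := hy; exact ⟨[⟨f, hf⟩], by simp⟩
    | one => exact ⟨[], by simp⟩
    | mul y z _ _ hy hz =>
      obtain ⟨l, rfl⟩ := hy
      obtain ⟨l', rfl⟩ := hz
      exact ⟨l ++ l', by simp⟩
  have hin : ∀ x ∈ Submodule.span ℂ (Set.range fun l : List T.QHᗮ =>
      (((l.map C.grassField).prod : C.grass) : 𝔄)), ∃ hx : x ∈ C.grass, P ⟨x, hx⟩ := by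
    intro x hx
    induction hx using Submodule.span_induction with
    | mem x hx => obtain ⟨l, rfl⟩ := hx; exact ⟨Subtype.prop _, hl l⟩
    | zero => exact ⟨zero_mem _, h0⟩
    | add x y _ _ hx hy =>
      obtain ⟨h1, h2⟩ := hx
      obtain ⟨h3, h4⟩ := hy
      exact ⟨add_mem h1 h3, hadd _ _ h2 h4⟩
    | smul c x _ hx =>
      obtain ⟨h1, h2⟩ := hx
      exact ⟨Subalgebra.smul_mem _ h1 c, hsmul c _ h2⟩
  have : a ∈ closure {a : C.grass | P a} := by
    rw [closure_subtype]
    refine closure_mono ?_ (show (a : 𝔄) ∈ closure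
      ((Algebra.adjoin ℂ (C.G '' (T.QHᗮ : Set H)) : Subalgebra ℂ 𝔄) : Set 𝔄) from a.2)
    intro x hx
    obtain ⟨h1, h2⟩ := hin x (hspan x hx)
    exact ⟨⟨x, h1⟩, h2, rfl⟩
  rwa [hcl.closure_eq] at this

theorem neg_one_pow_congr {p q : ℕ} (h : p ≡ q [MOD 2]) : (-1 : ℂ) ^ p = (-1) ^ q := by
  rw [neg_one_pow_eq_pow_mod_two, h, ← neg_one_pow_eq_pow_mod_two]

theorem anticomm_graded {x : 𝔄} (hx : ∀ h : T.QHᗮ, x * C.G h = -(C.G h * x)) {p : ℕ}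
    {a : C.grass} (ha : a ∈ C.grassGraded p) :
    x * (a : 𝔄) = (-1 : ℂ) ^ p • ((a : 𝔄) * x) := by
  refine C.grassGraded_induction (P := fun a => x * (a : 𝔄) = (-1 : ℂ) ^ p • ((a : 𝔄) * x))
    (isClosed_eq (by fun_prop) (by fun_prop)) ?_ ?_ ?_ ha
  · intro a b ha hb
    rw [AddMemClass.coe_add, mul_add, ha, hb, add_mul, smul_add]
  · intro c a ha
    rw [Subalgebra.coe_smul, mul_smul_comm, ha, smul_mul_assoc, smul_comm]
  · intro l hl
    rw [coe_grass_list_prod, anticomm_list_prod l fun h _ => hx h, neg_one_pow_congr hl]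

theorem comm_grass {x : 𝔄} (hx : ∀ h : T.QHᗮ, x * C.G h = C.G h * x) (a : C.grass) :
    x * (a : 𝔄) = (a : 𝔄) * x := by
  refine C.grass_induction (P := fun a => x * (a : 𝔄) = (a : 𝔄) * x)
    (isClosed_eq (by fun_prop) (by fun_prop)) ?_ ?_ ?_ a
  · intro a b ha hb
    rw [AddMemClass.coe_add, mul_add, ha, hb, add_mul]
  · intro c a ha
    rw [Subalgebra.coe_smul, mul_smul_comm, ha, smul_mul_assoc]
  · intro l
    rw [coe_grass_list_prod]
    refine Commute.list_prod_right _ _ fun y hy => ?_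
    obtain ⟨h, -, rfl⟩ := List.mem_map.1 hy
    exact hx h

theorem G_mul_graded (f : H) {p : ℕ} {a : C.grass} (ha : a ∈ C.grassGraded p) :
    C.G f * (a : 𝔄) = (-1 : ℂ) ^ p • ((a : 𝔄) * C.G f) :=
  C.anticomm_graded (fun h => C.G_anticomm_perp f h.2) ha

theorem graded_mul_comm {p q : ℕ} {a b : C.grass} (ha : a ∈ C.grassGraded p)
    (hb : b ∈ C.grassGraded q) : a * b = (-1 : ℂ) ^ (p * q) • (b * a) := by
  refine C.grassGraded_induction (P := fun a => a * b = (-1 : ℂ) ^ (p * q) • (b * a))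
    (isClosed_eq (by fun_prop) (by fun_prop)) ?_ ?_ ?_ ha
  · intro a b ha hb
    rw [add_mul, ha, hb, mul_add, smul_add]
  · intro c a ha
    rw [smul_mul_assoc, ha, mul_smul_comm, smul_comm]
  · intro l hl
    have h1 : ∀ l : List T.QHᗮ, (l.map C.grassField).prod * b =
        (-1 : ℂ) ^ (l.length * q) • (b * (l.map C.grassField).prod) := by
      intro l
      induction l with
      | nil => simp
      | cons h l ih =>
        have : C.grassField h * b = (-1 : ℂ) ^ q • (b * C.grassField h) :=
          Subtype.ext (C.G_mul_graded h hb)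
        rw [List.map_cons, List.prod_cons, mul_assoc, ih, mul_smul_comm, ← mul_assoc, this,
          smul_mul_assoc, smul_smul, mul_assoc, List.length_cons, add_mul, one_mul, pow_add]
    rw [h1, neg_one_pow_congr (hl.mul_right q)]

theorem graded_mul_mem {p q : ℕ} {a b : C.grass} (ha : a ∈ C.grassGraded p)
    (hb : b ∈ C.grassGraded q) : a * b ∈ C.grassGraded (p + q) := by
  have hclosed : IsClosed (C.grassGraded (p + q) : Set C.grass) :=
    Submodule.isClosed_topologicalClosure _
  refine C.grassGraded_induction (P := fun a => a * b ∈ C.grassGraded (p + q))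
    (hclosed.preimage (continuous_mul_const b)) ?_ ?_ ?_ ha
  · intro a b ha hb
    rw [add_mul]; exact add_mem ha hb
  · intro c a ha
    rw [smul_mul_assoc]; exact Submodule.smul_mem _ _ ha
  · intro l hl
    refine C.grassGraded_induction
      (P := fun b => (l.map C.grassField).prod * b ∈ C.grassGraded (p + q))
      (hclosed.preimage (continuous_const_mul _)) ?_ ?_ ?_ hb
    · intro a b ha hb
      rw [mul_add]; exact add_mem ha hb
    · intro c a ha
      rw [mul_smul_comm]; exact Submodule.smul_mem _ _ ha
    · intro l' hl'
      rw [← List.prod_append, ← List.map_append]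
      refine Submodule.le_topologicalClosure _ (Submodule.subset_span ⟨l ++ l', ?_, rfl⟩)
      rw [List.length_append]
      exact hl.add hl'

/-- Used to read a product of two odd elements, of degree 1 + 1, as an element of degree 0. -/
theorem grassGraded_congr {p q : ℕ} (h : p ≡ q [MOD 2]) : C.grassGraded p = C.grassGraded q := by
  unfold grassGraded
  have : ∀ n : ℕ, n ≡ p [MOD 2] ↔ n ≡ q [MOD 2] := fun n => ⟨fun h' => h'.trans h,
    fun h' => h'.trans h.symm⟩
  simp only [this]

theorem list_prod_mem_graded (l : List T.QHᗮ) :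
    (l.map C.grassField).prod ∈ C.grassGraded l.length :=
  Submodule.le_topologicalClosure _ (Submodule.subset_span ⟨l, rfl, rfl⟩)

theorem grassField_mem_graded (h : T.QHᗮ) : C.grassField h ∈ C.grassGraded 1 := by
  simpa using C.list_prod_mem_graded [h]

theorem graded_mul_self {a : C.grass} (ha : a ∈ C.grassGraded 1) : a * a = 0 := by
  have h := C.graded_mul_comm ha ha
  have h2 : (2 : ℂ) • (a * a) = 0 := by
    rw [two_smul]
    nth_rewrite 1 [h]
    simp
  exact (smul_eq_zero.1 h2).resolve_left two_ne_zero

theorem graded_anticomm {a b : C.grass} (ha : a ∈ C.grassGraded 1) (hb : b ∈ C.grassGraded 1) :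
    a * b = -(b * a) := by
  have h := C.graded_mul_comm ha hb
  simpa using h

theorem even_comm_grass {a : C.grass} (ha : a ∈ C.grassGraded 0) (b : C.grass) :
    a * b = b * a := by
  refine Subtype.ext (C.comm_grass (x := (a : 𝔄)) (fun h => ?_) b)
  have := C.G_mul_graded (h : H) ha
  simpa using this.symm

end CARAlgebra

end GAR

/-! ### Real vectors, and the involution on the abstract Grassmann algebra -/

namespace GAR

namespace Conjugation

variable {E : Type*} [NormedAddCommGroup E] [InnerProductSpace ℂ E] (J : Conjugation E)

theorem inner_map_map (f g : E) : ⟪J f, J g⟫_ℂ = ⟪g, f⟫_ℂ := Construction.inner_conj J f g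

theorem inner_right (f g : E) : ⟪f, J g⟫_ℂ = ⟪g, J f⟫_ℂ := by
  rw [← J.inner_map_map, J.involutive]

/-- A finite-dimensional Hilbert space with conjugation has a real orthonormal basis. -/
theorem exists_real_orthonormalBasis [FiniteDimensional ℂ E] :
    ∃ b : OrthonormalBasis (Fin (Module.finrank ℂ E)) ℂ E, ∀ i, J (b i) = b i := by
  have : CompleteSpace E := FiniteDimensional.complete ℂ E
  obtain ⟨w, b, hb⟩ := Construction.exists_real_basis J
  have hfin : Finite w := b.orthonormal.linearIndependent.finite
  have : Fintype w := Fintype.ofFinite w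
  have hc : Fintype.card w = Module.finrank ℂ E :=
    (Module.finrank_eq_card_basis b.toOrthonormalBasis.toBasis).symm
  refine ⟨b.toOrthonormalBasis.reindex (Fintype.equivFinOfCardEq hc), fun i => ?_⟩
  rw [OrthonormalBasis.reindex_apply, HilbertBasis.coe_toOrthonormalBasis]
  exact hb _

/-- In an infinite-dimensional space there are real unit vectors orthogonal to a given
finite-dimensional subspace. -/
theorem exists_real_unit_perp [CompleteSpace E] (hinf : ¬ FiniteDimensional ℂ E)
    (V : Submodule ℂ E) [FiniteDimensional ℂ V] :
    ∃ e : E, ‖e‖ = 1 ∧ J e = e ∧ ∀ h ∈ V, ⟪e, h⟫_ℂ = 0 := by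
  obtain ⟨S, hS⟩ : V.FG := (Submodule.fg_iff_finiteDimensional V).2 inferInstance
  -- Including the conjugates makes both x and J x orthogonal to S whenever x is orthogonal to W.
  set W : Submodule ℂ E := Submodule.span ℂ ((S : Set E) ∪ J '' S) with hW
  have hWfin : FiniteDimensional ℂ W :=
    FiniteDimensional.span_of_finite ℂ (S.finite_toSet.union (S.finite_toSet.image _))
  have hne : Wᗮ ≠ ⊥ := by
    intro h
    rw [Submodule.orthogonal_eq_bot_iff] at h
    rw [h] at hWfin
    exact hinf (Module.Finite.equiv (Submodule.topEquiv (R := ℂ) (M := E)))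
  obtain ⟨x, hx, hx0⟩ := Submodule.exists_mem_ne_zero_of_ne_bot hne
  have key : ∃ u : E, u ≠ 0 ∧ J u = u ∧ ∀ s ∈ S, ⟪u, s⟫_ℂ = 0 := by
    rw [Submodule.mem_orthogonal'] at hx
    have h1 : ∀ s ∈ S, ⟪x, s⟫_ℂ = 0 := fun s hs => hx s (Submodule.subset_span (Or.inl hs))
    have h2 : ∀ s ∈ S, ⟪J x, s⟫_ℂ = 0 := fun s hs => by
      rw [J.inner_left, ← inner_conj_symm, hx _ (Submodule.subset_span (Or.inr ⟨s, hs, rfl⟩)),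
        map_zero]
    -- The real part x + J x serves as the vector unless it vanishes; in that case J x = -x and the
    -- multiple i x is real.
    by_cases h0 : x + J x = 0
    · refine ⟨Complex.I • x, smul_ne_zero Complex.I_ne_zero hx0, ?_, fun s hs => ?_⟩
      · rw [map_smulₛₗ, Complex.conj_I, eq_neg_of_add_eq_zero_right h0]
        simp
      · rw [inner_smul_left, h1 s hs, mul_zero]
    · refine ⟨x + J x, h0, ?_, fun s hs => ?_⟩
      · rw [map_add, J.involutive, add_comm]
      · rw [inner_add_left, h1 s hs, h2 s hs, add_zero]
  obtain ⟨u, hu0, hu, hus⟩ := key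
  refine ⟨((‖u‖⁻¹ : ℝ) : ℂ) • u, ?_, ?_, fun h hh => ?_⟩
  · rw [norm_smul, Complex.norm_real, norm_inv, norm_norm, inv_mul_cancel₀ (norm_ne_zero_iff.2 hu0)]
  · rw [map_smulₛₗ, hu, Complex.conj_ofReal]
  · rw [inner_smul_left]
    have : ⟪u, h⟫_ℂ = 0 := by
      rw [← hS] at hh
      induction hh using Submodule.span_induction with
      | mem s hs => exact hus s hs
      | zero => exact inner_zero_right _
      | add x y _ _ hx hy => rw [inner_add_right, hx, hy, add_zero]
      | smul c x _ hx => rw [inner_smul_right, hx, mul_zero]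
    rw [this, mul_zero]

section ExtStar

open ExteriorAlgebra

theorem extMap_ι (f : E) : J.extMap (ι ℂ f) = (ι ℂ (J f) : ExteriorAlgebra ℂ E) :=
  ExteriorAlgebra.lift_ι_apply ℂ (A := ConjExterior E) _ _ f

theorem extStar_ι (f : E) : J.extStar (ι ℂ f) = ι ℂ (J f) := by
  rw [extStar, extMap_ι]
  exact CliffordAlgebra.reverse_ι _

theorem extStar_algebraMap (c : ℂ) :
    J.extStar (algebraMap ℂ _ c) = algebraMap ℂ _ (starRingEnd ℂ c) := by
  have : J.extMap (algebraMap ℂ _ c) =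
      (algebraMap ℂ (ExteriorAlgebra ℂ E) (starRingEnd ℂ c) : ExteriorAlgebra ℂ E) :=
    AlgHom.commutes J.extMap c
  rw [extStar, this]
  exact CliffordAlgebra.reverse.commutes _

theorem extStar_add (a b : ExteriorAlgebra ℂ E) :
    J.extStar (a + b) = J.extStar a + J.extStar b := by
  have : J.extMap (a + b) =
      ((J.extMap a : ExteriorAlgebra ℂ E) + (J.extMap b : ExteriorAlgebra ℂ E)) :=
    map_add J.extMap a b
  rw [extStar, this]
  exact map_add CliffordAlgebra.reverse _ _

theorem extStar_mul (a b : ExteriorAlgebra ℂ E) :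
    J.extStar (a * b) = J.extStar b * J.extStar a := by
  have : J.extMap (a * b) =
      ((J.extMap a : ExteriorAlgebra ℂ E) * (J.extMap b : ExteriorAlgebra ℂ E)) :=
    map_mul J.extMap a b
  rw [extStar, this]
  exact CliffordAlgebra.reverse.map_mul _ _

theorem extStar_smul (c : ℂ) (a : ExteriorAlgebra ℂ E) :
    J.extStar (c • a) = starRingEnd ℂ c • J.extStar a := by
  rw [Algebra.smul_def, extStar_mul, extStar_algebraMap, Algebra.smul_def, Algebra.commutes]

theorem extStar_extStar (a : ExteriorAlgebra ℂ E) : J.extStar (J.extStar a) = a := by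
  induction a using ExteriorAlgebra.induction with
  | algebraMap c => rw [extStar_algebraMap, extStar_algebraMap, Complex.conj_conj]
  | ι f => rw [extStar_ι, extStar_ι, J.involutive]
  | mul a b ha hb => rw [extStar_mul, extStar_mul, ha, hb]
  | add a b ha hb => rw [extStar_add, extStar_add, ha, hb]

/-- The adjoint `⋆` on the Grassmann algebra as an antilinear map. -/
noncomputable def extStarₗ : ExteriorAlgebra ℂ E →ₗ⋆[ℂ] ExteriorAlgebra ℂ E where
  toFun := J.extStar
  map_add' := J.extStar_add
  map_smul' := J.extStar_smul

end ExtStar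

end Conjugation

/-- An element of the exterior algebra is a polynomial in finitely many vectors. The subspace V
depends on x alone, so the intertwiner U may be chosen after V is known, for instance from a vector
orthogonal to V. -/
theorem exists_finiteDimensional_intertwine {E : Type*} [AddCommGroup E] [Module ℂ E]
    (x : ExteriorAlgebra ℂ E) :
    ∃ V : Submodule ℂ E, FiniteDimensional ℂ V ∧ ∀ {R : Type*} [Ring R] [Algebra ℂ R]
      (p q : ExteriorAlgebra ℂ E →ₐ[ℂ] R) (U : R),
      (∀ h ∈ V, U * p (ExteriorAlgebra.ι ℂ h) = q (ExteriorAlgebra.ι ℂ h) * U) →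
        U * p x = q x * U := by
  induction x using ExteriorAlgebra.induction with
  | algebraMap c =>
    refine ⟨⊥, inferInstance, fun p q U _ => ?_⟩
    rw [AlgHom.commutes, AlgHom.commutes, Algebra.commutes]
  | ι f =>
    exact ⟨Submodule.span ℂ {f}, inferInstance, fun p q U h => h f
      (Submodule.mem_span_singleton_self f)⟩
  | mul a b ha hb =>
    obtain ⟨V, hV, h1⟩ := ha
    obtain ⟨V', hV', h2⟩ := hb
    refine ⟨V ⊔ V', inferInstance, fun p q U h => ?_⟩
    rw [map_mul, map_mul, ← mul_assoc, h1 p q U fun x hx => h x (Submodule.mem_sup_left hx),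
      mul_assoc, h2 p q U fun x hx => h x (Submodule.mem_sup_right hx), mul_assoc]
  | add a b ha hb =>
    obtain ⟨V, hV, h1⟩ := ha
    obtain ⟨V', hV', h2⟩ := hb
    refine ⟨V ⊔ V', inferInstance, fun p q U h => ?_⟩
    rw [map_add, map_add, mul_add, add_mul,
      h1 p q U fun x hx => h x (Submodule.mem_sup_left hx),
      h2 p q U fun x hx => h x (Submodule.mem_sup_right hx)]

namespace Triple

variable {H : Type*} [NormedAddCommGroup H] [InnerProductSpace ℂ H] (T : Triple H)

/-- The restriction of `J` to `Q^⊥H`. -/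
noncomputable def Jperp : Conjugation T.QHᗮ := T.J.restrict T.QHᗮ T.J_mem_perp

@[simp] theorem coe_Jperp (h : T.QHᗮ) : (T.Jperp h : H) = T.J h := rfl

@[simp] theorem coe_JQ (h : T.QH) : (T.JQ h : H) = T.J h := rfl

end Triple

namespace CARAlgebra

variable {H : Type*} [NormedAddCommGroup H] [InnerProductSpace ℂ H] {T : Triple H}
  {𝔄 : Type*} [CStarAlgebra 𝔄] (C : CARAlgebra T.conjQ 𝔄)

/-! ### Selfadjoint unitaries of degree one -/

/-- The operator `G e + (G e)*`. -/
noncomputable def maj (e : T.QHᗮ) : 𝔄 := C.G e + star (C.G e)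

theorem star_maj (e : T.QHᗮ) : star (C.maj e) = C.maj e := by
  rw [maj, star_add, star_star, add_comm]

theorem star_G_sq (e : T.QHᗮ) : star (C.G e) * star (C.G e) = 0 := by
  rw [← star_mul, C.G_sq_perp e.2, star_zero]

theorem G_mul_star_add {e : T.QHᗮ} (he : ‖e‖ = 1) :
    C.G e * star (C.G e) + star (C.G e) * C.G e = 1 := by
  rw [C.G_anticomm_star _ e.2, inner_self_eq_norm_sq_to_K]
  have : ‖(e : H)‖ = 1 := he
  simp [this]

theorem maj_sq {e : T.QHᗮ} (he : ‖e‖ = 1) : C.maj e * C.maj e = 1 := by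
  rw [maj, add_mul, mul_add, mul_add, C.G_sq_perp e.2, star_G_sq, zero_add, add_zero,
    C.G_mul_star_add he]

theorem star_G_anticomm {e : T.QHᗮ} {f : H} (h : ⟪(e : H), f⟫_ℂ = 0) :
    star (C.G e) * C.G f = -(C.G f * star (C.G e)) := by
  have := C.G_anticomm_star f e.2
  rw [h, map_zero, add_comm] at this
  exact eq_neg_of_add_eq_zero_left this

/-- G f anticommutes with G e because e lies in Q^⊥H, and with (G e)* because e is orthogonal to f.
-/
theorem maj_anticomm {e : T.QHᗮ} {f : H} (h : ⟪(e : H), f⟫_ℂ = 0) :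
    C.maj e * C.G f = -(C.G f * C.maj e) := by
  rw [maj, add_mul, mul_add, C.star_G_anticomm h, neg_add]
  congr 1
  rw [← neg_eq_iff_eq_neg]
  exact (C.G_anticomm_perp f e.2).symm

theorem maj_anticomm_ferm (e : T.QHᗮ) {f : H} (hf : f ∈ T.QH) :
    C.maj e * C.G f = -(C.G f * C.maj e) :=
  C.maj_anticomm (by rw [← inner_conj_symm, e.2 f hf, map_zero])

theorem maj_mul_G (e : T.QHᗮ) : C.maj e * C.G e = star (C.G e) * C.maj e := by
  rw [maj, add_mul, mul_add, C.G_sq_perp e.2, star_G_sq, zero_add, add_zero]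

/-- Finitely many fields anticommute with a common selfadjoint unitary. -/
theorem exists_parity [CompleteSpace H] (hinf : ¬ FiniteDimensional ℂ T.QHᗮ)
    (V : Submodule ℂ T.QHᗮ) [FiniteDimensional ℂ V] :
    ∃ D : 𝔄, star D = D ∧ D * D = 1 ∧ (∀ f ∈ T.QH, D * C.G f = -(C.G f * D)) ∧
      ∀ h ∈ V, D * C.G (h : H) = -(C.G (h : H) * D) := by
  obtain ⟨e, he, -, heV⟩ := T.Jperp.exists_real_unit_perp hinf V
  exact ⟨C.maj e, C.star_maj e, C.maj_sq he, fun f hf => C.maj_anticomm_ferm e hf,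
    fun h hh => C.maj_anticomm (heV h hh)⟩

theorem norm_conj_le {D x : 𝔄} (h : star D = D) (h2 : D * D = 1) : ‖D * x * D‖ ≤ ‖x‖ := by
  have hD : ‖D‖ ≤ 1 := by
    have h3 := CStarRing.norm_star_mul_self (x := D)
    rw [h, h2] at h3
    rcases subsingleton_or_nontrivial 𝔄 with hs | hs
    · simp [Subsingleton.elim D 0]
    · rw [CStarRing.norm_one] at h3
      nlinarith [norm_nonneg D]
  calc ‖D * x * D‖ ≤ ‖D‖ * ‖x‖ * ‖D‖ :=
        (norm_mul_le _ _).trans (mul_le_mul_of_nonneg_right (norm_mul_le _ _) (norm_nonneg _))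
    _ ≤ 1 * ‖x‖ * 1 := by gcongr
    _ = ‖x‖ := by ring

/-! ### The adjoint of the Grassmann part -/

/-- U is the product of the `maj e`. A field moving past it collects one sign per factor, except
that `maj e` turns its own G e into the adjoint without a sign; this explains the extra -1 for
members of the list. -/
theorem exists_swap_list (l : List T.QHᗮ) (hn : ∀ e ∈ l, ‖e‖ = 1)
    (ho : l.Pairwise fun e e' => ⟪e, e'⟫_ℂ = 0) :
    ∃ U : 𝔄, star U * U = 1 ∧ U * star U = 1 ∧
      (∀ e ∈ l, U * C.G (e : H) = -(-1 : ℂ) ^ l.length • (star (C.G (e : H)) * U)) ∧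
      ∀ h : T.QHᗮ, (∀ e ∈ l, ⟪e, h⟫_ℂ = 0) →
        U * C.G (h : H) = (-1 : ℂ) ^ l.length • (C.G (h : H) * U) := by
  induction l with
  | nil => exact ⟨1, by simp⟩
  | cons e l ih =>
    rw [List.pairwise_cons] at ho
    obtain ⟨U, h1, h2, h3, h4⟩ := ih (fun x hx => hn x (by simp [hx])) ho.2
    have he := hn e (by simp)
    have hsymm : ∀ x ∈ l, ⟪x, e⟫_ℂ = 0 := fun x hx => by
      rw [← inner_conj_symm, ho.1 x hx, map_zero]
    refine ⟨C.maj e * U, ?_, ?_, ?_, ?_⟩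
    · rw [star_mul, C.star_maj, mul_assoc, ← mul_assoc _ _ U, C.maj_sq he, one_mul, h1]
    · rw [star_mul, C.star_maj, mul_assoc, ← mul_assoc U, h2, one_mul, C.maj_sq he]
    · intro x hx
      rcases List.mem_cons.1 hx with rfl | hx
      · rw [mul_assoc, h4 x hsymm, mul_smul_comm, ← mul_assoc, C.maj_mul_G, List.length_cons,
          pow_succ, mul_assoc]
        simp
      · have h5 : C.maj e * star (C.G (x : H)) = -(star (C.G (x : H)) * C.maj e) := by
          have := congrArg star (C.maj_anticomm (e := e) (f := x) (ho.1 x hx))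
          rw [star_neg, star_mul, star_mul, C.star_maj] at this
          rw [this, neg_neg]
        rw [mul_assoc, h3 x hx, mul_smul_comm, ← mul_assoc, h5, List.length_cons, pow_succ]
        simp [mul_assoc]
    · intro h hh
      rw [mul_assoc, h4 h fun x hx => hh x (by simp [hx]), mul_smul_comm, ← mul_assoc,
        C.maj_anticomm (f := (h : H)) (hh e (by simp)), List.length_cons, pow_succ]
      simp [mul_assoc]

/-- On finitely many vectors the assignments h ↦ G h and h ↦ (G (J h))* are unitarily equivalent.
This is the source of the isometry of ⋆. -/
theorem exists_swap [CompleteSpace H] (hinf : ¬ FiniteDimensional ℂ T.QHᗮ)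
    (V : Submodule ℂ T.QHᗮ) [FiniteDimensional ℂ V] :
    ∃ U : 𝔄, star U * U = 1 ∧ U * star U = 1 ∧
      ∀ h ∈ V, U * C.G (h : H) = star (C.G (T.Jperp h : H)) * U := by
  -- a finite-dimensional invariant subspace with a real basis
  obtain ⟨S, hS⟩ : V.FG := (Submodule.fg_iff_finiteDimensional V).2 inferInstance
  set W : Submodule ℂ T.QHᗮ := Submodule.span ℂ ((S : Set T.QHᗮ) ∪ T.Jperp '' S) with hW
  have hWfin : FiniteDimensional ℂ W :=
    FiniteDimensional.span_of_finite ℂ (S.finite_toSet.union (S.finite_toSet.image _))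
  have hVW : V ≤ W := by
    rw [← hS]
    exact Submodule.span_mono Set.subset_union_left
  have hJW : ∀ f ∈ W, T.Jperp f ∈ W := by
    intro f hf
    induction hf using Submodule.span_induction with
    | mem x hx =>
      rcases hx with hx | ⟨y, hy, rfl⟩
      · exact Submodule.subset_span (Or.inr ⟨x, hx, rfl⟩)
      · rw [T.Jperp.involutive]; exact Submodule.subset_span (Or.inl hy)
    | zero => rw [map_zero]; exact zero_mem _
    | add x y _ _ hx hy => rw [map_add]; exact add_mem hx hy
    | smul c x _ hx => rw [map_smulₛₗ]; exact Submodule.smul_mem _ _ hx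
  obtain ⟨b, hb⟩ := (T.Jperp.restrict W hJW).exists_real_orthonormalBasis
  set l : List T.QHᗮ := List.ofFn fun i => (b i : T.QHᗮ) with hl
  obtain ⟨U, h1, h2, h3, -⟩ := C.exists_swap_list l (by
      intro e he
      obtain ⟨i, rfl⟩ := (List.mem_ofFn' _ _).1 he
      exact b.orthonormal.1 i) (by
      rw [hl, List.pairwise_ofFn]
      intro i j hij
      exact b.orthonormal.2 hij.ne)
  have key : ∃ U : 𝔄, star U * U = 1 ∧ U * star U = 1 ∧
      ∀ e ∈ l, U * C.G (e : H) = star (C.G (e : H)) * U := by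
    rcases Nat.even_or_odd l.length with hev | hod
    -- For an even number of factors the swap carries the wrong sign; a parity operator for W
    -- corrects it.
    · obtain ⟨D, d1, d2, -, d3⟩ := C.exists_parity hinf W
      refine ⟨D * U, ?_, ?_, fun e he => ?_⟩
      · rw [star_mul, d1, mul_assoc, ← mul_assoc D, d2, one_mul, h1]
      · rw [star_mul, d1, mul_assoc, ← mul_assoc U, h2, one_mul, d2]
      · have heW : e ∈ W := by
          obtain ⟨i, rfl⟩ := (List.mem_ofFn' _ _).1 he
          exact (b i).2
        have h5 : D * star (C.G (e : H)) = -(star (C.G (e : H)) * D) := by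
          have := congrArg star (d3 e heW)
          rw [star_neg, star_mul, star_mul, d1] at this
          rw [this, neg_neg]
        rw [mul_assoc, h3 e he, hev.neg_one_pow, mul_smul_comm, ← mul_assoc, h5]
        simp [mul_assoc]
    · refine ⟨U, h1, h2, fun e he => ?_⟩
      rw [h3 e he, hod.neg_one_pow]
      simp
  obtain ⟨U, h1, h2, h3⟩ := key
  refine ⟨U, h1, h2, fun h hh => ?_⟩
  -- Both sides of the claim are linear in h, since conjugation and adjoint are each antilinear; so
  -- the real basis suffices.
  have hexp : h = ∑ i, ⟪b i, (⟨h, hVW hh⟩ : W)⟫_ℂ • (b i : T.QHᗮ) := by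
    have := congrArg (W.subtype) (b.sum_repr' ⟨h, hVW hh⟩)
    simpa using this.symm
  have hi : ∀ i, U * C.G ((b i : T.QHᗮ) : H) = star (C.G ((b i : T.QHᗮ) : H)) * U := fun i =>
    h3 _ ((List.mem_ofFn' _ _).2 ⟨i, rfl⟩)
  have hJ : ∀ i, T.J ((b i : T.QHᗮ) : H) = ((b i : T.QHᗮ) : H) := fun i =>
    congrArg (fun x : W => ((x : T.QHᗮ) : H)) (hb i)
  rw [hexp]
  simp only [T.coe_Jperp, Submodule.coe_sum, Submodule.coe_smul, map_sum, map_smulₛₗ, star_sum,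
    star_smul, Finset.mul_sum, Finset.sum_mul, mul_smul_comm, smul_mul_assoc, hi, hJ]
  simp

/-- The Grassmann algebra over `Q^⊥H`, mapped to the Grassmann part. -/
noncomputable def toGrass : ExteriorAlgebra ℂ T.QHᗮ →ₐ[ℂ] C.grass :=
  ExteriorAlgebra.lift ℂ ⟨C.grassField, fun h => Subtype.ext (C.G_sq_perp h.2)⟩

theorem toGrass_ι (h : T.QHᗮ) : C.toGrass (ExteriorAlgebra.ι ℂ h) = C.grassField h :=
  ExteriorAlgebra.lift_ι_apply _ _ _ _

/-- The representation of the Grassmann algebra over `Q^⊥H` with `h ↦ (G (J h))*`. -/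
noncomputable def toStarGrass : ExteriorAlgebra ℂ T.QHᗮ →ₐ[ℂ] 𝔄 :=
  ExteriorAlgebra.lift ℂ ⟨
    { toFun := fun h => star (C.G (T.Jperp h : H))
      map_add' := fun f g => by rw [map_add, Submodule.coe_add, map_add, star_add]
      map_smul' := fun c f => by
        rw [map_smulₛₗ, Submodule.coe_smul, map_smul, star_smul]; simp },
    fun h => C.star_G_sq _⟩

theorem toStarGrass_ι (h : T.QHᗮ) :
    C.toStarGrass (ExteriorAlgebra.ι ℂ h) = star (C.G (T.Jperp h : H)) :=
  ExteriorAlgebra.lift_ι_apply _ _ _ _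

/-- Both sides are antilinear, reverse products and agree on generators. It relates the C*-adjoint,
whose norm is known, to the Grassmann involution. -/
theorem star_toGrass (x : ExteriorAlgebra ℂ T.QHᗮ) :
    star (C.toGrass x : 𝔄) = C.toStarGrass (T.Jperp.extStar x) := by
  induction x using ExteriorAlgebra.induction with
  | algebraMap c =>
    rw [AlgHom.commutes, Conjugation.extStar_algebraMap, AlgHom.commutes,
      Subalgebra.coe_algebraMap, ← algebraMap_star_comm]
    rfl
  | ι f =>
    rw [toGrass_ι, Conjugation.extStar_ι, toStarGrass_ι, T.Jperp.involutive]
    rfl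
  | mul a b ha hb =>
    rw [map_mul, Subalgebra.coe_mul, star_mul, ha, hb, Conjugation.extStar_mul, map_mul]
  | add a b ha hb =>
    rw [map_add, Subalgebra.coe_add, star_add, ha, hb, Conjugation.extStar_add, map_add]

theorem norm_toStarGrass [CompleteSpace H] (hinf : ¬ FiniteDimensional ℂ T.QHᗮ)
    (x : ExteriorAlgebra ℂ T.QHᗮ) : ‖C.toStarGrass x‖ = ‖C.toGrass x‖ := by
  obtain ⟨V, hV, h⟩ := exists_finiteDimensional_intertwine x
  obtain ⟨U, h1, h2, h3⟩ := C.exists_swap hinf V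
  have h4 := h (C.grass.val.comp C.toGrass) C.toStarGrass U fun f hf => by
    rw [AlgHom.comp_apply, toGrass_ι, toStarGrass_ι]
    exact h3 f hf
  have hU : U ∈ unitary 𝔄 := Unitary.mem_iff.2 ⟨h1, h2⟩
  have h5 := congrArg norm h4
  rw [CStarRing.norm_mul_mem_unitary _ hU, CStarRing.norm_mem_unitary_mul _ hU] at h5
  exact h5.symm

theorem denseRange_toGrass : DenseRange C.toGrass := by
  intro a
  have hcoe : Set.range C.toGrass = ((LinearMap.range C.toGrass.toLinearMap) : Set C.grass) := rfl
  rw [hcoe, ← Submodule.topologicalClosure_coe]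
  refine C.grass_induction
    (P := fun a => a ∈ (LinearMap.range C.toGrass.toLinearMap).topologicalClosure)
    (Submodule.isClosed_topologicalClosure _) (fun a b => add_mem)
    (fun c a => Submodule.smul_mem _ c) (fun l => Submodule.le_topologicalClosure _
      ⟨(l.map (ExteriorAlgebra.ι ℂ)).prod, ?_⟩) a
  rw [AlgHom.toLinearMap_apply, map_list_prod, List.map_map]
  congr 2
  ext h
  rw [Function.comp_apply, toGrass_ι]

/-- On the dense image of the exterior algebra the involution is isometric: combine `star_toGrass`
with `norm_toStarGrass`. The norm bound makes it well defined and extends it by continuity, and its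
algebraic properties persist by density. -/
theorem isGrassAdjoint_grassAdjoint [CompleteSpace H] (hinf : ¬ FiniteDimensional ℂ T.QHᗮ) :
    C.IsGrassAdjoint C.grassAdjoint := by
  refine Classical.epsilon_spec (p := C.IsGrassAdjoint) ?_
  have hcomp : CompleteSpace C.grass :=
    (Subalgebra.isClosed_topologicalClosure _).completeSpace_coe
  set f : ExteriorAlgebra ℂ T.QHᗮ →ₗ⋆[ℂ] C.grass :=
    C.toGrass.toLinearMap.comp T.Jperp.extStarₗ with hf
  have hnorm : ∀ x, ‖f x‖ ≤ 1 * ‖C.toGrass.toLinearMap x‖ := by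
    intro x
    have h1 := C.norm_toStarGrass hinf (T.Jperp.extStar x)
    rw [← C.star_toGrass, norm_star] at h1
    rw [one_mul]
    exact h1.symm.le
  have hd : DenseRange C.toGrass.toLinearMap := C.denseRange_toGrass
  set s : C.grass →SL[starRingEnd ℂ] C.grass := f.extendOfNorm C.toGrass.toLinearMap with hs
  have hse : ∀ x, s (C.toGrass x) = C.toGrass (T.Jperp.extStar x) := fun x =>
    LinearMap.extendOfNorm_eq hd ⟨1, hnorm⟩ x
  refine ⟨s.toLinearMap, s.continuous, fun a => ?_, fun a b => ?_, fun h => ?_⟩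
  · refine hd.induction_on (p := fun a => s (s a) = a) a
      (isClosed_eq (by fun_prop) (by fun_prop)) fun x => ?_
    change s (s (C.toGrass x)) = C.toGrass x
    rw [hse, hse, Conjugation.extStar_extStar]
  · refine hd.induction_on₂ (p := fun a b => s (a * b) = s b * s a)
      (isClosed_eq (by fun_prop) (by fun_prop)) (fun x y => ?_) a b
    change s (C.toGrass x * C.toGrass y) = s (C.toGrass y) * s (C.toGrass x)
    rw [← map_mul, hse, hse, hse, Conjugation.extStar_mul, map_mul]
  · have := hse (ExteriorAlgebra.ι ℂ h)
    rw [toGrass_ι, Conjugation.extStar_ι, toGrass_ι] at this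
    exact this

/-! ### Annihilators of the Grassmann part -/

/-- (G e)* G e is a selfadjoint idempotent, so its norm ‖G e‖² equals its own square. -/
theorem norm_G_le_one {e : T.QHᗮ} (he : ‖e‖ = 1) : ‖C.G (e : H)‖ ≤ 1 := by
  have h1 := C.G_mul_star_add he
  set g := C.G (e : H)
  have h2 : (star g * g) * (star g * g) = star g * g := by
    have h3 : g * star g = 1 - star g * g := eq_sub_of_add_eq h1
    rw [mul_assoc, ← mul_assoc g, h3, sub_mul, one_mul, mul_assoc, C.G_sq_perp e.2, mul_zero,
      sub_zero]
  have h4 := CStarRing.norm_star_mul_self (x := star g * g)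
  rw [star_mul, star_star, h2, CStarRing.norm_star_mul_self] at h4
  by_contra! h5
  have h6 : 1 < ‖g‖ * ‖g‖ := by nlinarith
  nlinarith

/-- Products with all generators vanish only for zero. -/
theorem eq_zero_of_mul_grassField [CompleteSpace H] (hinf : ¬ FiniteDimensional ℂ T.QHᗮ)
    {a : C.grass} (ha : ∀ h, a * C.grassField h = 0) : a = 0 := by
  rw [← norm_le_zero_iff]
  refine le_of_forall_pos_le_add fun ε hε => ?_
  -- Thirds suffice because the bound will be ‖a‖ ≤ ‖a - x‖ + 2 ‖x g‖ for a generator g of norm at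
  -- most 1.
  obtain ⟨b, ⟨x, rfl⟩, hb⟩ := Metric.mem_closure_iff.1 (C.denseRange_toGrass a) (ε / 3)
    (by positivity)
  rw [dist_eq_norm] at hb
  obtain ⟨V, hV, hx⟩ := exists_finiteDimensional_intertwine x
  obtain ⟨e, he, -, heV⟩ := T.Jperp.exists_real_unit_perp hinf V
  obtain ⟨D, d1, d2, -, d3⟩ := C.exists_parity hinf (V ⊔ Submodule.span ℂ {e})
  set p : ExteriorAlgebra ℂ T.QHᗮ →ₐ[ℂ] 𝔄 := C.grass.val.comp C.toGrass with hp
  -- The parity automorphism of the exterior algebra absorbs the signs that arise when g* or D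
  -- passes through x.
  set q : ExteriorAlgebra ℂ T.QHᗮ →ₐ[ℂ] 𝔄 :=
    p.comp (ExteriorAlgebra.map (-LinearMap.id)) with hq
  have hpι : ∀ h, p (ExteriorAlgebra.ι ℂ h) = C.G h := fun h => by
    rw [hp, AlgHom.comp_apply, toGrass_ι]; rfl
  have hqι : ∀ h, q (ExteriorAlgebra.ι ℂ h) = -C.G h := fun h => by
    rw [hq, AlgHom.comp_apply, ExteriorAlgebra.map_apply_ι]
    rw [LinearMap.neg_apply, map_neg, map_neg, hpι]; rfl
  set g := C.G (e : H) with hg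
  have h1 : star g * q x = p x * star g := hx q p (star g) fun h hh => by
    rw [hpι, hqι, mul_neg, C.star_G_anticomm (f := (h : H)) (heV h hh), neg_neg]
  have h2 : D * p x = q x * D := hx p q D fun h hh => by
    rw [hpι, hqι, d3 h (Submodule.mem_sup_left hh), neg_mul]
  have h3 : D * g = -(g * D) :=
    d3 e (Submodule.mem_sup_right (Submodule.mem_span_singleton_self e))
  have hgn : ‖g‖ ≤ 1 := C.norm_G_le_one he
  have h4 : ‖q x * g‖ ≤ ‖p x * g‖ := by
    have : q x * g = -(D * (p x * g) * D) := by
      rw [← mul_assoc, h2, mul_assoc (q x), mul_assoc, h3, neg_mul,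
        mul_assoc g, d2, mul_one, mul_neg, neg_neg]
    rw [this, norm_neg]
    exact norm_conj_le d1 d2
  -- Inserting g g* + g* g = 1 and moving g* to the left recovers p x from its product with g. That
  -- product is small because a g = 0.
  have h5 : p x = p x * g * star g + star g * (q x * g) := by
    rw [← mul_assoc, h1, mul_assoc, mul_assoc, ← mul_add, C.G_mul_star_add he, mul_one]
  have h6 : ‖p x‖ ≤ ‖p x * g‖ + ‖p x * g‖ := by
    calc ‖p x‖ ≤ ‖p x * g‖ * ‖star g‖ + ‖star g‖ * ‖q x * g‖ := by
          conv_lhs => rw [h5]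
          exact (norm_add_le _ _).trans (add_le_add (norm_mul_le _ _) (norm_mul_le _ _))
      _ ≤ ‖p x * g‖ * 1 + 1 * ‖p x * g‖ := by
          rw [norm_star]
          gcongr
      _ = _ := by ring
  have h7 : ‖p x * g‖ ≤ ε / 3 := by
    have : p x * g = -(((a - C.toGrass x : C.grass) : 𝔄) * g) := by
      have h8 : (a : 𝔄) * g = 0 := congrArg Subtype.val (ha e)
      rw [Subalgebra.coe_sub, sub_mul, h8, zero_sub, neg_neg]
      rfl
    rw [this, norm_neg]
    calc _ ≤ ‖((a - C.toGrass x : C.grass) : 𝔄)‖ * ‖g‖ := norm_mul_le _ _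
      _ ≤ ε / 3 * 1 := by
        gcongr
        exact hb.le
      _ = ε / 3 := mul_one _
  have h8 : ‖a‖ ≤ ‖a - C.toGrass x‖ + ‖p x‖ := by
    have h9 : ‖p x‖ = ‖C.toGrass x‖ := rfl
    rw [h9]
    simpa using norm_add_le (a - C.toGrass x) (C.toGrass x)
  linarith

end CARAlgebra

end GAR

namespace GAR

/-! ### Ordered products -/

section SortedProd

variable {R : Type*} [Ring R] {ι : Type*} [LinearOrder ι]

/-- The product of the `y i`, `i ∈ I`, in increasing order. -/
def sortedProd (y : ι → R) (I : Finset ι) : R := (I.sort.map y).prod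

@[simp] theorem sortedProd_empty (y : ι → R) : sortedProd y ∅ = 1 := by simp [sortedProd]

theorem sortedProd_insert (y : ι → R) {a : ι} {I : Finset ι} (h : ∀ x ∈ I, a < x) :
    sortedProd y (insert a I) = y a * sortedProd y I := by
  rw [sortedProd, Finset.sort_insert _ (fun x hx => (h x hx).le) (fun ha => lt_irrefl a (h a ha)),
    List.map_cons, List.prod_cons, sortedProd]

variable [Algebra ℂ R]

/-- Straightening by induction on the smallest index a. The auxiliary set S is needed when i > a:
applied to the indices of S above a, the induction hypothesis yields only products in front of which
y a may again be placed. -/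
theorem mul_sortedProd_mem {y : ι → R} (hsq : ∀ i, ∃ c : ℂ, y i * y i = c • (1 : R))
    (hac : ∀ i j, i ≠ j → y i * y j = -(y j * y i)) (I : Finset ι) :
    ∀ (S : Set ι), (I : Set ι) ⊆ S → ∀ i ∈ S,
      y i * sortedProd y I ∈ Submodule.span ℂ (sortedProd y '' {J | (J : Set ι) ⊆ S}) := by
  induction I using Finset.induction_on_min with
  | empty =>
    intro S _ i hi
    refine Submodule.subset_span ⟨{i}, by simpa using hi, ?_⟩
    have := sortedProd_insert y (a := i) (I := ∅) (by simp)
    simpa using this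
  | insert a I ha ih =>
    intro S hS i hi
    have haS : a ∈ S := hS (by simp)
    have hIS : (I : Set ι) ⊆ S := fun x hx => hS (by simp [Finset.mem_coe.1 hx])
    rcases lt_trichotomy i a with h | rfl | h
    · refine Submodule.subset_span ⟨insert i (insert a I), ?_, ?_⟩
      · intro x hx
        rcases Finset.mem_insert.1 (Finset.mem_coe.1 hx) with rfl | hx
        · exact hi
        · exact hS hx
      · refine sortedProd_insert y fun x hx => ?_
        rcases Finset.mem_insert.1 hx with rfl | hx
        · exact h
        · exact h.trans (ha x hx)
    · obtain ⟨c, hc⟩ := hsq i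
      rw [sortedProd_insert y ha, ← mul_assoc, hc, smul_mul_assoc, one_mul]
      exact Submodule.smul_mem _ _ (Submodule.subset_span ⟨I, hIS, rfl⟩)
    · rw [sortedProd_insert y ha, ← mul_assoc, hac i a h.ne', neg_mul, mul_assoc]
      refine Submodule.neg_mem _ ?_
      have h1 := ih (S ∩ Set.Ioi a) (fun x hx => ⟨hIS hx, ha x hx⟩) i ⟨hi, h⟩
      have h2 : Submodule.span ℂ (sortedProd y '' {J | (J : Set ι) ⊆ S ∩ Set.Ioi a}) ≤
          (Submodule.span ℂ (sortedProd y '' {J | (J : Set ι) ⊆ S})).comap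
            (LinearMap.mulLeft ℂ (y a)) := by
        refine Submodule.span_le.2 ?_
        rintro _ ⟨J, hJ, rfl⟩
        refine Submodule.subset_span ⟨insert a J, ?_, ?_⟩
        · intro x hx
          rcases Finset.mem_insert.1 (Finset.mem_coe.1 hx) with rfl | hx
          · exact haS
          · exact (hJ hx).1
        · exact sortedProd_insert y fun x hx => (hJ hx).2
      exact h2 h1

/-- The ordered products span a left ideal of the algebra generated by the `y i`. -/
theorem mul_mem_span_sortedProd {y : ι → R} (hsq : ∀ i, ∃ c : ℂ, y i * y i = c • (1 : R))
    (hac : ∀ i j, i ≠ j → y i * y j = -(y j * y i)) (i : ι) {x : R}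
    (hx : x ∈ Submodule.span ℂ (Set.range (sortedProd y))) :
    y i * x ∈ Submodule.span ℂ (Set.range (sortedProd y)) := by
  have h2 : Submodule.span ℂ (Set.range (sortedProd y)) ≤
      (Submodule.span ℂ (Set.range (sortedProd y))).comap (LinearMap.mulLeft ℂ (y i)) := by
    refine Submodule.span_le.2 ?_
    rintro _ ⟨J, rfl⟩
    exact Submodule.span_mono (Set.image_subset_range _ _)
      (mul_sortedProd_mem hsq hac J Set.univ (Set.subset_univ _) i trivial)
  exact h2 hx

end SortedProd

/-- If unitaries `u i` anticommute with `y i` and commute with the other `y j` and with the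
coefficients, then the coefficients of `∑ y_J λ_J` are bounded by the sum. -/
theorem norm_coeff_le {𝔄 : Type*} [CStarAlgebra 𝔄] {ι : Type*} [LinearOrder ι] {y u : ι → 𝔄}
    (hu : ∀ i, u i ∈ unitary 𝔄) (hyu : ∀ i, y i ∈ unitary 𝔄)
    (huy : ∀ i, u i * y i = -(y i * u i)) (huy' : ∀ i j, i ≠ j → u i * y j = y j * u i)
    (s : Finset ι) : ∀ (a : Finset ι → 𝔄), (∀ i J, u i * a J = a J * u i) → ∀ I ⊆ s,
      ‖a I‖ ≤ ‖∑ J ∈ s.powerset, sortedProd y J * a J‖ := by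
  induction s using Finset.induction_on_min with
  | empty =>
    intro a _ I hI
    rw [Finset.subset_empty.1 hI]
    simp
  | insert k s hk ih =>
    intro a ha I hI
    have hks : k ∉ s := fun h => lt_irrefl k (hk k h)
    set Y := ∑ J ∈ s.powerset, sortedProd y J * a J with hY
    set Z := ∑ J ∈ s.powerset, sortedProd y J * a (insert k J) with hZ
    have hsum : ∑ J ∈ (insert k s).powerset, sortedProd y J * a J = Y + y k * Z := by
      rw [Finset.sum_powerset_insert hks, hZ, Finset.mul_sum]
      congr 1
      refine Finset.sum_congr rfl fun J hJ => ?_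
      rw [sortedProd_insert y fun x hx => hk x (Finset.mem_powerset.1 hJ hx), mul_assoc]
    have hcomm : ∀ J ⊆ s, u k * sortedProd y J = sortedProd y J * u k := by
      intro J hJ
      refine Commute.list_prod_right _ _ fun x hx => ?_
      obtain ⟨j, hj, rfl⟩ := List.mem_map.1 hx
      exact huy' k j (hk j (hJ ((Finset.mem_sort _).1 hj))).ne
    have hY' : u k * Y = Y * u k := by
      rw [hY, Finset.mul_sum, Finset.sum_mul]
      refine Finset.sum_congr rfl fun J hJ => ?_
      rw [← mul_assoc, hcomm J (Finset.mem_powerset.1 hJ), mul_assoc, ha, mul_assoc]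
    have hZ' : u k * Z = Z * u k := by
      rw [hZ, Finset.mul_sum, Finset.sum_mul]
      refine Finset.sum_congr rfl fun J hJ => ?_
      rw [← mul_assoc, hcomm J (Finset.mem_powerset.1 hJ), mul_assoc, ha, mul_assoc]
    -- Conjugation by u k flips the sign of the part containing y k. Sum and difference of the two
    -- expressions, which have equal norm, bound Y and Z separately.
    have h1 : u k * (Y + y k * Z) * star (u k) = Y - y k * Z := by
      rw [mul_add, hY', ← mul_assoc, huy, neg_mul, mul_assoc (y k), hZ', add_mul, neg_mul,
        mul_assoc, ← mul_assoc (y k), mul_assoc (y k * Z), Unitary.mul_star_self_of_mem (hu k)]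
      simp [sub_eq_add_neg]
    have h2 : ‖Y - y k * Z‖ = ‖Y + y k * Z‖ := by
      rw [← h1, CStarRing.norm_mul_mem_unitary _ (Unitary.star_mem (hu k)),
        CStarRing.norm_mem_unitary_mul _ (hu k)]
    have h3 : ‖Y‖ ≤ ‖Y + y k * Z‖ := by
      have : (2 : ℂ) • Y = (Y + y k * Z) + (Y - y k * Z) := by rw [two_smul]; abel
      have h4 := norm_add_le (Y + y k * Z) (Y - y k * Z)
      rw [← this, norm_smul, h2] at h4
      norm_num at h4
      linarith
    have h4 : ‖Z‖ ≤ ‖Y + y k * Z‖ := by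
      have : (2 : ℂ) • (y k * Z) = (Y + y k * Z) - (Y - y k * Z) := by rw [two_smul]; abel
      have h4 := norm_sub_le (Y + y k * Z) (Y - y k * Z)
      rw [← this, norm_smul, h2, CStarRing.norm_mem_unitary_mul _ (hyu k)] at h4
      norm_num at h4
      linarith
    rw [hsum]
    by_cases hkI : k ∈ I
    -- Coefficients of products containing y k are coefficients of Z, so the induction hypothesis
    -- applies to the shifted family.
    · have h5 := ih (fun J => a (insert k J)) (fun i J => ha i _) (I.erase k) (by
        intro x hx
        rw [Finset.mem_erase] at hx
        exact (Finset.mem_insert.1 (hI hx.2)).resolve_left hx.1)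
      rw [Finset.insert_erase hkI] at h5
      exact h5.trans h4
    · refine (ih a ha I fun x hx => ?_).trans h3
      exact (Finset.mem_insert.1 (hI hx)).resolve_left fun h => hkI (h ▸ hx)

theorem closure_adjoin_induction {𝔄 : Type*} [CStarAlgebra 𝔄] {s : Set 𝔄} {P : 𝔄 → Prop}
    (hcl : IsClosed {a | P a}) (hadd : ∀ a b, P a → P b → P (a + b))
    (hsmul : ∀ (c : ℂ) a, P a → P (c • a)) (hl : ∀ l : List 𝔄, (∀ x ∈ l, x ∈ s) → P l.prod)
    {x : 𝔄} (hx : x ∈ (Algebra.adjoin ℂ s).topologicalClosure) : P x := by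
  have h0 : P 0 := by
    have := hsmul 0 _ (hl [] (by simp))
    rwa [zero_smul] at this
  set K : Submodule ℂ 𝔄 := ⟨⟨⟨{a | P a}, fun {a b} => hadd a b⟩, h0⟩, fun c {a} => hsmul c a⟩
  have h1 : Subalgebra.toSubmodule (Algebra.adjoin ℂ s) ≤ K := by
    rw [Algebra.adjoin_eq_span]
    refine Submodule.span_le.2 fun y hy => ?_
    obtain ⟨l, hl', rfl⟩ := Submonoid.exists_list_of_mem_closure hy
    exact hl l hl'
  exact closure_minimal h1 hcl hx

/-! ### The GAR algebra as a product of its two parts; G-extensions -/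

namespace CARAlgebra

variable {H : Type*} [NormedAddCommGroup H] [InnerProductSpace ℂ H] {T : Triple H}
  {𝔄 : Type*} [CStarAlgebra 𝔄] (C : CARAlgebra T.conjQ 𝔄)

theorem fermField_anticomm (f h : T.QH) :
    C.fermField f * C.fermField h + C.fermField h * C.fermField f =
      ⟪T.JQ f, h⟫_ℂ • (1 : C.ferm) := by
  refine Subtype.ext ?_
  have := C.G_anticomm_ferm f.2 h
  rw [Algebra.algebraMap_eq_smul_one] at this
  exact this

theorem star_fermField (f : T.QH) : star (C.fermField f) = C.fermField (T.JQ f) :=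
  Subtype.ext (C.star_G f f.2)

theorem coe_ferm_sortedProd {ι : Type*} [LinearOrder ι] (y : ι → C.ferm) (I : Finset ι) :
    ((sortedProd y I : C.ferm) : 𝔄) = sortedProd (fun i => (y i : 𝔄)) I := by
  change C.ferm.subtype _ = _
  rw [sortedProd, map_list_prod, List.map_map]
  rfl

theorem fermField_sq {e : T.QH} (he : ‖e‖ = 1) (hJ : T.JQ e = e) :
    C.fermField e * C.fermField e = (1 / 2 : ℂ) • (1 : C.ferm) := by
  have h := C.fermField_anticomm e e
  rw [hJ, inner_self_eq_norm_sq_to_K, he, ← two_smul ℂ] at h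
  have h2 := congrArg (fun x => (1 / 2 : ℂ) • x) h
  simpa [smul_smul] using h2

theorem fermField_anticomm_basis {ι : Type*} {e : ι → T.QH} (he : Orthonormal ℂ e)
    (hJ : ∀ i, T.JQ (e i) = e i) {i j : ι} (hij : i ≠ j) :
    C.fermField (e i) * C.fermField (e j) = -(C.fermField (e j) * C.fermField (e i)) := by
  have h := C.fermField_anticomm (e i) (e j)
  rw [hJ, he.2 hij, zero_smul] at h
  exact eq_neg_of_add_eq_zero_left h

/-- The multiplication map from the fermionic and the Grassmann part to the GAR algebra. -/
noncomputable def mulMap : C.ferm ⊗[ℂ] C.grass →ₗ[ℂ] C.gar :=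
  TensorProduct.lift ((LinearMap.mul ℂ C.gar).compl₁₂ C.fermIncl.toLinearMap
    C.grassIncl.toLinearMap)

@[simp] theorem mulMap_tmul (A : C.ferm) (a : C.grass) :
    C.mulMap (A ⊗ₜ a) = C.fermIncl A * C.grassIncl a := rfl

theorem coe_mulMap_tmul (A : C.ferm) (a : C.grass) :
    ((C.mulMap (A ⊗ₜ a) : C.gar) : 𝔄) = (A : 𝔄) * (a : 𝔄) := by
  rw [mulMap_tmul, Subalgebra.coe_mul, coe_fermIncl, coe_grassIncl]

/-- The fermionic part is spanned by the ordered products of a real basis. -/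
theorem ferm_mem_span {ι : Type*} [Fintype ι] [LinearOrder ι] (e : OrthonormalBasis ι ℂ T.QH)
    (hJ : ∀ i, T.JQ (e i) = e i) (A : C.ferm) :
    A ∈ Submodule.span ℂ (Set.range (sortedProd fun i => C.fermField (e i))) := by
  set K := Submodule.span ℂ (Set.range (sortedProd fun i => C.fermField (e i))) with hK
  have hsq : ∀ i, ∃ c : ℂ, C.fermField (e i) * C.fermField (e i) = c • (1 : C.ferm) := fun i =>
    ⟨_, C.fermField_sq (e.orthonormal.1 i) (hJ i)⟩
  have hac := fun i j (h : i ≠ j) => C.fermField_anticomm_basis e.orthonormal hJ h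
  -- There are finitely many ordered products, so their span is closed and taking the norm closure
  -- adds nothing.
  have hfin : FiniteDimensional ℂ K := FiniteDimensional.span_of_finite ℂ (Set.finite_range _)
  have hfin' : FiniteDimensional ℂ (K.map C.ferm.toSubalgebra.val.toLinearMap) := inferInstance
  have hcl : IsClosed ((K.map C.ferm.toSubalgebra.val.toLinearMap) : Set 𝔄) :=
    Submodule.closed_of_finiteDimensional _
  have hmem : (A : 𝔄) ∈ K.map C.ferm.toSubalgebra.val.toLinearMap := by
    refine closure_adjoin_induction (s := C.G '' (T.QH : Set H))
      (P := fun x => x ∈ K.map C.ferm.toSubalgebra.val.toLinearMap) hcl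
      (fun a b => add_mem) (fun c a => Submodule.smul_mem _ c) (fun l hl => ?_) A.2
    induction l with
    | nil =>
      refine ⟨1, Submodule.subset_span ⟨∅, sortedProd_empty _⟩, rfl⟩
    | cons x l ih =>
      obtain ⟨B, hB, hB'⟩ := ih fun y hy => hl y (by simp [hy])
      obtain ⟨f, hf, rfl⟩ := hl x (by simp)
      refine ⟨C.fermField ⟨f, hf⟩ * B, ?_, ?_⟩
      · rw [← e.sum_repr' ⟨f, hf⟩, map_sum, Finset.sum_mul]
        refine Submodule.sum_mem _ fun i _ => ?_
        rw [map_smul, smul_mul_assoc]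
        exact Submodule.smul_mem _ _ (mul_mem_span_sortedProd hsq hac i hB)
      · rw [List.prod_cons, ← hB']
        rfl
  obtain ⟨B, hB, hB'⟩ := hmem
  have : B = A := Subtype.ext hB'
  exact this ▸ hB

/-- Split each field into its QH and Q^⊥H components. The latter anticommutes with the former, hence
can be moved, up to sign, to the right of all fermionic fields. -/
theorem denseRange_mulMap : DenseRange C.mulMap := by
  intro X
  have hR : ∀ l : List 𝔄, (∀ x ∈ l, x ∈ Set.range C.G) →
      l.prod ∈ Submodule.span ℂ (Set.range fun q : List T.QH × C.grass =>
        ((q.1.map fun f : T.QH => C.G f).prod : 𝔄) * (q.2 : 𝔄)) := by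
    intro l hl
    induction l with
    | nil => exact Submodule.subset_span ⟨([], 1), by simp⟩
    | cons x l ih =>
      obtain ⟨f, rfl⟩ := hl x (by simp)
      have ih := ih fun y hy => hl y (by simp [hy])
      rw [List.prod_cons]
      generalize l.prod = z at ih
      induction ih using Submodule.span_induction with
      | zero => rw [mul_zero]; exact zero_mem _
      | add x y _ _ hx hy => rw [mul_add]; exact add_mem hx hy
      | smul c x _ hx => rw [mul_smul_comm]; exact Submodule.smul_mem _ _ hx
      | mem x hx =>
        obtain ⟨⟨l, a⟩, rfl⟩ := hx
        rw [← T.QH.starProjection_add_starProjection_orthogonal f, map_add, add_mul]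
        refine add_mem ?_ ?_
        · refine Submodule.subset_span
            ⟨(⟨T.QH.starProjection f, Submodule.starProjection_apply_mem _ _⟩ :: l, a), ?_⟩
          simp [mul_assoc]
        · set h : T.QHᗮ := ⟨T.QHᗮ.starProjection f, Submodule.starProjection_apply_mem _ _⟩
            with hh
          change C.G (h : H) * _ ∈ _
          rw [← mul_assoc, anticomm_list_prod l fun f _ => by
            rw [C.G_anticomm_perp f h.2, neg_neg], smul_mul_assoc, mul_assoc]
          refine Submodule.smul_mem _ _ (Submodule.subset_span ⟨(l, C.grassField h * a), ?_⟩)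
          rfl
  have hX : (X : 𝔄) ∈ closure ((Subtype.val : C.gar → 𝔄) '' (Set.range C.mulMap)) := by
    have himg : (Subtype.val : C.gar → 𝔄) '' (Set.range C.mulMap) =
        (((LinearMap.range C.mulMap).map C.gar.val.toLinearMap : Submodule ℂ 𝔄) : Set 𝔄) := by
      ext; simp
    rw [himg, ← Submodule.topologicalClosure_coe]
    refine closure_adjoin_induction (s := Set.range C.G)
      (P := fun x => x ∈ ((LinearMap.range C.mulMap).map
        C.gar.val.toLinearMap).topologicalClosure) (Submodule.isClosed_topologicalClosure _)
      (fun a b => add_mem) (fun c a => Submodule.smul_mem _ c) (fun l hl => ?_) X.2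
    refine Submodule.le_topologicalClosure _ (Submodule.span_le.2 ?_ (hR l hl))
    rintro _ ⟨⟨l, a⟩, rfl⟩
    refine ⟨C.mulMap ((l.map C.fermField).prod ⊗ₜ a), ⟨_, rfl⟩, ?_⟩
    change ((C.mulMap ((l.map C.fermField).prod ⊗ₜ a) : C.gar) : 𝔄) = _
    rw [coe_mulMap_tmul, coe_ferm_list_prod]
  rw [closure_subtype]
  exact hX

theorem ferm_induction [FiniteDimensional ℂ T.QH] {P : C.ferm → Prop}
    (hadd : ∀ a b, P a → P b → P (a + b))
    (hsmul : ∀ (c : ℂ) a, P a → P (c • a))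
    (hl : ∀ l : List T.QH, P (l.map C.fermField).prod) (A : C.ferm) : P A := by
  obtain ⟨e, he⟩ := T.JQ.exists_real_orthonormalBasis
  have h0 : P 0 := by
    have := hsmul 0 _ (hl [])
    rwa [zero_smul] at this
  have := C.ferm_mem_span e he A
  induction this using Submodule.span_induction with
  | mem x hx =>
    obtain ⟨I, rfl⟩ := hx
    have := hl (I.sort.map e)
    rwa [List.map_map] at this
  | zero => exact h0
  | add x y _ _ hx hy => exact hadd _ _ hx hy
  | smul c x _ hx => exact hsmul c _ hx

/-- The fermionic part is spanned by ordered products whose coefficients in a sum depend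
continuously on the sum. -/
theorem exists_bounded_coeff [FiniteDimensional ℂ T.QH] [CompleteSpace H]
    (hinf : ¬ FiniteDimensional ℂ T.QHᗮ) :
    ∃ y : Fin (Module.finrank ℂ T.QH) → C.ferm,
      (∀ A : C.ferm, A ∈ Submodule.span ℂ (Set.range (sortedProd y))) ∧
      ∀ (a : Finset (Fin (Module.finrank ℂ T.QH)) → C.grass) I,
        ‖a I‖ ≤ ‖∑ J, ((sortedProd y J : C.ferm) : 𝔄) * (a J : 𝔄)‖ := by
  obtain ⟨e, he⟩ := T.JQ.exists_real_orthonormalBasis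
  -- A field of a real unit vector squares to 1/2; the factor √2 makes it a selfadjoint unitary.
  set y : Fin (Module.finrank ℂ T.QH) → C.ferm := fun i => ((√2 : ℝ) : ℂ) • C.fermField (e i)
    with hy
  have h2 : (((√2 : ℝ) : ℂ) * ((√2 : ℝ) : ℂ)) = 2 := by
    rw [← Complex.ofReal_mul, Real.mul_self_sqrt (by norm_num)]
    norm_num
  have ysq : ∀ i, y i * y i = 1 := fun i => by
    rw [hy]
    simp only [smul_mul_smul_comm]
    rw [C.fermField_sq (e.orthonormal.1 i) (he i), h2, smul_smul]
    norm_num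
  have yac : ∀ i j, i ≠ j → y i * y j = -(y j * y i) := fun i j h => by
    simp only [hy, smul_mul_smul_comm]
    rw [C.fermField_anticomm_basis e.orthonormal he h, smul_neg]
  have ystar : ∀ i, star (y i) = y i := fun i => by
    simp only [hy, star_smul, C.star_fermField, he]
    simp
  have yspan : ∀ A : C.ferm, A ∈ Submodule.span ℂ (Set.range (sortedProd y)) := by
    refine C.ferm_induction (fun a b => add_mem) (fun c a => Submodule.smul_mem _ c) fun l => ?_
    induction l with
    | nil => exact Submodule.subset_span ⟨∅, by simp⟩
    | cons f l ih =>
      rw [List.map_cons, List.prod_cons, ← e.sum_repr' f, map_sum, Finset.sum_mul]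
      refine Submodule.sum_mem _ fun i _ => ?_
      rw [map_smul, smul_mul_assoc]
      refine Submodule.smul_mem _ _ ?_
      have h3 : C.fermField (e i) = (((√2 : ℝ) : ℂ))⁻¹ • y i := by
        rw [hy, smul_smul, inv_mul_cancel₀, one_smul]
        intro h0
        rw [h0] at h2
        norm_num at h2
      rw [h3, smul_mul_assoc]
      exact Submodule.smul_mem _ _ (mul_mem_span_sortedProd (fun i => ⟨1, by rw [ysq, one_smul]⟩)
        yac i ih)
  refine ⟨y, yspan, fun a I => ?_⟩
  have hbound : ‖a I‖ ≤ ‖∑ J, ((sortedProd y J : C.ferm) : 𝔄) * (a J : 𝔄)‖ := by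
    have hd : DenseRange (fun x : Finset (Fin (Module.finrank ℂ T.QH)) →
        ExteriorAlgebra ℂ T.QHᗮ => fun J => C.toGrass (x J)) :=
      DenseRange.piMap fun _ => C.denseRange_toGrass
    refine hd.induction_on
      (p := fun a => ‖a I‖ ≤ ‖∑ J, ((sortedProd y J : C.ferm) : 𝔄) * (a J : 𝔄)‖) a
      (isClosed_le (by fun_prop) (by fun_prop)) fun x => ?_
    choose V hV hx using fun J => exists_finiteDimensional_intertwine (x J)
    obtain ⟨D, d1, d2, d3, d4⟩ := C.exists_parity hinf (⨆ J, V J)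
    have hDy : ∀ i, D * (y i : 𝔄) = -((y i : 𝔄) * D) := fun i => by
      have := d3 (e i) (e i).2
      have hyi : (y i : 𝔄) = ((√2 : ℝ) : ℂ) • C.G (e i) := rfl
      rw [hyi, mul_smul_comm, this, smul_mul_assoc, smul_neg]
    have hsq' : ∀ i, (y i : 𝔄) * (y i : 𝔄) = 1 := fun i => congrArg Subtype.val (ysq i)
    have hstar' : ∀ i, star (y i : 𝔄) = y i := fun i => congrArg Subtype.val (ystar i)
    have hyy : ∀ i j, i ≠ j → (y i : 𝔄) * (y j : 𝔄) = -((y j : 𝔄) * (y i : 𝔄)) :=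
      fun i j h => congrArg Subtype.val (yac i j h)
    -- D anticommutes with every y j and with the generators occurring in the coefficients. So y i *
    -- D anticommutes with y i and commutes with the other y j and with the coefficients.
    have key := norm_coeff_le (y := fun i => (y i : 𝔄)) (u := fun i => (y i : 𝔄) * D)
      (fun i => Unitary.mem_iff.2 ⟨by
          rw [star_mul, d1, hstar', mul_assoc, ← mul_assoc (y i : 𝔄), hsq', one_mul, d2], by
          rw [star_mul, d1, hstar', mul_assoc, ← mul_assoc D, d2, one_mul, hsq']⟩)
      (fun i => Unitary.mem_iff.2 ⟨by rw [hstar', hsq'], by rw [hstar', hsq']⟩)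
      (fun i => by rw [mul_assoc, hDy, mul_neg])
      (fun i j h => by rw [mul_assoc, hDy, mul_neg, ← mul_assoc, hyy i j h, neg_mul, neg_neg,
        mul_assoc])
      Finset.univ (fun J => ((C.toGrass (x J) : C.grass) : 𝔄)) (fun i J =>
        hx J (C.grass.val.comp C.toGrass) (C.grass.val.comp C.toGrass) _ fun h hh => by
          rw [AlgHom.comp_apply, toGrass_ι]
          change (y i : 𝔄) * D * C.G (h : H) = C.G (h : H) * ((y i : 𝔄) * D)
          have hyi : (y i : 𝔄) = ((√2 : ℝ) : ℂ) • C.G (e i) := rfl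
          rw [mul_assoc, d4 h (Submodule.mem_iSup_of_mem J hh), mul_neg, ← mul_assoc,
            ← mul_assoc, hyi, smul_mul_assoc, C.G_anticomm_perp _ h.2, smul_neg, neg_mul,
            neg_neg, mul_smul_comm])
      I (Finset.subset_univ _)
    rw [Finset.powerset_univ] at key
    simp only [coe_ferm_sortedProd]
    exact key
  exact hbound

theorem norm_mulMap_sum {ι : Type*} (s : Finset ι) (A : ι → C.ferm) (a : ι → C.grass) :
    ‖C.mulMap (∑ J ∈ s, A J ⊗ₜ a J)‖ = ‖∑ J ∈ s, (A J : 𝔄) * (a J : 𝔄)‖ := by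
  have h : ((C.mulMap (∑ J ∈ s, A J ⊗ₜ a J) : C.gar) : 𝔄) = ∑ J ∈ s, (A J : 𝔄) * (a J : 𝔄) := by
    rw [map_sum, AddSubmonoidClass.coe_finsetSum]
    exact Finset.sum_congr rfl fun J _ => C.coe_mulMap_tmul _ _
  rw [← h]
  rfl

/-- The map `A ⊗ λ ↦ ω(A) λ`. -/
noncomputable def slice (ω : C.ferm →ₗ[ℂ] ℂ) : C.ferm ⊗[ℂ] C.grass →ₗ[ℂ] C.grass :=
  TensorProduct.lift ((LinearMap.lsmul ℂ C.grass).comp ω)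

theorem slice_tmul (ω : C.ferm →ₗ[ℂ] ℂ) (A : C.ferm) (a : C.grass) :
    C.slice ω (A ⊗ₜ a) = ω A • a := rfl

/-- Expand t in ordered products y_J: each coefficient is bounded by the norm of the image of t, so
the sum of the |ω(y_J)| is a valid constant. The bound in terms of the image, not of t, lets the
slice map descend to the GAR algebra. -/
theorem exists_norm_slice_le [FiniteDimensional ℂ T.QH] [CompleteSpace H]
    (hinf : ¬ FiniteDimensional ℂ T.QHᗮ)
    (ω : C.ferm →ₗ[ℂ] ℂ) : ∃ K, ∀ t, ‖C.slice ω t‖ ≤ K * ‖C.mulMap t‖ := by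
  obtain ⟨y, yspan, hbound⟩ := C.exists_bounded_coeff hinf
  have hrep : ∀ t : C.ferm ⊗[ℂ] C.grass, ∃ a : Finset (Fin (Module.finrank ℂ T.QH)) → C.grass,
      t = ∑ J, sortedProd y J ⊗ₜ a J := by
    intro t
    induction t using TensorProduct.induction_on with
    | zero => exact ⟨0, by simp⟩
    | tmul A a =>
      obtain ⟨c, hc⟩ := (Submodule.mem_span_range_iff_exists_fun ℂ).1 (yspan A)
      refine ⟨fun J => c J • a, ?_⟩
      rw [← hc, TensorProduct.sum_tmul]
      exact Finset.sum_congr rfl fun J _ => TensorProduct.smul_tmul _ _ _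
    | add t t' h h' =>
      obtain ⟨a, rfl⟩ := h
      obtain ⟨a', rfl⟩ := h'
      refine ⟨a + a', ?_⟩
      simp only [Pi.add_apply, TensorProduct.tmul_add, Finset.sum_add_distrib]
  refine ⟨∑ J, ‖ω (sortedProd y J)‖, fun t => ?_⟩
  obtain ⟨a, rfl⟩ := hrep t
  rw [norm_mulMap_sum, map_sum, Finset.sum_mul]
  refine norm_sum_le_of_le _ fun J _ => ?_
  rw [slice_tmul, norm_smul]
  exact mul_le_mul_of_nonneg_left (hbound a J) (norm_nonneg _)

theorem exists_isGExtension [FiniteDimensional ℂ T.QH] [CompleteSpace H]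
    (hinf : ¬ FiniteDimensional ℂ T.QHᗮ)
    (ω : C.ferm →ₗ[ℂ] ℂ) : ∃ Φ, C.IsGExtension ω Φ := by
  have hcomp : CompleteSpace C.grass :=
    (Subalgebra.isClosed_topologicalClosure _).completeSpace_coe
  refine ⟨(C.slice ω).extendOfNorm C.mulMap, fun A a => ?_⟩
  rw [← mulMap_tmul, ← slice_tmul]
  exact LinearMap.extendOfNorm_eq C.denseRange_mulMap (C.exists_norm_slice_le hinf ω) (A ⊗ₜ a)

/-- Every functional on the fermionic part has a G-extension. -/
theorem isGExtension_gExtension [FiniteDimensional ℂ T.QH] [CompleteSpace H]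
    (hinf : ¬ FiniteDimensional ℂ T.QHᗮ)
    (ω : C.ferm →ₗ[ℂ] ℂ) : C.IsGExtension ω (C.gExtension ω) :=
  Classical.epsilon_spec (C.exists_isGExtension hinf ω)

end CARAlgebra

end GAR

/-! ### Eigenbases of covariance operators adapted to the conjugation -/

namespace GAR

namespace Conjugation

variable {E : Type*} [NormedAddCommGroup E] [InnerProductSpace ℂ E] (J : Conjugation E)

/-- The vectors `f i` and `J (f i)` form an orthonormal basis. -/
structure IsPairBasis {n : ℕ} (f : Fin n → E) : Prop where
  inner_eq : ∀ i j, ⟪f i, f j⟫_ℂ = if i = j then 1 else 0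
  inner_conj : ∀ i j, ⟪f i, J (f j)⟫_ℂ = 0
  complete : ∀ x, x = ∑ i, (⟪f i, x⟫_ℂ • f i + ⟪J (f i), x⟫_ℂ • J (f i))

variable {J}

theorem IsPairBasis.conj_inner {n : ℕ} {f : Fin n → E} (hf : J.IsPairBasis f) (i j : Fin n) :
    ⟪J (f i), f j⟫_ℂ = 0 := by
  rw [← inner_conj_symm, hf.inner_conj, map_zero]

theorem IsPairBasis.conj_inner_conj {n : ℕ} {f : Fin n → E} (hf : J.IsPairBasis f)
    (i j : Fin n) : ⟪J (f i), J (f j)⟫_ℂ = if i = j then 1 else 0 := by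
  rw [J.inner_map_map, hf.inner_eq]
  simp only [eq_comm]

theorem IsPairBasis.norm_eq {n : ℕ} {f : Fin n → E} (hf : J.IsPairBasis f) (i : Fin n) :
    ‖f i‖ = 1 := by
  have h := hf.inner_eq i i
  rw [inner_self_eq_norm_sq_to_K, if_pos rfl] at h
  have h2 : ‖f i‖ ^ 2 = 1 := by
    refine Complex.ofReal_injective ?_
    rw [Complex.ofReal_one, ← h, Complex.ofReal_pow]
    rfl
  nlinarith [norm_nonneg (f i)]

namespace IsCovariance

variable {S : E →L[ℂ] E} (hS : J.IsCovariance S)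
include hS

theorem inner_apply (x y : E) : ⟪S x, y⟫_ℂ = ⟪x, S y⟫_ℂ := hS.pos.isSymmetric x y

theorem conj_apply (x : E) : S (J x) = J x - J (S x) := by
  have := hS.add_conj (J x)
  rw [J.involutive] at this
  exact eq_sub_of_add_eq this

theorem conj_eigen {f : E} {s : ℝ} (h : S f = (s : ℂ) • f) :
    S (J f) = ((1 - s : ℝ) : ℂ) • J f := by
  rw [hS.conj_apply, h, map_smulₛₗ, Complex.conj_ofReal]
  push_cast
  rw [sub_smul, one_smul]

/-- An eigenvector f with eigenvalue s ≠ 1/2 is orthogonal to J f, because J f has the different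
eigenvalue 1 - s. If 1/2 is the only eigenvalue then S is scalar on W, every vector of W is an
eigenvector, and only the orthogonality of f and J f has to be arranged. -/
theorem exists_pair [FiniteDimensional ℂ E] (W : Submodule ℂ E) (hSW : ∀ x ∈ W, S x ∈ W)
    (hJW : ∀ x ∈ W, J x ∈ W) (hW : 2 ≤ Module.finrank ℂ W) :
    ∃ f ∈ W, ∃ s : ℝ, ‖f‖ = 1 ∧ ⟪f, J f⟫_ℂ = 0 ∧ S f = (s : ℂ) • f := by
  have hsym : (S.toLinearMap.restrict hSW).IsSymmetric :=
    LinearMap.IsSymmetric.restrict_invariant hS.pos.isSymmetric hSW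
  set b := hsym.eigenvectorBasis rfl
  have hb : ∀ i, S (b i : E) = ((hsym.eigenvalues rfl i : ℝ) : ℂ) • (b i : E) := fun i =>
    congrArg Subtype.val (hsym.apply_eigenvectorBasis rfl i)
  by_cases h : ∃ i, hsym.eigenvalues rfl i ≠ 1 / 2
  · obtain ⟨i, hi⟩ := h
    refine ⟨b i, (b i).2, _, b.orthonormal.1 i, ?_, hb i⟩
    have h1 := hS.inner_apply (b i : E) (J (b i : E))
    rw [hb, hS.conj_eigen (hb i), inner_smul_left, inner_smul_right, Complex.conj_ofReal,
      ← sub_eq_zero, ← sub_mul] at h1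
    refine (mul_eq_zero.1 h1).resolve_left fun h2 => hi ?_
    have h3 : hsym.eigenvalues rfl i - (1 - hsym.eigenvalues rfl i) = 0 := by exact_mod_cast h2
    linarith
  · push Not at h
    have hhalf : ∀ x ∈ W, S x = ((1 / 2 : ℝ) : ℂ) • x := by
      intro x hx
      have h1 := congrArg W.subtype (b.sum_repr' ⟨x, hx⟩)
      rw [map_sum] at h1
      change _ = x at h1
      rw [← h1, map_sum, Finset.smul_sum]
      refine Finset.sum_congr rfl fun i _ => ?_
      rw [map_smul, map_smul, Submodule.subtype_apply, hb, h i, smul_comm]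
    obtain ⟨e, he⟩ := (J.restrict W hJW).exists_real_orthonormalBasis
    have he' : ∀ i, J (e i : E) = e i := fun i => congrArg Subtype.val (he i)
    have hin : ∀ i j, ⟪(e i : E), (e j : E)⟫_ℂ = if i = j then 1 else 0 :=
      fun i j => orthonormal_iff_ite.1 e.orthonormal i j
    set i0 : Fin (Module.finrank ℂ W) := ⟨0, by omega⟩
    set i1 : Fin (Module.finrank ℂ W) := ⟨1, by omega⟩
    have h01 : i0 ≠ i1 := by simp [i0, i1]
    -- For orthonormal real vectors, e₀ + i e₁ is orthogonal to its conjugate e₀ - i e₁; this is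
    -- where dimension 2 is needed.
    set u : E := (e i0 : E) + Complex.I • (e i1 : E) with hu
    have huW : u ∈ W := add_mem (e i0).2 (Submodule.smul_mem _ _ (e i1).2)
    have hJu : J u = (e i0 : E) - Complex.I • (e i1 : E) := by
      rw [hu, map_add, map_smulₛₗ, he', he', Complex.conj_I, neg_smul, sub_eq_add_neg]
    have huu : ⟪u, u⟫_ℂ = 2 := by
      rw [hu, inner_add_left, inner_add_right, inner_add_right, inner_smul_left, inner_smul_left,
        inner_smul_right, inner_smul_right, hin, hin, hin, hin, if_pos rfl, if_neg h01,
        if_neg h01.symm, if_pos rfl, Complex.conj_I]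
      simp
      norm_num
    have huJ : ⟪u, J u⟫_ℂ = 0 := by
      rw [hJu, hu, inner_add_left, inner_sub_right, inner_sub_right, inner_smul_left,
        inner_smul_left, inner_smul_right, inner_smul_right, hin, hin, hin, hin, if_pos rfl,
        if_neg h01, if_neg h01.symm, if_pos rfl, Complex.conj_I]
      simp
    have hnu : ‖u‖ ^ 2 = 2 := by
      rw [inner_self_eq_norm_sq_to_K] at huu
      refine Complex.ofReal_injective ?_
      rw [Complex.ofReal_ofNat, ← huu, Complex.ofReal_pow]
      rfl
    have hu0 : ‖u‖ ≠ 0 := fun h0 => by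
      rw [h0] at hnu
      norm_num at hnu
    refine ⟨((‖u‖⁻¹ : ℝ) : ℂ) • u, Submodule.smul_mem _ _ huW, 1 / 2, ?_, ?_, ?_⟩
    · rw [norm_smul, Complex.norm_real, norm_inv, norm_norm, inv_mul_cancel₀ hu0]
    · rw [map_smulₛₗ, inner_smul_left, inner_smul_right, huJ, mul_zero, mul_zero]
    · exact hhalf _ (Submodule.smul_mem _ _ huW)

/-- The orthogonal complement of the pairs already found is invariant under S and J and has
dimension at least 2, so `exists_pair` supplies the next one. -/
theorem exists_pairs [FiniteDimensional ℂ E] (k : ℕ) (hk : 2 * k ≤ Module.finrank ℂ E) :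
    ∃ (f : Fin k → E) (s : Fin k → ℝ), (∀ i j, ⟪f i, f j⟫_ℂ = if i = j then 1 else 0) ∧
      (∀ i j, ⟪f i, J (f j)⟫_ℂ = 0) ∧ ∀ i, S (f i) = (s i : ℂ) • f i := by
  induction k with
  | zero => exact ⟨Fin.elim0, Fin.elim0, fun i => i.elim0, fun i => i.elim0, fun i => i.elim0⟩
  | succ k ih =>
    obtain ⟨f, s, h1, h2, h3⟩ := ih (by omega)
    set K := Submodule.span ℂ (Set.range (Sum.elim f fun i => J (f i))) with hK
    have hKr : Module.finrank ℂ K ≤ 2 * k := by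
      have := finrank_range_le_card (R := ℂ) (Sum.elim f fun i => J (f i))
      rw [Fintype.card_sum, Fintype.card_fin] at this
      change Module.finrank ℂ K ≤ _ at this
      omega
    have hadd := Submodule.finrank_add_finrank_orthogonal K
    have hmem : ∀ x, x ∈ Kᗮ ↔ ∀ i, ⟪f i, x⟫_ℂ = 0 ∧ ⟪J (f i), x⟫_ℂ = 0 := by
      intro x
      constructor
      · intro hx i
        exact ⟨hx _ (Submodule.subset_span ⟨Sum.inl i, rfl⟩),
          hx _ (Submodule.subset_span ⟨Sum.inr i, rfl⟩)⟩
      · intro hx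
        rw [Submodule.mem_orthogonal]
        intro u hu
        induction hu using Submodule.span_induction with
        | mem u hu =>
          obtain ⟨i | i, rfl⟩ := hu
          · exact (hx i).1
          · exact (hx i).2
        | zero => exact inner_zero_left _
        | add a b _ _ ha hb => rw [inner_add_left, ha, hb, add_zero]
        | smul c a _ ha => rw [inner_smul_left, ha, mul_zero]
    obtain ⟨g, hg, t, g1, g2, g3⟩ := hS.exists_pair Kᗮ (fun x hx => by
        rw [hmem] at hx ⊢
        intro i
        rw [← hS.inner_apply, ← hS.inner_apply, h3, hS.conj_eigen (h3 i), inner_smul_left,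
          inner_smul_left, (hx i).1, (hx i).2, mul_zero, mul_zero]
        exact ⟨rfl, rfl⟩) (fun x hx => by
        rw [hmem] at hx ⊢
        intro i
        rw [J.inner_right, J.inner_map_map, ← inner_conj_symm, (hx i).2,
          ← inner_conj_symm, (hx i).1, map_zero]
        exact ⟨rfl, rfl⟩) (by omega)
    rw [hmem] at hg
    have gg : ⟪g, g⟫_ℂ = 1 := by rw [inner_self_eq_norm_sq_to_K, g1]; simp
    have gf : ∀ i, ⟪g, f i⟫_ℂ = 0 := fun i => by rw [← inner_conj_symm, (hg i).1, map_zero]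
    have gJf : ∀ i, ⟪g, J (f i)⟫_ℂ = 0 := fun i => by
      rw [← inner_conj_symm, (hg i).2, map_zero]
    have fJg : ∀ i, ⟪f i, J g⟫_ℂ = 0 := fun i => by rw [J.inner_right, gJf]
    refine ⟨Fin.cons g f, Fin.cons t s, fun i j => ?_, fun i j => ?_, fun i => ?_⟩
    · refine Fin.cases ?_ (fun i => ?_) i <;> refine Fin.cases ?_ (fun j => ?_) j
      · simpa using gg
      · simpa [Fin.succ_ne_zero, (Fin.succ_ne_zero _).symm] using gf j
      · simpa [Fin.succ_ne_zero] using (hg i).1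
      · simpa using h1 i j
    · refine Fin.cases ?_ (fun i => ?_) i <;> refine Fin.cases ?_ (fun j => ?_) j
      · simpa using g2
      · simpa using gJf j
      · simpa using fJg i
      · simpa using h2 i j
    · refine Fin.cases ?_ (fun i => ?_) i
      · simpa using g3
      · simpa using h3 i

/-- A covariance operator on a space of dimension `2n` is diagonal in some basis of pairs `f i`,
`J (f i)`. -/
theorem exists_isPairBasis [FiniteDimensional ℂ E] {n : ℕ} (hn : Module.finrank ℂ E = 2 * n) :
    ∃ (f : Fin n → E) (s : Fin n → ℝ), J.IsPairBasis f ∧ (∀ i, S (f i) = (s i : ℂ) • f i) ∧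
      ∀ i, 0 ≤ s i ∧ s i ≤ 1 := by
  obtain ⟨f, s, h1, h2, h3⟩ := hS.exists_pairs n hn.ge
  have ho : Orthonormal ℂ (Sum.elim f fun i => J (f i)) := by
    rw [orthonormal_iff_ite]
    rintro (i | i) (j | j)
    · simpa using h1 i j
    · simpa using h2 i j
    · simp only [Sum.elim_inr, Sum.elim_inl, reduceCtorEq, if_false]
      rw [← inner_conj_symm, h2, map_zero]
    · simp only [Sum.elim_inr, Sum.inr.injEq]
      rw [J.inner_map_map, h1]
      simp only [eq_comm]
  have hcard : Fintype.card (Fin n ⊕ Fin n) = Module.finrank ℂ E := by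
    rw [Fintype.card_sum, Fintype.card_fin, hn, two_mul]
  set b : OrthonormalBasis (Fin n ⊕ Fin n) ℂ E :=
    (basisOfLinearIndependentOfCardEqFinrank' _ ho.linearIndependent hcard).toOrthonormalBasis
      (by simpa using ho) with hb
  have hb' : ∀ i, b i = Sum.elim f (fun i => J (f i)) i := fun i => by simp [hb]
  refine ⟨f, s, ⟨h1, h2, fun x => ?_⟩, h3, fun i => ?_⟩
  · rw [Finset.sum_add_distrib]
    have := b.sum_repr' x
    rw [Fintype.sum_sum_type] at this
    simp only [hb', Sum.elim_inl, Sum.elim_inr] at this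
    exact this.symm
  · have hpos := hS.pos.inner_nonneg_right (f i)
    have hle := hS.le_one.inner_nonneg_right (f i)
    rw [sub_apply, one_apply_eq_self, inner_sub_right, h3, inner_smul_right, h1,
      if_pos rfl, mul_one] at hle
    rw [h3, inner_smul_right, h1, if_pos rfl, mul_one] at hpos
    constructor
    · exact_mod_cast hpos
    · have : (0 : ℂ) ≤ ((1 - s i : ℝ) : ℂ) := by push_cast; exact hle
      have h5 : (0 : ℝ) ≤ 1 - s i := by exact_mod_cast this
      linarith

end IsCovariance

/-- A basis projection has a basis of pairs `f i`, `J (f i)` with the `f i` in its range. -/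
theorem IsBasisProjection.exists_isPairBasis [FiniteDimensional ℂ E] {P : E →L[ℂ] E}
    (hP : J.IsBasisProjection P) {n : ℕ} (hn : Module.finrank ℂ E = 2 * n) :
    ∃ f : Fin n → E, J.IsPairBasis f ∧ (∀ i, P (f i) = f i) ∧ ∀ i, P (J (f i)) = 0 := by
  obtain ⟨f, s, hf, h3, -⟩ := hP.toIsCovariance.exists_isPairBasis hn
  have hs : ∀ i, s i = 1 ∨ s i = 0 := by
    intro i
    have h := congrArg (fun A : E →L[ℂ] E => ⟪f i, A (f i)⟫_ℂ) hP.idem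
    simp only [mul_apply_eq_comp] at h
    rw [h3, map_smul, h3, inner_smul_right, inner_smul_right, hf.inner_eq, if_pos rfl, mul_one]
      at h
    have h2 : s i * s i = s i := by exact_mod_cast h
    have h4 : s i * (s i - 1) = 0 := by linarith
    rcases mul_eq_zero.1 h4 with h5 | h5
    · exact Or.inr h5
    · exact Or.inl (by linarith)
  classical
  -- The eigenvalues of P are 0 and 1. When f i has eigenvalue 0 its conjugate has eigenvalue 1, so
  -- the two are exchanged.
  set g : Fin n → E := fun i => if s i = 1 then f i else J (f i) with hg
  have hJg : ∀ i, J (g i) = if s i = 1 then J (f i) else f i := fun i => by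
    simp only [hg]
    split_ifs
    · rfl
    · exact J.involutive _
  refine ⟨g, ⟨fun i j => ?_, fun i j => ?_, fun x => ?_⟩, fun i => ?_, fun i => ?_⟩
  · by_cases hij : i = j
    · subst hij
      simp only [hg]
      split_ifs
      · rw [hf.inner_eq, if_pos rfl]
      · rw [hf.conj_inner_conj, if_pos rfl]
    · simp only [hg, if_neg hij]
      split_ifs
      · rw [hf.inner_eq, if_neg hij]
      · exact hf.inner_conj _ _
      · exact hf.conj_inner _ _
      · rw [hf.conj_inner_conj, if_neg hij]
  · rw [hJg]
    simp only [hg]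
    by_cases hij : i = j
    · subst hij
      split_ifs
      · exact hf.inner_conj _ _
      · exact hf.conj_inner _ _
    · split_ifs
      · exact hf.inner_conj _ _
      · rw [hf.inner_eq, if_neg hij]
      · rw [hf.conj_inner_conj, if_neg hij]
      · exact hf.conj_inner _ _
  · conv_lhs => rw [hf.complete x]
    refine Finset.sum_congr rfl fun i _ => ?_
    rw [hJg]
    simp only [hg]
    split_ifs
    · rfl
    · rw [add_comm]
  · simp only [hg]
    split_ifs with h
    · rw [h3, h]; simp
    · rw [hP.toIsCovariance.conj_eigen (h3 i), (hs i).resolve_left h]; simp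
  · rw [hJg]
    split_ifs with h
    · rw [hP.toIsCovariance.conj_eigen (h3 i), h]; simp
    · rw [h3, (hs i).resolve_left h]; simp

end Conjugation

end GAR

namespace GAR

theorem Conjugation.IsPairBasis.induction {E : Type*} [NormedAddCommGroup E]
    [InnerProductSpace ℂ E] {J : Conjugation E} {n : ℕ} {f : Fin n → E} (hf : J.IsPairBasis f)
    {p : E → Prop} (h0 : p 0) (hadd : ∀ x y, p x → p y → p (x + y))
    (hsmul : ∀ (c : ℂ) x, p x → p (c • x)) (h1 : ∀ i, p (f i)) (h2 : ∀ i, p (J (f i))) (x : E) :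
    p x := by
  rw [hf.complete x]
  exact Finset.sum_induction _ p hadd h0 fun i _ =>
    hadd _ _ (hsmul _ _ (h1 i)) (hsmul _ _ (h2 i))

namespace CARAlgebra

variable {H : Type*} [NormedAddCommGroup H] [InnerProductSpace ℂ H] {T : Triple H}
  {𝔄 : Type*} [CStarAlgebra 𝔄] (C : CARAlgebra T.conjQ 𝔄)

/-- A field, moved through a product of fields. -/
theorem fermField_mul_list (k : T.QH) (l : List T.QH) :
    C.fermField k * (l.map C.fermField).prod =
      ∑ j : Fin l.length, ((-1 : ℂ) ^ (j : ℕ) * ⟪T.JQ k, l.get j⟫_ℂ) •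
        ((l.eraseIdx j).map C.fermField).prod +
      (-1 : ℂ) ^ l.length • ((l.map C.fermField).prod * C.fermField k) := by
  induction l with
  | nil => simp
  | cons h t ih =>
    have h1 : C.fermField k * C.fermField h =
        ⟪T.JQ k, h⟫_ℂ • 1 - C.fermField h * C.fermField k :=
      eq_sub_of_add_eq (C.fermField_anticomm k h)
    rw [List.map_cons, List.prod_cons, ← mul_assoc, h1, sub_mul, smul_mul_assoc, one_mul,
      mul_assoc, ih, mul_add, mul_smul_comm, Finset.mul_sum]
    have h2 := Fin.sum_univ_succ (n := t.length) fun j : Fin (t.length + 1) =>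
      ((-1 : ℂ) ^ (j : ℕ) * ⟪T.JQ k, (h :: t).get j⟫_ℂ) •
        (((h :: t).eraseIdx j).map C.fermField).prod
    refine Eq.trans ?_ (congrArg (· + _) h2).symm
    have h3 : ∀ j : Fin t.length, (h :: t).get j.succ = t.get j := fun _ => rfl
    simp only [Fin.val_zero, pow_zero, one_mul, List.get_cons_zero, List.eraseIdx_zero,
      List.tail_cons, Fin.val_succ, h3, List.eraseIdx_cons_succ, List.map_cons,
      List.prod_cons, List.length_cons, pow_succ, mul_neg, neg_mul, neg_smul, mul_one,
      mul_smul_comm, Finset.sum_neg_distrib, mul_assoc]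
    abel

/-! ### Number operators -/

section Number

variable {n : ℕ} {f : Fin n → T.QH} (hf : T.JQ.IsPairBasis f)
include hf

theorem annih_anticomm (i j : Fin n) :
    C.fermField (f i) * C.fermField (f j) = -(C.fermField (f j) * C.fermField (f i)) := by
  have h := C.fermField_anticomm (f i) (f j)
  rw [hf.conj_inner, zero_smul] at h
  exact eq_neg_of_add_eq_zero_left h

theorem annih_sq (i : Fin n) : C.fermField (f i) * C.fermField (f i) = 0 := by
  have h := C.annih_anticomm hf i i
  have h2 : (2 : ℂ) • (C.fermField (f i) * C.fermField (f i)) = 0 := by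
    rw [two_smul]
    nth_rewrite 1 [h]
    exact neg_add_cancel _
  exact (smul_eq_zero.1 h2).resolve_left two_ne_zero

theorem star_annih_sq (i : Fin n) :
    star (C.fermField (f i)) * star (C.fermField (f i)) = 0 := by
  rw [← star_mul, C.annih_sq hf, star_zero]

theorem annih_mul_star (i : Fin n) :
    C.fermField (f i) * star (C.fermField (f i)) + star (C.fermField (f i)) * C.fermField (f i)
      = 1 := by
  rw [C.star_fermField, C.fermField_anticomm, hf.conj_inner_conj, if_pos rfl, one_smul]

theorem annih_mul_star_of_ne {i j : Fin n} (hij : i ≠ j) :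
    C.fermField (f i) * star (C.fermField (f j)) =
      -(star (C.fermField (f j)) * C.fermField (f i)) := by
  have h := C.fermField_anticomm (f i) (T.JQ (f j))
  rw [hf.conj_inner_conj, if_neg hij, zero_smul, ← C.star_fermField] at h
  exact eq_neg_of_add_eq_zero_left h

theorem star_annih_anticomm (i j : Fin n) :
    star (C.fermField (f i)) * star (C.fermField (f j)) =
      -(star (C.fermField (f j)) * star (C.fermField (f i))) := by
  rw [← star_mul, C.annih_anticomm hf, star_neg, star_mul]

theorem annih_mul_star_mul (i : Fin n) :
    C.fermField (f i) * (star (C.fermField (f i)) * C.fermField (f i)) = C.fermField (f i) := by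
  have h : star (C.fermField (f i)) * C.fermField (f i) =
      1 - C.fermField (f i) * star (C.fermField (f i)) := eq_sub_of_add_eq'
    (C.annih_mul_star hf i)
  rw [h, mul_sub, mul_one, ← mul_assoc, C.annih_sq hf, zero_mul, sub_zero]

omit hf in
/-- The product of the number operators `(G (f i))* G (f i)`. -/
noncomputable def numberProd (f : Fin n → T.QH) (l : List (Fin n)) : C.ferm :=
  (l.map fun i => star (C.fermField (f i)) * C.fermField (f i)).prod

omit hf in
theorem numberProd_cons (f : Fin n → T.QH) (i : Fin n) (l : List (Fin n)) :
    C.numberProd f (i :: l) =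
      star (C.fermField (f i)) * C.fermField (f i) * C.numberProd f l := by
  rw [numberProd, List.map_cons, List.prod_cons, numberProd]

theorem number_comm_annih {i j : Fin n} (hij : i ≠ j) :
    Commute (C.fermField (f i)) (star (C.fermField (f j)) * C.fermField (f j)) := by
  rw [commute_iff_eq, ← mul_assoc, C.annih_mul_star_of_ne hf hij, neg_mul, mul_assoc,
    C.annih_anticomm hf, mul_neg, neg_neg, mul_assoc]

theorem number_comm (i j : Fin n) :
    Commute (star (C.fermField (f i)) * C.fermField (f i))
      (star (C.fermField (f j)) * C.fermField (f j)) := by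
  by_cases hij : i = j
  · rw [hij]
  · refine Commute.mul_left ?_ (C.number_comm_annih hf hij)
    have h := (C.number_comm_annih hf hij).star_star
    rwa [star_mul, star_star] at h

theorem number_comm_numberProd (i : Fin n) (l : List (Fin n)) :
    Commute (star (C.fermField (f i)) * C.fermField (f i)) (C.numberProd f l) := by
  refine Commute.list_prod_right _ _ fun y hy => ?_
  obtain ⟨j, -, rfl⟩ := List.mem_map.1 hy
  exact C.number_comm hf i j

theorem annih_comm_numberProd {i : Fin n} {l : List (Fin n)} (hi : i ∉ l) :
    Commute (C.fermField (f i)) (C.numberProd f l) := by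
  refine Commute.list_prod_right _ _ fun y hy => ?_
  obtain ⟨j, hj, rfl⟩ := List.mem_map.1 hy
  exact C.number_comm_annih hf fun h => hi (h ▸ hj)

theorem star_numberProd (l : List (Fin n)) :
    star (C.numberProd f l) = C.numberProd f l := by
  induction l with
  | nil => simp [numberProd]
  | cons i l ih =>
    rw [numberProd_cons, star_mul, ih, star_mul, star_star]
    exact (C.number_comm_numberProd hf i l).eq.symm

theorem numberProd_mul_annih {i : Fin n} {l : List (Fin n)} (hi : i ∈ l) :
    C.numberProd f l * C.fermField (f i) = 0 := by
  induction l with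
  | nil => simp at hi
  | cons j l ih =>
    rcases List.mem_cons.1 hi with rfl | hi
    · rw [numberProd_cons, (C.number_comm_numberProd hf i l).eq, mul_assoc, mul_assoc,
        C.annih_sq hf, mul_zero, mul_zero]
    · rw [numberProd_cons, mul_assoc, ih hi, mul_zero]

theorem star_annih_mul_numberProd {i : Fin n} {l : List (Fin n)} (hi : i ∈ l) :
    star (C.fermField (f i)) * C.numberProd f l = 0 := by
  have h := congrArg star (C.numberProd_mul_annih hf hi)
  rwa [star_mul, C.star_numberProd hf, star_zero] at h

theorem numberProd_sq (l : List (Fin n)) :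
    C.numberProd f l * C.numberProd f l = C.numberProd f l := by
  induction l with
  | nil => simp [numberProd]
  | cons i l ih =>
    rw [numberProd_cons, mul_assoc, ← mul_assoc (C.numberProd f l),
      ← (C.number_comm_numberProd hf i l).eq, mul_assoc _ (C.numberProd f l), ih, ← mul_assoc,
      mul_assoc (star (C.fermField (f i))) _ (star _ * _), C.annih_mul_star_mul hf]

/-- Write a for the first annihilator and R for the rest of the product. If a* a R = 0, then
multiplying by a on the left and a* on the right gives a a* R = 0, since a* commutes with R. As a a*
+ a* a = 1, it follows that R = 0. -/
theorem numberProd_ne_zero {l : List (Fin n)} (hl : l.Nodup) : C.numberProd f l ≠ 0 := by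
  induction l with
  | nil =>
    intro h
    have h2 : (1 : 𝔄) = 0 := congrArg Subtype.val h
    have := C.nontrivial
    exact one_ne_zero h2
  | cons i l ih =>
    rw [List.nodup_cons] at hl
    intro h
    refine ih hl.2 ?_
    have hc := C.annih_comm_numberProd hf hl.1
    have hc' : Commute (star (C.fermField (f i))) (C.numberProd f l) := by
      have := hc.star_star
      rwa [C.star_numberProd hf] at this
    rw [numberProd_cons] at h
    have h2 : C.fermField (f i) * star (C.fermField (f i)) * C.numberProd f l = 0 := by
      have h3 : C.fermField (f i) * (star (C.fermField (f i)) * C.fermField (f i) *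
          C.numberProd f l) * star (C.fermField (f i)) = 0 := by rw [h, mul_zero, zero_mul]
      rwa [← mul_assoc, C.annih_mul_star_mul hf, mul_assoc, ← hc'.eq, ← mul_assoc] at h3
    rw [← one_mul (C.numberProd f l), ← C.annih_mul_star hf i, add_mul, h, h2, add_zero]

/-- The product of all number operators is a minimal projection. -/
theorem numberProd_mul_list (l : List T.QH) :
    (∃ c : ℂ, C.numberProd f (List.finRange n) * (l.map C.fermField).prod *
      C.numberProd f (List.finRange n) = c • C.numberProd f (List.finRange n)) ∧
    (Odd l.length → C.numberProd f (List.finRange n) * (l.map C.fermField).prod *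
      C.numberProd f (List.finRange n) = 0) := by
  set E := C.numberProd f (List.finRange n) with hE
  induction hm : l.length using Nat.strong_induction_on generalizing l with
  | _ m ih =>
    cases l with
    | nil =>
      refine ⟨⟨1, by rw [List.map_nil, List.prod_nil, mul_one, C.numberProd_sq hf, one_smul]⟩,
        fun h => ?_⟩
      rw [← hm] at h
      simp at h
    | cons k l =>
      rw [List.length_cons] at hm
      have herase : ∀ j : Fin l.length, (l.eraseIdx j).length + 2 = m := fun j => by
        rw [List.length_eraseIdx_of_lt j.2]
        have := j.2
        omega
      refine hf.induction (p := fun k => (∃ c : ℂ, E * ((k :: l).map C.fermField).prod * E =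
        c • E) ∧ (Odd m → E * ((k :: l).map C.fermField).prod * E = 0)) ?_ ?_ ?_ ?_ ?_ k
      · exact ⟨⟨0, by simp⟩, by simp⟩
      · rintro x y ⟨⟨c, hc⟩, h1⟩ ⟨⟨d, hd⟩, h2⟩
        rw [List.map_cons, List.prod_cons] at *
        rw [map_add, add_mul, mul_add, add_mul]
        exact ⟨⟨c + d, by rw [hc, hd, add_smul]⟩, fun h => by rw [h1 h, h2 h, add_zero]⟩
      · rintro a x ⟨⟨c, hc⟩, h1⟩
        rw [List.map_cons, List.prod_cons] at *
        rw [map_smul, smul_mul_assoc, mul_smul_comm, smul_mul_assoc]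
        exact ⟨⟨a * c, by rw [hc, smul_smul]⟩, fun h => by rw [h1 h, smul_zero]⟩
      · intro i
        have : E * (((f i) :: l).map C.fermField).prod * E = 0 := by
          rw [List.map_cons, List.prod_cons, ← mul_assoc,
            C.numberProd_mul_annih hf (List.mem_finRange i), zero_mul, zero_mul]
        exact ⟨⟨0, by rw [this, zero_smul]⟩, fun _ => this⟩
      · intro i
        -- Here the field is annihilated by the right factor E, so it is moved through the product.
        -- Only the contractions remain; they have two fields fewer, hence the same parity.
        have : E * (((T.JQ (f i)) :: l).map C.fermField).prod * E =
            ∑ j : Fin l.length, ((-1 : ℂ) ^ (j : ℕ) * ⟪T.JQ (T.JQ (f i)), l.get j⟫_ℂ) •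
              (E * ((l.eraseIdx j).map C.fermField).prod * E) := by
          have h3 : C.fermField (T.JQ (f i)) * E = 0 := by
            rw [← C.star_fermField]
            exact C.star_annih_mul_numberProd hf (List.mem_finRange i)
          rw [List.map_cons, List.prod_cons, fermField_mul_list, mul_add, add_mul,
            mul_smul_comm, smul_mul_assoc, mul_assoc E ((l.map C.fermField).prod * _) E,
            mul_assoc (l.map C.fermField).prod _ E, h3, mul_zero, mul_zero, smul_zero, add_zero,
            Finset.mul_sum, Finset.sum_mul]
          simp only [mul_smul_comm, smul_mul_assoc]
        constructor
        · choose c hc using fun j : Fin l.length =>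
            (ih _ (by have := herase j; omega) (l.eraseIdx j) rfl).1
          refine ⟨∑ j : Fin l.length, ((-1 : ℂ) ^ (j : ℕ) * ⟪T.JQ (T.JQ (f i)), l.get j⟫_ℂ) *
            c j, ?_⟩
          rw [this, Finset.sum_smul]
          refine Finset.sum_congr rfl fun j _ => ?_
          rw [hc, smul_smul]
        · intro hodd
          rw [this]
          refine Finset.sum_eq_zero fun j _ => ?_
          rw [(ih _ (by have := herase j; omega) (l.eraseIdx j) rfl).2, smul_zero]
          have := herase j
          rw [← this] at hodd
          simpa [Nat.odd_add] using hodd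

end Number

/-! ### States -/

/-- The functional vanishes on odd products. -/
def IsEven (ω : C.ferm →ₗ[ℂ] ℂ) : Prop :=
  ∀ l : List T.QH, Odd l.length → ω (l.map C.fermField).prod = 0

section States

variable [FiniteDimensional ℂ T.QH] {n : ℕ} {f : Fin n → T.QH} (hf : T.JQ.IsPairBasis f)
include hf

/-- The pure state supported by the product of all number operators. -/
theorem exists_pure_state : ∃ ω : C.ferm →ₗ[ℂ] ℂ, C.IsState ω ∧ C.IsEven ω ∧
    ∀ A, C.numberProd f (List.finRange n) * A * C.numberProd f (List.finRange n) =
      ω A • C.numberProd f (List.finRange n) := by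
  set E := C.numberProd f (List.finRange n) with hE
  have hE0 : E ≠ 0 := C.numberProd_ne_zero hf (List.nodup_finRange n)
  have hEE : E * E = E := C.numberProd_sq hf _
  have hEs : star E = E := C.star_numberProd hf _
  have hmem : ∀ A : C.ferm, ∃ c : ℂ, E * A * E = c • E := by
    refine C.ferm_induction ?_ ?_ fun l => (C.numberProd_mul_list hf l).1
    · rintro a b ⟨c, hc⟩ ⟨d, hd⟩
      exact ⟨c + d, by rw [mul_add, add_mul, hc, hd, add_smul]⟩
    · rintro c a ⟨d, hd⟩
      exact ⟨c * d, by rw [mul_smul_comm, smul_mul_assoc, hd, smul_smul]⟩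
  choose ω hω using hmem
  have hinj : ∀ {c d : ℂ}, c • E = d • E → c = d := fun h => smul_left_injective ℂ hE0 h
  set ω' : C.ferm →ₗ[ℂ] ℂ :=
    { toFun := ω
      map_add' := fun a b => hinj (by rw [← hω, mul_add, add_mul, hω, hω, add_smul])
      map_smul' := fun c a => hinj (by
        rw [← hω, mul_smul_comm, smul_mul_assoc, hω, smul_smul]; rfl) }
  refine ⟨ω', ⟨?_, fun A => ?_⟩, fun l hl => ?_, hω⟩
  · refine hinj ?_
    rw [one_smul]
    exact (hω 1).symm.trans (by rw [mul_one, hEE])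
  · -- positivity is inherited from the C*-algebra
    have h1 : ω (star A * A) • (E : 𝔄) = star ((A * E : C.ferm) : 𝔄) * ((A * E : C.ferm) : 𝔄) := by
      have h2 : star (A * E) * (A * E) = ω (star A * A) • E := by
        rw [star_mul, hEs, ← hω]
        simp only [mul_assoc]
      exact (congrArg Subtype.val h2).symm
    have hE0' : (E : 𝔄) ≠ 0 := fun h => hE0 (Subtype.ext h)
    have hEE' : star (E : 𝔄) * (E : 𝔄) = E := by
      have : star E * E = E := by rw [hEs, hEE]
      exact congrArg Subtype.val this
    change 0 ≤ ω (star A * A)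
    -- E A* A E is selfadjoint and E is nonzero, so the coefficient is real and only its sign
    -- remains to be settled.
    have hself : star (ω (star A * A)) = ω (star A * A) := by
      refine hinj ?_
      have h3 : star (E * (star A * A) * E) = E * (star A * A) * E := by
        simp only [star_mul, star_star, hEs, mul_assoc]
      rw [hω, star_smul, hEs] at h3
      exact h3
    obtain ⟨r, hr⟩ : ∃ r : ℝ, ω (star A * A) = (r : ℂ) :=
      ⟨_, (Complex.conj_eq_iff_re.1 hself).symm⟩
    rw [hr] at h1 ⊢
    suffices 0 ≤ r by exact_mod_cast this
    by_contra! hneg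
    -- otherwise a nonzero element would be both positive and negative
    have h4 : star ((A * E : C.ferm) : 𝔄) * ((A * E : C.ferm) : 𝔄) +
        star ((((√(-r) : ℝ) : ℂ)) • (E : 𝔄)) * ((((√(-r) : ℝ) : ℂ)) • (E : 𝔄)) = 0 := by
      rw [← h1, star_smul, smul_mul_smul_comm, hEE', ← add_smul]
      have : (r : ℂ) + star ((√(-r) : ℝ) : ℂ) * ((√(-r) : ℝ) : ℂ) = 0 := by
        have h5 : star ((√(-r) : ℝ) : ℂ) = ((√(-r) : ℝ) : ℂ) := Complex.conj_ofReal _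
        rw [h5, ← Complex.ofReal_mul, Real.mul_self_sqrt (by linarith)]
        push_cast
        ring
      rw [this, zero_smul]
    let _ : PartialOrder 𝔄 := CStarAlgebra.spectralOrder 𝔄
    have : StarOrderedRing 𝔄 := CStarAlgebra.spectralOrderedRing 𝔄
    have h6 := (add_eq_zero_iff_of_nonneg (star_mul_self_nonneg ((A * E : C.ferm) : 𝔄))
      (star_mul_self_nonneg ((((√(-r) : ℝ) : ℂ)) • (E : 𝔄)))).1 h4
    rw [h6.1, smul_eq_zero] at h1
    rcases h1 with h1 | h1
    · have : r = 0 := by exact_mod_cast h1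
      exact hneg.ne this
    · exact hE0' h1
  · refine hinj ?_
    rw [zero_smul]
    exact (hω _).symm.trans ((C.numberProd_mul_list hf l).2 hl)

omit hf [FiniteDimensional ℂ T.QH] in
/-- The functional `A ↦ ω (x* A x)`. -/
noncomputable def conjBy (ω : C.ferm →ₗ[ℂ] ℂ) (x : C.ferm) : C.ferm →ₗ[ℂ] ℂ :=
  ω ∘ₗ LinearMap.mulLeft ℂ (star x) ∘ₗ LinearMap.mulRight ℂ x

omit hf [FiniteDimensional ℂ T.QH] in
theorem conjBy_apply (ω : C.ferm →ₗ[ℂ] ℂ) (x A : C.ferm) :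
    C.conjBy ω x A = ω (star x * (A * x)) := rfl

omit hf [FiniteDimensional ℂ T.QH] in
theorem IsState.conjBy_nonneg {ω : C.ferm →ₗ[ℂ] ℂ} (hω : C.IsState ω) (x A : C.ferm) :
    0 ≤ C.conjBy ω x (star A * A) := by
  have := hω.nonneg (A * x)
  rw [star_mul] at this
  rw [conjBy_apply]
  simpa only [mul_assoc] using this

omit hf [FiniteDimensional ℂ T.QH] in
-- On one side b has to pass x*, on the other it has to pass x; the same sign ε appears on both
-- sides and drops out.
theorem conjBy_kms {ω : C.ferm →ₗ[ℂ] ℂ} {p q ε : ℂ} {b x : C.ferm}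
    (hω : ∀ A, p * ω (b * A) = q * ω (A * b)) (hε : ε * ε = 1) (h1 : x * b = ε • (b * x))
    (h2 : star x * b = ε • (b * star x)) (A : C.ferm) :
    p * C.conjBy ω x (b * A) = q * C.conjBy ω x (A * b) := by
  have h3 : b * x = ε • (x * b) := by rw [h1, smul_smul, hε, one_smul]
  rw [conjBy_apply, conjBy_apply, mul_assoc b, ← mul_assoc, h2, smul_mul_assoc, map_smul,
    smul_eq_mul, mul_left_comm, mul_assoc b, hω, mul_assoc A, h3, mul_smul_comm, mul_smul_comm,
    map_smul, smul_eq_mul, mul_left_comm]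
  simp only [mul_assoc]

/-- The KMS condition for the mode `f i`. -/
def KMS (f : Fin n → T.QH) (s : Fin n → ℝ) (ω : C.ferm →ₗ[ℂ] ℂ) (i : Fin n) : Prop :=
  (∀ A, (s i : ℂ) * ω (C.fermField (f i) * A) = (1 - s i : ℂ) * ω (A * C.fermField (f i))) ∧
  ∀ A, (1 - s i : ℂ) * ω (star (C.fermField (f i)) * A) =
    (s i : ℂ) * ω (A * star (C.fermField (f i)))

/-- A transformation of functionals that implements the KMS condition for the mode `f i`. -/
noncomputable def kraus (f : Fin n → T.QH) (s : Fin n → ℝ) (ω : C.ferm →ₗ[ℂ] ℂ) (i : Fin n) :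
    C.ferm →ₗ[ℂ] ℂ :=
  (1 - s i : ℂ) • (C.conjBy ω (C.fermField (f i)) +
    C.conjBy ω (C.fermField (f i) * star (C.fermField (f i)))) +
  (s i : ℂ) • (C.conjBy ω (star (C.fermField (f i))) +
    C.conjBy ω (star (C.fermField (f i)) * C.fermField (f i)))

omit [FiniteDimensional ℂ T.QH] in
-- Nilpotency of the mode kills half of the terms on each side. The surviving expressions coincide,
-- with weight 1 - s on one side and s on the other, so the identity holds for an arbitrary
-- functional ω.
theorem kms_kraus_self (s : Fin n → ℝ) (ω : C.ferm →ₗ[ℂ] ℂ) (i : Fin n) :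
    C.KMS f s (C.kraus f s ω i) i := by
  have hc := C.annih_sq hf i
  have hd := C.star_annih_sq hf i
  have h1 := C.annih_mul_star_mul hf i
  have h2 := congrArg star h1
  rw [star_mul, star_mul, star_star] at h2
  have e1 : ∀ X, C.fermField (f i) * (C.fermField (f i) * X) = 0 := fun X => by
    rw [← mul_assoc, hc, zero_mul]
  have e2 : ∀ X, star (C.fermField (f i)) * (star (C.fermField (f i)) * X) = 0 := fun X => by
    rw [← mul_assoc, hd, zero_mul]
  have e3 : ∀ X, C.fermField (f i) * (star (C.fermField (f i)) * (C.fermField (f i) * X)) =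
      C.fermField (f i) * X := fun X => by rw [← mul_assoc _ _ X, ← mul_assoc, h1]
  have e4 : ∀ X, star (C.fermField (f i)) * (C.fermField (f i) *
      (star (C.fermField (f i)) * X)) = star (C.fermField (f i)) * X := fun X => by
    rw [← mul_assoc, ← mul_assoc, h2]
  rw [mul_assoc] at h2
  constructor <;> intro A <;>
    simp only [kraus, LinearMap.add_apply, LinearMap.smul_apply, conjBy_apply, star_mul,
      star_star, mul_assoc, hc, hd, h1, h2, e1, e2, e3, e4, mul_zero, map_zero, smul_eq_mul] <;>
    ring

omit [FiniteDimensional ℂ T.QH] in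
-- The operators in `kraus` are monomials in mode i; odd ones anticommute and even ones commute with
-- the fields of mode j, so `conjBy_kms` applies with ε = -1 or ε = 1.
theorem kms_kraus {s : Fin n → ℝ} {ω : C.ferm →ₗ[ℂ] ℂ} {i j : Fin n} (hij : i ≠ j)
    (h : C.KMS f s ω j) : C.KMS f s (C.kraus f s ω i) j := by
  have h1 := C.annih_anticomm hf i j
  have h2 := C.annih_mul_star_of_ne hf hij
  have h3 := congrArg star (C.annih_mul_star_of_ne hf hij.symm)
  have h4 := C.star_annih_anticomm hf i j
  have h5 : star (C.fermField (f i)) * C.fermField (f j) =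
      -(C.fermField (f j) * star (C.fermField (f i))) := by
    rw [C.annih_mul_star_of_ne hf hij.symm, neg_neg]
  have key : ∀ {p q : ℂ} {b : C.ferm}, (∀ A, p * ω (b * A) = q * ω (A * b)) →
      C.fermField (f i) * b = -(b * C.fermField (f i)) →
      star (C.fermField (f i)) * b = -(b * star (C.fermField (f i))) →
      ∀ A, p * C.kraus f s ω i (b * A) = q * C.kraus f s ω i (A * b) := by
    intro p q b hb hb1 hb2 A
    have m1 : (-1 : ℂ) * (-1) = 1 := by norm_num
    have k1 := C.conjBy_kms hb m1 (x := C.fermField (f i)) (by simp [hb1]) (by simp [hb2]) A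
    have k2 := C.conjBy_kms hb m1 (x := star (C.fermField (f i))) (by simp [hb2])
      (by simp [hb1]) A
    have t1 : C.fermField (f i) * star (C.fermField (f i)) * b =
        b * (C.fermField (f i) * star (C.fermField (f i))) := by
      rw [mul_assoc, hb2, mul_neg, ← mul_assoc, hb1, neg_mul, neg_neg, mul_assoc]
    have t2 : star (C.fermField (f i)) * C.fermField (f i) * b =
        b * (star (C.fermField (f i)) * C.fermField (f i)) := by
      rw [mul_assoc, hb1, mul_neg, ← mul_assoc, hb2, neg_mul, neg_neg, mul_assoc]
    have k3 := C.conjBy_kms hb (one_mul 1)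
      (x := C.fermField (f i) * star (C.fermField (f i))) (by simp [t1]) (by simp [t1]) A
    have k4 := C.conjBy_kms hb (one_mul 1)
      (x := star (C.fermField (f i)) * C.fermField (f i)) (by simp [t2]) (by simp [t2]) A
    simp only [kraus, LinearMap.add_apply, LinearMap.smul_apply, smul_eq_mul]
    linear_combination (1 - s i : ℂ) * (k1 + k3) + (s i : ℂ) * (k2 + k4)
  exact ⟨key h.1 h1 h5, key h.2 h2 h4⟩

omit [FiniteDimensional ℂ T.QH] in
-- Each of the two brackets takes the value ω(a* a + a a*) = 1 at the unit, and their nonnegative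
-- weights add up to 1.
theorem isState_kraus {s : Fin n → ℝ} (hs : ∀ i, 0 ≤ s i ∧ s i ≤ 1) {ω : C.ferm →ₗ[ℂ] ℂ}
    (hω : C.IsState ω) (i : Fin n) : C.IsState (C.kraus f s ω i) := by
  constructor
  · have h1 := congrArg ω (C.annih_mul_star hf i)
    rw [map_add, hω.map_one] at h1
    have h2 := C.annih_mul_star_mul hf i
    have h3 := congrArg star h2
    rw [star_mul, star_mul, star_star, mul_assoc] at h3
    simp only [kraus, LinearMap.add_apply, LinearMap.smul_apply, conjBy_apply, star_mul,
      star_star, one_mul, mul_assoc, h2, h3, smul_eq_mul]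
    linear_combination h1
  · intro A
    have h0 : (0 : ℂ) ≤ (s i : ℂ) := by exact_mod_cast (hs i).1
    have h1 : (0 : ℂ) ≤ (1 - s i : ℂ) := by
      have : (0 : ℝ) ≤ 1 - s i := by linarith [(hs i).2]
      exact_mod_cast this
    exact add_nonneg (mul_nonneg h1 (add_nonneg (hω.conjBy_nonneg C _ _) (hω.conjBy_nonneg C _ _)))
      (mul_nonneg h0 (add_nonneg (hω.conjBy_nonneg C _ _) (hω.conjBy_nonneg C _ _)))

omit hf [FiniteDimensional ℂ T.QH] in
theorem isEven_kraus (s : Fin n → ℝ) {ω : C.ferm →ₗ[ℂ] ℂ} (hω : C.IsEven ω) (i : Fin n) :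
    C.IsEven (C.kraus f s ω i) := by
  intro l hl
  have key : ∀ a b : List T.QH, Even (a.length + b.length) →
      ω ((a.map C.fermField).prod * ((l.map C.fermField).prod * (b.map C.fermField).prod)) = 0 := by
    intro a b hab
    have := hω (a ++ (l ++ b)) (by
      rw [List.length_append, List.length_append, add_left_comm]
      exact hl.add_even hab)
    simpa using this
  have k1 := key [T.JQ (f i)] [f i] (by simp)
  have k2 := key [f i] [T.JQ (f i)] (by simp)
  have k3 := key [f i, T.JQ (f i)] [f i, T.JQ (f i)] (by simp; decide)
  have k4 := key [T.JQ (f i), f i] [T.JQ (f i), f i] (by simp; decide)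
  simp only [List.map_cons, List.map_nil, List.prod_cons, List.prod_nil, mul_one,
    mul_assoc] at k1 k2 k3 k4
  simp only [kraus, LinearMap.add_apply, LinearMap.smul_apply, conjBy_apply, star_mul,
    C.star_fermField, T.JQ.involutive, mul_assoc, k1, k2, k3, k4]
  simp

/-- Start with a pure state and transform it mode by mode. Each transformation installs the
condition for its own mode and preserves those already present. -/
theorem exists_kms_state {s : Fin n → ℝ} (hs : ∀ i, 0 ≤ s i ∧ s i ≤ 1) :
    ∃ ω : C.ferm →ₗ[ℂ] ℂ, C.IsState ω ∧ C.IsEven ω ∧ ∀ i, C.KMS f s ω i := by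
  have key : ∀ t : Finset (Fin n), ∃ ω : C.ferm →ₗ[ℂ] ℂ, C.IsState ω ∧ C.IsEven ω ∧
      ∀ i ∈ t, C.KMS f s ω i := by
    intro t
    induction t using Finset.induction_on with
    | empty =>
      obtain ⟨ω, h1, h2, -⟩ := C.exists_pure_state hf
      exact ⟨ω, h1, h2, by simp⟩
    | insert i t hi ih =>
      obtain ⟨ω, h1, h2, h3⟩ := ih
      refine ⟨C.kraus f s ω i, C.isState_kraus hf hs h1 i, C.isEven_kraus s h2 i, fun j hj => ?_⟩
      rcases Finset.mem_insert.1 hj with rfl | hj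
      · exact C.kms_kraus_self hf s ω j
      · exact C.kms_kraus hf (fun h => hi (h ▸ hj)) (h3 j hj)
  obtain ⟨ω, h1, h2, h3⟩ := key Finset.univ
  exact ⟨ω, h1, h2, fun i => h3 i (Finset.mem_univ i)⟩

omit hf [FiniteDimensional ℂ T.QH] in
-- For odd l, moving k through the product gives ω(k l) + ω(l k) as a sum of contractions, and the
-- hypothesis with p + q = 1 turns this into ω(k l) = q times that sum. The case of a single field
-- identifies q ⟨J k, h⟩ as the two-point function. For even l both sides vanish.
theorem wick_of_kms {ω : C.ferm →ₗ[ℂ] ℂ} (h1 : ω 1 = 1) (hω : C.IsEven ω) {p q : ℂ}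
    (hpq : p + q = 1) {k : T.QH}
    (h : ∀ A, p * ω (C.fermField k * A) = q * ω (A * C.fermField k)) :
    (∀ h, ω (C.fermField k * C.fermField h) = q * ⟪T.JQ k, h⟫_ℂ) ∧
    ∀ l : List T.QH, ω (C.fermField k * (l.map C.fermField).prod) =
      ∑ j : Fin l.length, (-1 : ℂ) ^ (j : ℕ) * ω (C.fermField k * C.fermField (l.get j)) *
        ω ((l.eraseIdx j).map C.fermField).prod := by
  have hodd : ∀ l : List T.QH, Odd l.length → ω (C.fermField k * (l.map C.fermField).prod) =
      q * ∑ j : Fin l.length, (-1 : ℂ) ^ (j : ℕ) * ⟪T.JQ k, l.get j⟫_ℂ *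
        ω ((l.eraseIdx j).map C.fermField).prod := by
    intro l hl
    have h2 := congrArg ω (C.fermField_mul_list k l)
    rw [hl.neg_one_pow, map_add, map_smul, map_sum, neg_smul, one_smul] at h2
    simp only [map_smul, smul_eq_mul] at h2
    have h3 := h (l.map C.fermField).prod
    linear_combination q * h2 + h3 - ω (C.fermField k * (l.map C.fermField).prod) * hpq
  have h2 : ∀ h, ω (C.fermField k * C.fermField h) = q * ⟪T.JQ k, h⟫_ℂ := by
    intro h
    have := hodd [h] (by simp)
    simpa [h1] using this
  refine ⟨h2, fun l => ?_⟩
  rcases Nat.even_or_odd l.length with hl | hl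
  · have h3 := hω (k :: l) (by simpa using hl.add_one)
    rw [List.map_cons, List.prod_cons] at h3
    rw [h3]
    refine (Finset.sum_eq_zero fun j _ => ?_).symm
    rw [hω (l.eraseIdx j), mul_zero]
    rw [List.length_eraseIdx_of_lt j.2]
    have := j.2
    exact Nat.Even.sub_odd (by omega) hl odd_one
  · rw [hodd l hl, Finset.mul_sum]
    refine Finset.sum_congr rfl fun j _ => ?_
    rw [h2]
    ring

omit [FiniteDimensional ℂ T.QH] in
theorem isQuasifree_of_kms {S : T.QH →L[ℂ] T.QH} (hS : T.JQ.IsCovariance S) {s : Fin n → ℝ}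
    (hfs : ∀ i, S (f i) = (s i : ℂ) • f i) {ω : C.ferm →ₗ[ℂ] ℂ} (h1 : C.IsState ω)
    (h2 : C.IsEven ω) (h3 : ∀ i, C.KMS f s ω i) : C.IsQuasifree S ω := by
  have ha := fun i => C.wick_of_kms h1.map_one h2 (p := s i) (q := 1 - s i) (by ring) (h3 i).1
  have hb := fun i => C.wick_of_kms h1.map_one h2 (p := 1 - s i) (q := s i)
    (k := T.JQ (f i)) (by ring) (by rw [← C.star_fermField]; exact (h3 i).2)
  refine ⟨h1, fun k h => ?_, fun k l => ?_⟩
  · refine hf.induction (p := fun k => ω (C.fermField k * C.fermField h) = ⟪T.JQ k, S h⟫_ℂ)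
      (by simp) ?_ ?_ ?_ ?_ k
    · intro x y hx hy
      rw [map_add, add_mul, map_add, hx, hy, map_add, inner_add_left]
    · intro c x hx
      rw [map_smul, smul_mul_assoc, map_smul, hx, map_smulₛₗ, inner_smul_left, Complex.conj_conj,
        smul_eq_mul]
    · intro i
      rw [(ha i).1, ← hS.inner_apply, hS.conj_eigen (hfs i), inner_smul_left, Complex.conj_ofReal]
      push_cast
      rfl
    · intro i
      rw [(hb i).1, T.JQ.involutive, ← hS.inner_apply, hfs, inner_smul_left, Complex.conj_ofReal]
  · refine hf.induction (p := fun k => ω (C.fermField k * (l.map C.fermField).prod) =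
      ∑ j : Fin l.length, (-1 : ℂ) ^ (j : ℕ) * ω (C.fermField k * C.fermField (l.get j)) *
        ω ((l.eraseIdx j).map C.fermField).prod) (by simp) ?_ ?_ (fun i => (ha i).2 l)
      (fun i => (hb i).2 l) k
    · intro x y hx hy
      simp only [map_add, add_mul, mul_add, Finset.sum_add_distrib, hx, hy]
    · intro c x hx
      simp only [map_smul, smul_mul_assoc, hx, smul_eq_mul, Finset.mul_sum]
      refine Finset.sum_congr rfl fun j _ => ?_
      ring

omit hf in
theorem isQuasifree_quasifree (hn : Module.finrank ℂ T.QH = 2 * n) {S : T.QH →L[ℂ] T.QH}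
    (hS : T.JQ.IsCovariance S) : C.IsQuasifree S (C.quasifree S) := by
  refine Classical.epsilon_spec (p := C.IsQuasifree S) ?_
  obtain ⟨f, s, hf, hfs, hs⟩ := hS.exists_isPairBasis hn
  obtain ⟨ω, h1, h2, h3⟩ := C.exists_kms_state hf hs
  exact ⟨ω, C.isQuasifree_of_kms hf hS hfs h1 h2 h3⟩

omit hf in
theorem IsQuasifree.eq {S : T.QH →L[ℂ] T.QH} {ω ω' : C.ferm →ₗ[ℂ] ℂ} (h : C.IsQuasifree S ω)
    (h' : C.IsQuasifree S ω') : ω = ω' := by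
  have key : ∀ l : List T.QH, ω (l.map C.fermField).prod = ω' (l.map C.fermField).prod := by
    intro l
    induction hm : l.length using Nat.strong_induction_on generalizing l with
    | _ m ih =>
      cases l with
      | nil => rw [List.map_nil, List.prod_nil, h.state.map_one, h'.state.map_one]
      | cons k l =>
        rw [List.map_cons, List.prod_cons, h.wick, h'.wick]
        refine Finset.sum_congr rfl fun j _ => ?_
        rw [h.two_point, h'.two_point, ih _ ?_ (l.eraseIdx j) rfl]
        rw [List.length_eraseIdx_of_lt j.2, ← hm, List.length_cons]
        omega
  refine LinearMap.ext fun A => C.ferm_induction (P := fun A => ω A = ω' A) ?_ ?_ key A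
  · intro a b ha hb
    rw [map_add, map_add, ha, hb]
  · intro c a ha
    rw [map_smul, map_smul, ha]

/-- The support projection of a pure quasifree state. -/
theorem support_quasifree {P : T.QH →L[ℂ] T.QH} (hP : T.JQ.IsBasisProjection P)
    (h1 : ∀ i, P (f i) = f i) :
    C.support (C.quasifree P) = C.numberProd f (List.finRange n) ∧
    C.IsQuasifree P (C.quasifree P) ∧
    ∀ A, C.numberProd f (List.finRange n) * A * C.numberProd f (List.finRange n) =
      C.quasifree P A • C.numberProd f (List.finRange n) := by
  set E := C.numberProd f (List.finRange n) with hE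
  have hEE : E * E = E := C.numberProd_sq hf _
  have hEs : star E = E := C.star_numberProd hf _
  have hE0 : E ≠ 0 := C.numberProd_ne_zero hf (List.nodup_finRange n)
  obtain ⟨ω, w1, w2, w3⟩ := C.exists_pure_state hf
  have hinj : ∀ {c d : ℂ}, c • E = d • E → c = d := fun h => smul_left_injective ℂ hE0 h
  -- All f i have eigenvalue 1, so the KMS condition says that ω vanishes on elements beginning with
  -- an annihilator or ending with a creator. This holds because E annihilates them from the
  -- respective side.
  have hω : C.IsQuasifree P ω := by
    refine C.isQuasifree_of_kms hf hP.toIsCovariance (s := fun _ => 1) (fun i => by simp [h1])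
      w1 w2 fun i => ⟨fun A => ?_, fun A => ?_⟩
    · have : ω (C.fermField (f i) * A) = 0 := by
        refine hinj ?_
        rw [zero_smul, ← w3, ← mul_assoc, C.numberProd_mul_annih hf (List.mem_finRange i),
          zero_mul, zero_mul]
      simp [this]
    · have : ω (A * star (C.fermField (f i))) = 0 := by
        refine hinj ?_
        rw [zero_smul, ← w3, mul_assoc, mul_assoc,
          C.star_annih_mul_numberProd hf (List.mem_finRange i), mul_zero, mul_zero]
      simp [this]
  have hq : C.IsQuasifree P (C.quasifree P) :=
    Classical.epsilon_spec (p := C.IsQuasifree P) ⟨ω, hω⟩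
  have hqω : C.quasifree P = ω := hq.eq C hω
  have hsupp : C.IsSupport ω E := by
    refine ⟨⟨hEE, hEs⟩, hinj ?_, fun F hF hF1 => ?_⟩
    · rw [← w3, hEE, hEE, one_smul]
    -- By minimality E (1 - F) E = (1 - ω(F)) E = 0, so E lies below every projection of expectation
    -- 1.
    · have h2 : star ((1 - F) * E) * ((1 - F) * E) = 0 := by
        have h3 : star (1 - F) * (1 - F) = 1 - F := by
          rw [star_sub, star_one, hF.isSelfAdjoint.star_eq, mul_sub, mul_one, sub_mul, one_mul,
            hF.isIdempotentElem.eq, sub_self, sub_zero]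
        rw [star_mul, hEs, mul_assoc, ← mul_assoc (star (1 - F)), h3, ← mul_assoc, w3, map_sub,
          w1.map_one, hF1, sub_self, zero_smul]
      have h4 : (1 - F) * E = 0 := by
        refine Subtype.ext ?_
        exact (CStarRing.star_mul_self_eq_zero_iff _).1 (congrArg Subtype.val h2)
      have h5 : E = F * E := by
        rw [sub_mul, one_mul, sub_eq_zero] at h4
        exact h4
      have h6 := congrArg star h5
      rw [star_mul, hEs, hF.isSelfAdjoint.star_eq] at h6
      exact h6.symm
  have hsupp' : C.IsSupport (C.quasifree P) (C.support (C.quasifree P)) :=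
    Classical.epsilon_spec (p := C.IsSupport (C.quasifree P)) ⟨E, hqω ▸ hsupp⟩
  rw [hqω] at hsupp'
  rw [hqω]
  refine ⟨?_, hω, w3⟩
  set F := C.support ω
  have a1 := hsupp.le F hsupp'.proj hsupp'.one
  have a2 := congrArg star (hsupp'.le E hsupp.proj hsupp.one)
  rw [star_mul, hEs, hsupp'.proj.isSelfAdjoint.star_eq] at a2
  exact a2.symm.trans a1

end States

end CARAlgebra

end GAR

namespace GAR

namespace CARAlgebra

variable {H : Type*} [NormedAddCommGroup H] [InnerProductSpace ℂ H] {T : Triple H}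
  {𝔄 : Type*} [CStarAlgebra 𝔄] (C : CARAlgebra T.conjQ 𝔄)

instance completeSpace_gar : CompleteSpace C.gar :=
  (Subalgebra.isClosed_topologicalClosure _).completeSpace_coe

instance completeSpace_grass : CompleteSpace C.grass :=
  (Subalgebra.isClosed_topologicalClosure _).completeSpace_coe

theorem continuous_grassIncl : Continuous C.grassIncl :=
  continuous_induced_rng.2 (by
    have : (Subtype.val ∘ C.grassIncl : C.grass → 𝔄) = Subtype.val :=
      funext fun a => C.coe_grassIncl a
    rw [this]
    exact continuous_subtype_val)

/-- Closed linear conditions on the GAR algebra are checked on products of generators. -/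
theorem gar_induction [FiniteDimensional ℂ T.QH] {P : C.gar → Prop} (hcl : IsClosed {X | P X})
    (hadd : ∀ X Y, P X → P Y → P (X + Y)) (hsmul : ∀ (c : ℂ) X, P X → P (c • X))
    (h : ∀ (l : List T.QH) (m : List T.QHᗮ), P (C.fermIncl (l.map C.fermField).prod *
      C.grassIncl (m.map C.grassField).prod)) (X : C.gar) : P X := by
  refine C.denseRange_mulMap.induction_on (p := P) X hcl fun t => ?_
  induction t using TensorProduct.induction_on with
  | zero =>
    have := hsmul 0 _ (h [] [])
    rwa [zero_smul, ← map_zero C.mulMap] at this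
  | add s t hs ht => rw [map_add]; exact hadd _ _ hs ht
  | tmul A a =>
    rw [mulMap_tmul]
    refine C.ferm_induction (P := fun A => P (C.fermIncl A * C.grassIncl a)) ?_ ?_ (fun l => ?_) A
    · intro A B hA hB
      rw [map_add, add_mul]
      exact hadd _ _ hA hB
    · intro c A hA
      rw [map_smul, smul_mul_assoc]
      exact hsmul _ _ hA
    · refine C.grass_induction
        (P := fun a => P (C.fermIncl (l.map C.fermField).prod * C.grassIncl a)) ?_ ?_ ?_
        (fun m => h l m) a
      · exact hcl.preimage (continuous_const.mul C.continuous_grassIncl)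
      · intro a b ha hb
        rw [map_add, mul_add]
        exact hadd _ _ ha hb
      · intro c a ha
        rw [map_smul, mul_smul_comm]
        exact hsmul _ _ ha

/-! ### The Grassmann-Bose field -/

/-- The field `ξ ↦ Φ(ξ)` on the even phase space. -/
noncomputable def evenField : C.EvenPhaseSpace →ₗ[ℂ] C.gar := C.boseField ∘ₗ C.evenIncl

theorem coe_evenField_tmul (f : T.QH) (a : C.grassGraded 1) :
    ((C.evenField (f ⊗ₜ a) : C.gar) : 𝔄) = C.G f * ((a : C.grass) : 𝔄) := by
  change ((C.garField f * C.grassIncl a : C.gar) : 𝔄) = _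
  rw [Subalgebra.coe_mul, coe_grassIncl, coe_garField]

/-- Both G f and an odd element b anticommute with every Grassmann generator, so their product
commutes with it. -/
theorem evenField_mul_grass (ξ : C.EvenPhaseSpace) (a : C.grass) :
    C.evenField ξ * C.grassIncl a = C.grassIncl a * C.evenField ξ := by
  refine Subtype.ext ?_
  rw [Subalgebra.coe_mul, Subalgebra.coe_mul, coe_grassIncl]
  refine C.comm_grass (fun h => ?_) a
  induction ξ using TensorProduct.induction_on with
  | zero => simp
  | add ξ η hξ hη => rw [map_add, Subalgebra.coe_add, add_mul, mul_add, hξ, hη]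
  | tmul f b =>
    have h1 := congrArg Subtype.val (C.graded_anticomm b.2 (C.grassField_mem_graded h))
    have h1 : ((b : C.grass) : 𝔄) * C.G (h : H) = -(C.G (h : H) * ((b : C.grass) : 𝔄)) := h1
    rw [coe_evenField_tmul, mul_assoc, h1, mul_neg, ← mul_assoc, C.G_anticomm_perp _ h.2, neg_mul,
      neg_neg, mul_assoc]

section Form

variable [CompleteSpace H]

theorem grassAdjoint_one (hinf : ¬ FiniteDimensional ℂ T.QHᗮ) :
    C.grassAdjoint (1 : C.grass) = 1 := by
  have hs := C.isGrassAdjoint_grassAdjoint hinf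
  have h := hs.mul (C.grassAdjoint 1) 1
  rw [mul_one, hs.involutive, mul_one] at h
  exact h.symm

omit [CompleteSpace H] in
theorem rigging_tmul (f h : T.QH) (a b : C.grass) :
    C.rigging (f ⊗ₜ a) (h ⊗ₜ b) = ⟪f, h⟫_ℂ • (C.grassAdjoint a * b) := rfl

omit [CompleteSpace H] in
theorem phaseConj_one_tmul (f : T.QH) (a : C.grassGraded 1) :
    C.phaseConj 1 (f ⊗ₜ a) = T.JQ f ⊗ₜ C.grassAdjoint a := by
  change ((-1 : ℂ) ^ (1 + 1) • _ : (T.QH ⊗[ℂ] C.grassGraded 1) →ₗ⋆[ℂ] C.PhaseSpace) _ = _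
  rw [show (-1 : ℂ) ^ (1 + 1) = 1 by norm_num, one_smul]
  rfl

omit [CompleteSpace H] in
theorem evenIncl_tmul (f : T.QH) (a : C.grassGraded 1) :
    C.evenIncl (f ⊗ₜ a) = f ⊗ₜ (a : C.grass) := rfl

omit [CompleteSpace H] in
theorem act_tmul (A : T.QH →L[ℂ] T.QH) (f : T.QH) (a : C.grassGraded 1) :
    C.act A (f ⊗ₜ a) = A f ⊗ₜ a := rfl

theorem form_tmul (hinf : ¬ FiniteDimensional ℂ T.QHᗮ) (f h : T.QH) (a b : C.grassGraded 1) :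
    C.form (f ⊗ₜ a) (h ⊗ₜ b) = ⟪T.JQ f, h⟫_ℂ • ((a : C.grass) * b) := by
  rw [form, phaseConj_one_tmul, evenIncl_tmul, rigging_tmul,
    (C.isGrassAdjoint_grassAdjoint hinf).involutive]

theorem component_tmul (hinf : ¬ FiniteDimensional ℂ T.QHᗮ) (u h : T.QH) (b : C.grassGraded 1) :
    C.component u (h ⊗ₜ b) = ⟪u, h⟫_ℂ • (b : C.grass) := by
  rw [component, evenIncl_tmul, rigging_tmul, C.grassAdjoint_one hinf, one_mul]

omit [CompleteSpace H] in
/-- The form `⟨ξ⋆, η⟩_Q` as a bilinear map. -/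
noncomputable def formₗ : C.EvenPhaseSpace →ₗ[ℂ] C.EvenPhaseSpace →ₗ[ℂ] C.grass :=
  LinearMap.mk₂ ℂ C.form
    (fun ξ ξ' η => by simp only [form, map_add, LinearMap.add_apply])
    (fun c ξ η => by
      simp only [form, map_smulₛₗ, LinearMap.smul_apply, Complex.conj_conj])
    (fun ξ η η' => by simp only [form, map_add])
    (fun c ξ η => by simp only [form, map_smul])

omit [CompleteSpace H] in
theorem formₗ_apply (ξ η : C.EvenPhaseSpace) : C.formₗ ξ η = C.form ξ η := rfl

theorem form_mem_graded (hinf : ¬ FiniteDimensional ℂ T.QHᗮ) (ξ η : C.EvenPhaseSpace) :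
    C.form ξ η ∈ C.grassGraded 0 := by
  rw [← formₗ_apply]
  induction ξ using TensorProduct.induction_on with
  | zero => simp
  | add ξ ξ' h h' => rw [map_add, LinearMap.add_apply]; exact add_mem h h'
  | tmul f a =>
    induction η using TensorProduct.induction_on with
    | zero => simp
    | add η η' h h' => rw [map_add]; exact add_mem h h'
    | tmul h b =>
      rw [formₗ_apply, C.form_tmul hinf, C.grassGraded_congr (show 0 ≡ 1 + 1 [MOD 2] from rfl)]
      exact Submodule.smul_mem _ _ (C.graded_mul_mem a.2 b.2)

/-- The canonical commutation relations of the Grassmann-Bose field. -/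
theorem evenField_comm (hinf : ¬ FiniteDimensional ℂ T.QHᗮ) (ξ η : C.EvenPhaseSpace) :
    C.evenField ξ * C.evenField η - C.evenField η * C.evenField ξ =
      -C.grassIncl (C.form ξ η) := by
  rw [← formₗ_apply]
  induction ξ using TensorProduct.induction_on with
  | zero => simp
  | add ξ ξ' h h' =>
    rw [map_add, map_add, LinearMap.add_apply, map_add, neg_add, ← h, ← h']
    noncomm_ring
  | tmul f a =>
    induction η using TensorProduct.induction_on with
    | zero => simp
    | add η η' h h' =>
      rw [map_add, map_add, map_add, neg_add, ← h, ← h']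
      noncomm_ring
    | tmul h b =>
      refine Subtype.ext ?_
      have e1 := C.G_mul_graded (h : H) a.2
      have e2 := C.G_mul_graded (f : H) b.2
      have e3 := congrArg Subtype.val (C.graded_anticomm a.2 b.2)
      have e3 : ((a : C.grass) : 𝔄) * ((b : C.grass) : 𝔄) =
        -(((b : C.grass) : 𝔄) * ((a : C.grass) : 𝔄)) := e3
      have e4 := C.G_anticomm_ferm f.2 (h : H)
      rw [pow_one, neg_smul, one_smul] at e1 e2
      have e1' : ((a : C.grass) : 𝔄) * C.G (h : H) = -(C.G h * ((a : C.grass) : 𝔄)) := by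
        rw [e1, neg_neg]
      have e2' : ((b : C.grass) : 𝔄) * C.G (f : H) = -(C.G f * ((b : C.grass) : 𝔄)) := by
        rw [e2, neg_neg]
      have e5 : ((C.grassIncl (C.formₗ (f ⊗ₜ a) (h ⊗ₜ b)) : C.gar) : 𝔄) =
          ⟪T.JQ f, h⟫_ℂ • (((a : C.grass) : 𝔄) * ((b : C.grass) : 𝔄)) := by
        rw [coe_grassIncl, formₗ_apply, C.form_tmul hinf]
        rfl
      rw [Subalgebra.coe_sub, Subalgebra.coe_mul, Subalgebra.coe_mul, coe_evenField_tmul,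
        coe_evenField_tmul, Subalgebra.coe_neg, e5, mul_assoc, ← mul_assoc _ (C.G (h : H)), e1',
        mul_assoc (C.G (h : H)), ← mul_assoc _ (C.G (f : H)), e2']
      have e6 : C.G (f : H) * C.G (h : H) = ⟪T.JQ f, h⟫_ℂ • (1 : 𝔄) - C.G h * C.G f := by
        rw [eq_sub_iff_add_eq, e4, Algebra.algebraMap_eq_smul_one]
        rfl
      rw [neg_mul, neg_mul, mul_neg, mul_neg, mul_assoc, ← mul_assoc (C.G (f : H)), e6, sub_mul,
        smul_mul_assoc, one_mul, mul_assoc (C.G (h : H)) _ (_ * _),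
        mul_assoc _ ((b : C.grass) : 𝔄), e3]
      simp only [mul_neg, smul_neg]
      abel

end Form

/-! ### The Fourier transform of a quasifree state -/

section Quasifree

variable {S : T.QH →L[ℂ] T.QH} {ω : C.ferm →ₗ[ℂ] ℂ}

theorem IsQuasifree.isEven (h : C.IsQuasifree S ω) : C.IsEven ω := by
  intro l hl
  induction hm : l.length using Nat.strong_induction_on generalizing l with
  | _ m ih =>
    cases l with
    | nil => simp at hl
    | cons k l =>
      rw [List.map_cons, List.prod_cons, h.wick]
      refine Finset.sum_eq_zero fun j _ => ?_
      have hj : (l.eraseIdx j).length + 1 = l.length := by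
        rw [List.length_eraseIdx_of_lt j.2]
        have := j.2
        omega
      rw [List.length_cons] at hm hl
      rw [ih _ (by omega) (l.eraseIdx j) ?_ rfl, mul_zero]
      rw [← hj, add_assoc] at hl
      simpa [Nat.odd_add] using hl

/-- Since J S = (1 - S) J, both sides contract f with the field l_j by ⟨J f, S (1 - S) l_j⟩: the
left one by Wick's theorem, the right one after moving the last field to the front. Unlike the
condition on single modes, this form refers to no eigenbasis. -/
theorem IsQuasifree.kms (hS : T.JQ.IsCovariance S) (h : C.IsQuasifree S ω) (f : T.QH)
    {l : List T.QH} (hl : Odd l.length) :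
    ω (C.fermField (S f) * (l.map C.fermField).prod) =
      ω ((l.map C.fermField).prod * C.fermField ((1 - S) f)) := by
  have h1 := congrArg ω (C.fermField_mul_list ((1 - S) f) l)
  rw [hl.neg_one_pow, neg_smul, one_smul, map_add, map_neg, h.wick, map_sum,
    eq_add_neg_iff_add_eq] at h1
  rw [h.wick, ← sub_eq_iff_eq_add'.2 h1.symm, ← Finset.sum_sub_distrib]
  refine Finset.sum_congr rfl fun j _ => ?_
  rw [h.two_point, h.two_point, map_smul, smul_eq_mul]
  have e1 : T.JQ ((1 - S) f) = S (T.JQ f) := by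
    rw [hS.conj_apply]
    simp
  have e2 : T.JQ (S f) = T.JQ f - S (T.JQ f) := by
    rw [hS.conj_apply]
    simp
  rw [e1, e2, inner_sub_left, hS.inner_apply, hS.inner_apply]
  ring

variable {Φ : C.gar →L[ℂ] C.grass}

theorem IsGExtension.map_mul_grass [FiniteDimensional ℂ T.QH] (hΦ : C.IsGExtension ω Φ)
    (X : C.gar) (a : C.grass) : Φ (X * C.grassIncl a) = Φ X * a := by
  refine C.gar_induction (P := fun X => Φ (X * C.grassIncl a) = Φ X * a)
    (isClosed_eq (by fun_prop) (by fun_prop)) ?_ ?_ ?_ X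
  · intro X Y hX hY
    rw [add_mul, map_add, map_add, hX, hY, add_mul]
  · intro c X hX
    rw [smul_mul_assoc, map_smul, map_smul, hX, smul_mul_assoc]
  · intro l m
    rw [mul_assoc, ← map_mul, hΦ, hΦ, smul_mul_assoc]

theorem IsGExtension.map_one (hΦ : C.IsGExtension ω Φ) (h1 : ω 1 = 1) : Φ 1 = 1 := by
  have := hΦ 1 1
  rwa [_root_.map_one, _root_.map_one, mul_one, h1, one_smul] at this

theorem evenField_mul_product (f : T.QH) (b : C.grassGraded 1) (l : List T.QH) (a : C.grass) :
    C.evenField (f ⊗ₜ b) * (C.fermIncl (l.map C.fermField).prod * C.grassIncl a) =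
      (-1 : ℂ) ^ l.length • (C.fermIncl (C.fermField f * (l.map C.fermField).prod) *
        C.grassIncl (b * a)) := by
  refine Subtype.ext ?_
  have e1 : ((b : C.grass) : 𝔄) * (l.map fun h : T.QH => C.G h).prod =
      (-1 : ℂ) ^ l.length • ((l.map fun h : T.QH => C.G h).prod * ((b : C.grass) : 𝔄)) := by
    refine anticomm_list_prod l fun h _ => ?_
    have := C.G_mul_graded (h : H) b.2
    rw [this, pow_one, neg_smul, one_smul, neg_neg]
  have e2 : ((C.fermField f * (l.map C.fermField).prod : C.ferm) : 𝔄) =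
      C.G f * (l.map fun h : T.QH => C.G h).prod := by
    rw [← coe_ferm_list_prod]
    rfl
  have e3 : ((((b : C.grass) * a : C.grass)) : 𝔄) = ((b : C.grass) : 𝔄) * a := rfl
  rw [Subalgebra.coe_mul, Subalgebra.coe_mul, Subalgebra.coe_smul, Subalgebra.coe_mul,
    coe_evenField_tmul, coe_fermIncl, coe_fermIncl, coe_grassIncl, coe_grassIncl, e2, e3,
    coe_ferm_list_prod, mul_assoc, ← mul_assoc ((b : C.grass) : 𝔄), e1, smul_mul_assoc,
    mul_smul_comm]
  simp only [mul_assoc]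

theorem product_mul_evenField (f : T.QH) (b : C.grassGraded 1) (l : List T.QH) (a : C.grass) :
    (C.fermIncl (l.map C.fermField).prod * C.grassIncl a) * C.evenField (f ⊗ₜ b) =
      C.fermIncl ((l.map C.fermField).prod * C.fermField f) * C.grassIncl (b * a) := by
  rw [mul_assoc, ← evenField_mul_grass]
  refine Subtype.ext ?_
  have e2 : (((l.map C.fermField).prod * C.fermField f : C.ferm) : 𝔄) =
      (((l.map C.fermField).prod : C.ferm) : 𝔄) * C.G f := rfl
  have e3 : ((((b : C.grass) * a : C.grass)) : 𝔄) = ((b : C.grass) : 𝔄) * a := rfl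
  rw [Subalgebra.coe_mul, Subalgebra.coe_mul, Subalgebra.coe_mul, coe_evenField_tmul,
    coe_fermIncl, coe_fermIncl, coe_grassIncl, coe_grassIncl, e2, e3]
  simp only [mul_assoc]

/-- The KMS condition for the G-extension of a quasifree state. -/
theorem IsGExtension.kms [FiniteDimensional ℂ T.QH] (hS : T.JQ.IsCovariance S)
    (h : C.IsQuasifree S ω) (hΦ : C.IsGExtension ω Φ) (ξ : C.EvenPhaseSpace) (X : C.gar) :
    Φ (C.evenField (C.act S ξ) * X) = -Φ (X * C.evenField (C.act (1 - S) ξ)) := by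
  induction ξ using TensorProduct.induction_on with
  | zero => simp
  | add ξ ξ' h h' => rw [map_add, map_add, map_add, map_add, add_mul, mul_add, map_add, map_add,
      h, h', neg_add]
  | tmul f b =>
    rw [act_tmul, act_tmul]
    refine C.gar_induction (P := fun X => Φ (C.evenField (S f ⊗ₜ b) * X) =
      -Φ (X * C.evenField ((1 - S) f ⊗ₜ b))) (isClosed_eq (by fun_prop) (by fun_prop)) ?_ ?_ ?_ X
    · intro X Y hX hY
      rw [mul_add, add_mul, map_add, map_add, hX, hY, neg_add]
    · intro c X hX
      rw [mul_smul_comm, smul_mul_assoc, map_smul, map_smul, hX, smul_neg]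
    · intro l m
      rw [evenField_mul_product, product_mul_evenField, map_smul, hΦ, hΦ]
      -- For even length both sides vanish by parity. For odd length the overall minus sign comes
      -- from moving b through the fields.
      rcases Nat.even_or_odd l.length with hl | hl
      · have h1 := h.isEven C (S f :: l) (by simpa using hl.add_one)
        have h2 := h.isEven C (l ++ [(1 - S) f]) (by simpa using hl.add_one)
        rw [List.map_cons, List.prod_cons] at h1
        rw [List.map_append, List.prod_append, List.map_singleton, List.prod_singleton] at h2
        rw [h1, h2]
        simp
      · rw [h.kms C hS f hl, hl.neg_one_pow, neg_smul, one_smul]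

omit T 𝔄 H in
-- The commutator with c is a derivation, and its value z on b commutes with b.
theorem _root_.GAR.commutator_pow {R : Type*} [Ring R] {b c z : R} (hz : c * b - b * c = z)
    (hzb : z * b = b * z) (m : ℕ) :
    c * b ^ (m + 1) - b ^ (m + 1) * c = ((m + 1 : ℕ) : R) * (b ^ m * z) := by
  have hzb' : Commute z b := hzb
  induction m with
  | zero => simpa using hz
  | succ m ih =>
    have e1 : c * b ^ (m + 2) - b ^ (m + 2) * c =
        (c * b ^ (m + 1) - b ^ (m + 1) * c) * b + b ^ (m + 1) * (c * b - b * c) := by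
      rw [pow_succ b (m + 1)]
      noncomm_ring
    have e2 : b ^ m * z * b = b ^ (m + 1) * z := by
      rw [mul_assoc, hzb, ← mul_assoc, ← pow_succ]
    rw [e1, ih, hz, mul_assoc, e2]
    push_cast
    noncomm_ring

variable [CompleteSpace H]

theorem form_act_conj (hinf : ¬ FiniteDimensional ℂ T.QHᗮ) (hS : T.JQ.IsCovariance S)
    (ξ η : C.EvenPhaseSpace) : C.form (C.act (1 - S) ξ) η = C.form ξ (C.act S η) := by
  rw [← formₗ_apply, ← formₗ_apply]
  induction ξ using TensorProduct.induction_on with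
  | zero => simp
  | add ξ ξ' h h' => simp only [map_add, LinearMap.add_apply, h, h']
  | tmul f a =>
    induction η using TensorProduct.induction_on with
    | zero => simp
    | add η η' h h' => simp only [map_add, h, h']
    | tmul h b =>
      have e1 : T.JQ ((1 - S) f) = S (T.JQ f) := by
        rw [hS.conj_apply]
        simp
      rw [act_tmul, act_tmul, formₗ_apply, formₗ_apply, C.form_tmul hinf, C.form_tmul hinf, e1,
        hS.inner_apply]

/-- The moments of the Grassmann-Bose field in a quasifree state. -/
theorem IsGExtension.map_evenField_pow [FiniteDimensional ℂ T.QH]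
    (hinf : ¬ FiniteDimensional ℂ T.QHᗮ) (hS : T.JQ.IsCovariance S)
    (h : C.IsQuasifree S ω) (hΦ : C.IsGExtension ω Φ) (ξ : C.EvenPhaseSpace) (m : ℕ) :
    Φ (C.evenField ξ ^ (m + 2)) =
      -((m + 1 : ℕ) : ℂ) • (Φ (C.evenField ξ ^ m) * C.form ξ (C.act S ξ)) := by
  set b := C.evenField ξ with hb
  set c := C.evenField (C.act (1 - S) ξ) with hc
  have hsplit : b = C.evenField (C.act S ξ) + c := by
    rw [hb, hc, ← map_add]
    congr 1
    induction ξ using TensorProduct.induction_on with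
    | zero => simp
    | add ξ ξ' h h' =>
      rw [map_add, map_add, add_add_add_comm, ← h rfl rfl, ← h' rfl rfl]
    | tmul f a =>
      rw [act_tmul, act_tmul, ← TensorProduct.add_tmul]
      simp
  have hz : c * b - b * c = -C.grassIncl (C.form ξ (C.act S ξ)) := by
    rw [hc, hb, C.evenField_comm hinf, C.form_act_conj hinf hS]
  have h1 := commutator_pow hz (by rw [neg_mul, mul_neg, evenField_mul_grass]) m
  -- Split off the first factor as Φ(Sξ) + c; the KMS condition turns Φ(Sξ) on the left into -c on
  -- the right.
  have h2 : Φ (b ^ (m + 2)) = Φ (c * b ^ (m + 1) - b ^ (m + 1) * c) := by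
    rw [pow_succ' b (m + 1)]
    nth_rewrite 1 [hsplit]
    rw [add_mul, map_add, hΦ.kms C hS h, map_sub]
    abel
  have h3 : ((m + 1 : ℕ) : C.gar) * (b ^ m * -C.grassIncl (C.form ξ (C.act S ξ))) =
      -((m + 1 : ℕ) : ℂ) • (b ^ m * C.grassIncl (C.form ξ (C.act S ξ))) := by
    rw [mul_neg, mul_neg, ← nsmul_eq_mul, neg_smul, Nat.cast_smul_eq_nsmul]
  rw [h2, h1, h3, map_smul, hΦ.map_mul_grass C]

/-- The odd moments vanish, and the recursion makes the moment of order 2k divided by (2k)! equal to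
the k-th power of -⟨ξ⋆, Sξ⟩/2 divided by k!. Hence the image of the exponential series is again an
exponential series. -/
theorem IsGExtension.map_exp [FiniteDimensional ℂ T.QH]
    (hinf : ¬ FiniteDimensional ℂ T.QHᗮ) (hS : T.JQ.IsCovariance S)
    (h : C.IsQuasifree S ω) (hΦ : C.IsGExtension ω Φ) (ξ : C.EvenPhaseSpace) :
    Φ (C.weyl ξ) = NormedSpace.exp (-(1 / 2 : ℂ) • C.form ξ (C.act S ξ)) := by
  have hodd : ∀ k, Φ (C.evenField ξ ^ (2 * k + 1)) = 0 := by
    intro k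
    induction k with
    | zero =>
      have h1 := fun ξ : C.EvenPhaseSpace => hΦ.kms C hS h ξ 1
      have h2 : ∀ f : T.QH, ∀ b, Φ (C.evenField (f ⊗ₜ b)) = 0 := by
        intro f b
        have h3 := C.evenField_mul_product f b [] 1
        have h4 := h.isEven C [f] (by simp)
        simp only [List.map_cons, List.map_nil, List.prod_cons, List.prod_nil, mul_one] at h3 h4
        rw [_root_.map_one, _root_.map_one, mul_one, mul_one] at h3
        rw [h3, map_smul, hΦ, h4, zero_smul, smul_zero]
      rw [mul_zero, zero_add, pow_one]
      induction ξ using TensorProduct.induction_on with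
      | zero => simp
      | add ξ ξ' h h' => rw [map_add, map_add, h, h', add_zero]
      | tmul f b => exact h2 f b
    | succ k ih =>
      rw [show 2 * (k + 1) + 1 = (2 * k + 1) + 2 by ring, hΦ.map_evenField_pow C hinf hS h, ih,
        zero_mul, smul_zero]
  have heven : ∀ k, ((2 * k)! : ℂ)⁻¹ • Φ (C.evenField ξ ^ (2 * k)) =
      (k ! : ℂ)⁻¹ • (-(1 / 2 : ℂ) • C.form ξ (C.act S ξ)) ^ k := by
    intro k
    induction k with
    | zero => simp [hΦ.map_one C h.state.map_one]
    | succ k ih =>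
      have hk : ((k : ℂ) + 1) ≠ 0 := by exact_mod_cast Nat.succ_ne_zero k
      have hk2 : (2 * (k : ℂ) + 1) ≠ 0 := by exact_mod_cast Nat.succ_ne_zero (2 * k)
      have e1 : (((2 * (k + 1))! : ℕ) : ℂ)⁻¹ * -((2 * k + 1 : ℕ) : ℂ) =
          ((k : ℂ) + 1)⁻¹ * -(1 / 2) * (((2 * k)! : ℕ) : ℂ)⁻¹ := by
        rw [show 2 * (k + 1) = 2 * k + 1 + 1 by ring, Nat.factorial_succ, Nat.factorial_succ]
        have := Nat.factorial_ne_zero (2 * k)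
        have : (((2 * k)! : ℕ) : ℂ) ≠ 0 := by exact_mod_cast this
        have hk3 : (2 * (k : ℂ) + 1 + 1) ≠ 0 := by exact_mod_cast Nat.succ_ne_zero (2 * k + 1)
        push_cast
        field_simp
        ring
      rw [show 2 * (k + 1) = 2 * k + 2 by ring, hΦ.map_evenField_pow C hinf hS h,
        ← show 2 * (k + 1) = 2 * k + 2 by ring, smul_smul, e1, mul_smul _ (((2 * k)! : ℕ) : ℂ)⁻¹,
        ← smul_mul_assoc (((2 * k)! : ℕ) : ℂ)⁻¹, ih, pow_succ, Nat.factorial_succ,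
        smul_mul_assoc, mul_smul_comm, smul_smul, smul_smul]
      congr 1
      push_cast
      rw [mul_inv]
      ring
  have hs : HasSum (fun m => Φ ((m ! : ℂ)⁻¹ • C.evenField ξ ^ m)) (Φ (C.weyl ξ)) :=
    Φ.hasSum (NormedSpace.exp_series_hasSum_exp' (𝕂 := ℂ) (C.evenField ξ))
  refine hs.unique ?_
  have hs2 := NormedSpace.exp_series_hasSum_exp' (𝕂 := ℂ) (-(1 / 2 : ℂ) • C.form ξ (C.act S ξ))
  have := HasSum.even_add_odd (f := fun m => Φ ((m ! : ℂ)⁻¹ • C.evenField ξ ^ m))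
    (m := NormedSpace.exp (-(1 / 2 : ℂ) • C.form ξ (C.act S ξ))) (m' := 0) ?_ ?_
  · rwa [add_zero] at this
  · simp only [map_smul, heven]
    exact hs2
  · simp only [map_smul, hodd, smul_zero]
    exact hasSum_zero

end Quasifree

end CARAlgebra

end GAR

/-! ### The convolution of a pure quasifree state with its support projection -/

namespace GAR

theorem exp_add_complex {R : Type*} [NormedRing R] [NormedAlgebra ℂ R] [CompleteSpace R] {x y : R}
    (h : Commute x y) :
    NormedSpace.exp (x + y) = NormedSpace.exp x * NormedSpace.exp y := by
  let _ : NormedAlgebra ℚ R := NormedAlgebra.restrictScalars ℚ ℂ R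
  exact NormedSpace.exp_add_of_commute h

namespace CARAlgebra

variable {H : Type*} [NormedAddCommGroup H] [InnerProductSpace ℂ H] {T : Triple H}
  {𝔄 : Type*} [CStarAlgebra 𝔄] (C : CARAlgebra T.conjQ 𝔄)

/-- A product of number operators commutes with the Grassmann part. -/
theorem numberProd_mul_grass {n : ℕ} (f : Fin n → T.QH) (l : List (Fin n)) (a : C.grass) :
    C.grassIncl a * C.fermIncl (C.numberProd f l) =
      C.fermIncl (C.numberProd f l) * C.grassIncl a := by
  refine Subtype.ext ?_
  rw [Subalgebra.coe_mul, Subalgebra.coe_mul, coe_fermIncl, coe_grassIncl]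
  refine (C.comm_grass (fun h => ?_) a).symm
  induction l with
  | nil => simp [numberProd]
  | cons i l ih =>
    have e : ((C.numberProd f (i :: l) : C.ferm) : 𝔄) =
        C.G (T.JQ (f i) : T.QH) * (C.G (f i : H) * (C.numberProd f l : 𝔄)) := by
      rw [numberProd_cons, star_fermField, mul_assoc]
      rfl
    rw [e, mul_assoc, mul_assoc, ih, ← mul_assoc (C.G (f i : H)), C.G_anticomm_perp _ h.2, neg_mul,
      mul_neg, mul_assoc, ← mul_assoc _ (C.G (h : H)), C.G_anticomm_perp _ h.2, neg_mul, neg_neg,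
      mul_assoc]

/-- The G-extension of a pure quasifree state factorizes over its support projection. -/
theorem IsGExtension.map_mul_support [FiniteDimensional ℂ T.QH] {n : ℕ} {f : Fin n → T.QH}
    (hf : T.JQ.IsPairBasis f) {ω : C.ferm →ₗ[ℂ] ℂ} {Φ : C.gar →L[ℂ] C.grass}
    (hΦ : C.IsGExtension ω Φ) (hω : ∀ A, C.numberProd f (List.finRange n) * A *
      C.numberProd f (List.finRange n) = ω A • C.numberProd f (List.finRange n))
    (X Y : C.gar) :
    Φ (X * C.fermIncl (C.numberProd f (List.finRange n)) * Y) = Φ X * Φ Y := by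
  set E := C.numberProd f (List.finRange n) with hE
  have hEE : E * E = E := C.numberProd_sq hf _
  have hE0 : E ≠ 0 := C.numberProd_ne_zero hf (List.nodup_finRange n)
  have hωE : ω E = 1 := by
    have h2 := hω 1
    have h3 := hω E
    rw [hEE, hEE] at h3
    refine smul_left_injective ℂ hE0 ?_
    change ω E • E = (1 : ℂ) • E
    rw [← h3, one_smul]
  have hEa := C.numberProd_mul_grass f (List.finRange n)
  rw [← hE] at hEa
  -- The Grassmann-valued form of E A E = ω(A) E; it uses that E commutes with the Grassmann part.
  have key : ∀ X, C.fermIncl E * X * C.fermIncl E = C.fermIncl E * C.grassIncl (Φ X) := by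
    refine C.gar_induction (isClosed_eq (by fun_prop) ?_) ?_ ?_ ?_
    · exact continuous_const.mul (C.continuous_grassIncl.comp Φ.continuous)
    · intro X Y hX hY
      rw [mul_add, add_mul, map_add, map_add, hX, hY, mul_add]
    · intro c X hX
      rw [mul_smul_comm, smul_mul_assoc, map_smul, map_smul, hX, mul_smul_comm]
    · intro l m
      rw [hΦ, ← mul_assoc, mul_assoc, hEa, ← mul_assoc, ← map_mul, ← map_mul, hω, map_smul,
        map_smul, smul_mul_assoc, mul_smul_comm]
  have hinj : ∀ a, Φ (C.fermIncl E * C.grassIncl a) = a := fun a => by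
    rw [hΦ, hωE, one_smul]
  -- E X E Y E is evaluated in two ways: as a whole, and as (E X E)(E Y E).
  have h2 : C.fermIncl E * C.grassIncl (Φ (X * C.fermIncl E * Y)) =
      C.fermIncl E * C.grassIncl (Φ X * Φ Y) := by
    rw [_root_.map_mul C.grassIncl, ← mul_assoc _ (C.grassIncl _), ← key, ← key,
      mul_assoc _ (C.fermIncl E) (C.grassIncl _), ← key]
    simp only [mul_assoc]
  rw [← hinj (Φ (X * C.fermIncl E * Y)), h2, hinj]

variable [CompleteSpace H]

/-- By `map_mul_support` the value is the product of the Fourier transforms at -ξ and ξ. These agree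
because the exponent is quadratic, so the two halves add up. -/
theorem convolution_quasifree [FiniteDimensional ℂ T.QH] (hinf : ¬ FiniteDimensional ℂ T.QHᗮ)
    {n : ℕ} {f : Fin n → T.QH} (hf : T.JQ.IsPairBasis f) {P : T.QH →L[ℂ] T.QH}
    (hP : T.JQ.IsBasisProjection P) (h1 : ∀ i, P (f i) = f i) (ξ : C.EvenPhaseSpace) :
    C.convolution (C.gExtension (C.quasifree P)) (C.fermIncl (C.support (C.quasifree P))) ξ =
      NormedSpace.exp (-C.form ξ (C.act P ξ)) := by
  obtain ⟨e1, e2, e3⟩ := C.support_quasifree hf hP h1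
  have hΦ := C.isGExtension_gExtension hinf (C.quasifree P)
  rw [convolution, e1, hΦ.map_mul_support C hf e3,
    hΦ.map_exp C hinf hP.toIsCovariance e2, hΦ.map_exp C hinf hP.toIsCovariance e2, map_neg,
    ← formₗ_apply, ← formₗ_apply, map_neg, map_neg, LinearMap.neg_apply, neg_neg,
    ← exp_add_complex (Commute.refl _), ← add_smul]
  norm_num

end CARAlgebra

end GAR

namespace GAR

/-! ### Sums of commuting elements with vanishing squares -/

theorem Commute.add_pow_of_sq_zero {R : Type*} [Ring R] {r s : R} (h : r * s = s * r)
    (hr : r * r = 0) (m : ℕ) : (r + s) ^ (m + 1) = s ^ (m + 1) + (m + 1) • (r * s ^ m) := by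
  have hc : ∀ k, s ^ k * r = r * s ^ k := fun k =>
    (Commute.pow_right (show Commute r s from h) k).symm
  induction m with
  | zero => simp [add_comm]
  | succ m ih =>
    have h1 : r * s ^ m * r = 0 := by rw [mul_assoc, hc, ← mul_assoc, hr, zero_mul]
    rw [pow_succ, ih, add_mul, mul_add, smul_mul_assoc, mul_add, h1, zero_add, hc, mul_assoc r,
      ← pow_succ, ← pow_succ, succ_nsmul _ (m + 1)]
    abel

/-- In the multinomial expansion only terms without repetition survive, and there are as many
orderings as the factorial says. The vanishing of the next power is part of the induction. -/
theorem list_sum_pow_of_sq_zero {R : Type*} [Ring R] (l : List R) (hsq : ∀ r ∈ l, r * r = 0)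
    (hc : ∀ r ∈ l, ∀ s ∈ l, r * s = s * r) :
    l.sum ^ l.length = (l.length)! • l.prod ∧ l.sum ^ (l.length + 1) = 0 := by
  induction l with
  | nil => simp
  | cons r l ih =>
    obtain ⟨h1, h2⟩ := ih (fun s hs => hsq s (by simp [hs]))
      fun s hs t ht => hc s (by simp [hs]) t (by simp [ht])
    have h3 : r * l.sum = l.sum * r :=
      Commute.list_sum_right r l fun s hs => hc r (by simp) s (by simp [hs])
    have h4 := fun m => Commute.add_pow_of_sq_zero h3 (hsq r (by simp)) m
    rw [List.sum_cons, List.length_cons, h4, h4, pow_succ _ (l.length + 1), h2, h1, List.prod_cons,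
      mul_smul_comm, smul_smul, Nat.factorial_succ]
    simp

/-! ### Scalar product, volume forms and Pfaffians in the abstract Grassmann algebra -/

namespace Conjugation

open ExteriorAlgebra

variable {E : Type*} [NormedAddCommGroup E] [InnerProductSpace ℂ E] (J : Conjugation E)

theorem contraction_ι (u : E) (z : ExteriorAlgebra ℂ E) :
    J.contraction (ι ℂ u) z = CliffordAlgebra.contractLeft (innerₛₗ ℂ (J u)) z := by
  rw [contraction, ExteriorAlgebra.lift_ι_apply]
  rfl

theorem contraction_ι_mul (u h : E) (z : ExteriorAlgebra ℂ E) :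
    J.contraction (ι ℂ u) (ι ℂ h * z) = ⟪J u, h⟫_ℂ • z - ι ℂ h * J.contraction (ι ℂ u) z := by
  rw [contraction_ι, contraction_ι]
  exact CliffordAlgebra.contractLeft_ι_mul _ _ _

theorem contraction_ι_one (u : E) : J.contraction (ι ℂ u) 1 = 0 := by
  rw [contraction_ι]
  exact CliffordAlgebra.contractLeft_one _ _

theorem extInner_smul_left (c : ℂ) (a z : ExteriorAlgebra ℂ E) :
    J.extInner (c • a) z = starRingEnd ℂ c * J.extInner a z := by
  rw [extInner, extStar_smul, map_smul, LinearMap.smul_apply, map_smul, extInner, smul_eq_mul]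

theorem extInner_smul_right (c : ℂ) (a z : ExteriorAlgebra ℂ E) :
    J.extInner a (c • z) = c * J.extInner a z := by
  rw [extInner, map_smul, map_smul, extInner, smul_eq_mul]

/-- A product of orthonormal vectors is normalized. -/
theorem extInner_prod_self {l : List E} (hl : ∀ u ∈ l, ‖u‖ = 1)
    (ho : l.Pairwise fun u v => ⟪u, v⟫_ℂ = 0) :
    J.extInner (l.map (ι ℂ)).prod (l.map (ι ℂ)).prod = 1 := by
  have hzero : ∀ (u : E) (l : List E), (∀ v ∈ l, ⟪J u, v⟫_ℂ = 0) →
      J.contraction (ι ℂ u) (l.map (ι ℂ)).prod = 0 := by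
    intro u l
    induction l with
    | nil => exact fun _ => J.contraction_ι_one u
    | cons v l ih =>
      intro h
      rw [List.map_cons, List.prod_cons, contraction_ι_mul, h v (by simp), zero_smul,
        ih fun w hw => h w (by simp [hw]), mul_zero, sub_zero]
  induction l with
  | nil =>
    have h1 : J.extStar 1 = 1 := by simpa using J.extStar_algebraMap 1
    simp [extInner, h1]
  | cons u l ih =>
    rw [List.pairwise_cons] at ho
    rw [← ih (fun v hv => hl v (by simp [hv])) ho.2, List.map_cons, List.prod_cons, extInner,
      extStar_mul, map_mul J.contraction, Module.End.mul_apply, extStar_ι, contraction_ι_mul,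
      J.involutive,
      hzero _ _ (by rw [J.involutive]; exact ho.1), mul_zero, sub_zero,
      inner_self_eq_norm_sq_to_K, hl u (by simp)]
    simp [extInner]

theorem list_prod_ι_mem (l : List E) : (l.map (ι ℂ)).prod ∈ ⋀[ℂ]^l.length E := by
  induction l with
  | nil => exact Submodule.one_le.1 (le_of_eq (pow_zero _).symm)
  | cons u l ih =>
    rw [List.map_cons, List.prod_cons, List.length_cons]
    change _ ∈ LinearMap.range (ι ℂ) ^ (l.length + 1)
    rw [pow_succ']
    exact Submodule.mul_mem_mul ⟨u, rfl⟩ ih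

theorem ιMulti_eq_list_prod {N : ℕ} (e : Fin N → E) :
    ιMulti ℂ N e = ((List.ofFn e).map (ι ℂ)).prod := by
  rw [ιMulti_apply, List.map_ofFn]
  rfl

theorem ι_anticomm (u v : E) : ι ℂ u * ι ℂ v = -(ι ℂ v * ι ℂ u) :=
  eq_neg_of_add_eq_zero_left (ι_add_mul_swap u v)

theorem pairwise_ofFn_orthonormal {N : ℕ} {e : Fin N → E} (he : Orthonormal ℂ e) :
    (List.ofFn e).Pairwise fun u v => ⟪u, v⟫_ℂ = 0 :=
  List.pairwise_ofFn.2 fun _ _ hij => he.2 hij.ne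

theorem ι_pair_comm (u v w z : E) :
    ι ℂ u * ι ℂ v * (ι ℂ w * ι ℂ z) = ι ℂ w * ι ℂ z * (ι ℂ u * ι ℂ v) := by
  have h : ∀ w, Commute (ι ℂ u * ι ℂ v) (ι ℂ w) := fun w => by
    rw [commute_iff_eq, mul_assoc, ι_anticomm v w, mul_neg, ← mul_assoc, ι_anticomm u w, neg_mul,
      neg_neg, mul_assoc]
  exact (h w).mul_right (h z)

section Top

variable [FiniteDimensional ℂ E] (e : OrthonormalBasis (Fin (Module.finrank ℂ E)) ℂ E)

omit [FiniteDimensional ℂ E] in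
theorem extInner_top : J.extInner (ιMulti ℂ _ e) (ιMulti ℂ _ e) = 1 := by
  rw [ιMulti_eq_list_prod]
  refine J.extInner_prod_self (fun u hu => ?_) (pairwise_ofFn_orthonormal e.orthonormal)
  obtain ⟨i, rfl⟩ := List.mem_ofFn.1 hu
  exact e.orthonormal.1 i

-- The top exterior power is one-dimensional, and the product of the basis vectors is nonzero
-- because its scalar square is 1; J is needed only to form that scalar product.
include J in
theorem exists_eq_smul_top {z : ExteriorAlgebra ℂ E} (hz : z ∈ ⋀[ℂ]^(Module.finrank ℂ E) E) :
    ∃ c : ℂ, z = c • ιMulti ℂ _ e := by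
  have h1 : Module.finrank ℂ (⋀[ℂ]^(Module.finrank ℂ E) E) = 1 := by
    rw [exteriorPower.finrank_eq, Nat.choose_self]
  set x : ⋀[ℂ]^(Module.finrank ℂ E) E := ⟨ιMulti ℂ _ e, ιMulti_range ℂ _ ⟨_, rfl⟩⟩ with hx
  have hx0 : x ≠ 0 := by
    intro h
    have h2 : ιMulti ℂ _ e = 0 := congrArg Subtype.val h
    have h3 := J.extInner_top e
    rw [h2] at h3
    simp [extInner] at h3
  obtain ⟨c, hc⟩ := (finrank_eq_one_iff_of_nonzero' x hx0).1 h1 ⟨z, hz⟩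
  exact ⟨c, (congrArg Subtype.val hc).symm⟩

-- On real vectors the involution only reverses the order, which takes m(m - 1)/2 transpositions of
-- m anticommuting factors.
omit [FiniteDimensional ℂ E] in
theorem extStar_list_prod (l : List E) (hl : ∀ u ∈ l, J u = u) :
    J.extStar (l.map (ι ℂ)).prod = (-1 : ℂ) ^ (l.length * (l.length - 1) / 2) •
      (l.map (ι ℂ)).prod := by
  induction l with
  | nil => simpa using J.extStar_algebraMap 1
  | cons u l ih =>
    have h1 := CARAlgebra.anticomm_list_prod (x := ι ℂ u) l fun v _ => ι_anticomm u v
    have h2 : (l.map (ι ℂ)).prod * ι ℂ u = (-1 : ℂ) ^ l.length • (ι ℂ u * (l.map (ι ℂ)).prod) := by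
      rw [h1, smul_smul, ← mul_pow]
      norm_num
    rw [List.map_cons, List.prod_cons, extStar_mul, extStar_ι, hl u (by simp),
      ih fun v hv => hl v (by simp [hv]), smul_mul_assoc, h2, smul_smul, ← pow_add]
    congr 2
    rw [List.length_cons, Nat.add_sub_cancel]
    rcases l.length with _ | m
    · rfl
    · rw [Nat.add_sub_cancel, show (m + 1 + 1) * (m + 1) = (m + 1) * m + (m + 1) * 2 by ring,
        Nat.add_mul_div_right _ _ two_pos]

omit [FiniteDimensional ℂ E] in
theorem extStar_top (he : ∀ i, J (e i) = e i) {n : ℕ} (hn : Module.finrank ℂ E = 2 * n) :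
    J.extStar (ιMulti ℂ _ e) = (-1 : ℂ) ^ n • ιMulti ℂ _ e := by
  rw [ιMulti_eq_list_prod, extStar_list_prod J _ fun u hu => by
    obtain ⟨i, rfl⟩ := List.mem_ofFn.1 hu
    exact he i]
  congr 1
  -- With 2n factors the exponent is n(2n - 1), which has the parity of n.
  rw [List.length_ofFn, hn, mul_assoc, Nat.mul_div_cancel_left _ two_pos]
  rcases n with _ | n
  · rfl
  · rw [show 2 * (n + 1) - 1 = 2 * n + 1 by omega, pow_mul', (odd_two_mul_add_one n).neg_one_pow]

end Top

/-! ### Two-forms -/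

theorem inner_two (u w g h : E) :
    algebraMapInv (J.contraction (ι ℂ u * ι ℂ w) (ι ℂ g * ι ℂ h)) =
      ⟪J w, g⟫_ℂ * ⟪J u, h⟫_ℂ - ⟪J w, h⟫_ℂ * ⟪J u, g⟫_ℂ := by
  have h1 : ∀ u h : E, J.contraction (ι ℂ u) (ι ℂ h) = ⟪J u, h⟫_ℂ • 1 := fun u h => by
    rw [← mul_one (ι ℂ h), contraction_ι_mul, contraction_ι_one, mul_zero, sub_zero]
  rw [map_mul J.contraction, Module.End.mul_apply, contraction_ι_mul, h1, map_sub, map_smul, h1,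
    mul_smul_comm,
    mul_one, map_smul, h1, map_sub, map_smul, map_smul, map_smul, map_smul, map_one]
  simp

/-- A two-form is determined by its scalar products with products of two vectors. -/
theorem eq_zero_of_inner_two [FiniteDimensional ℂ E] {a : ExteriorAlgebra ℂ E} (ha : a ∈ ⋀[ℂ]^2 E)
    (h : ∀ g h, algebraMapInv (J.contraction a (ι ℂ g * ι ℂ h)) = 0) : a = 0 := by
  obtain ⟨e, he⟩ := J.exists_real_orthonormalBasis
  -- The sum runs over ordered pairs, so each basis two-form is counted twice.
  have key : (2 : ℂ) • a = ∑ i, ∑ j,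
      algebraMapInv (J.contraction a (ι ℂ (e j) * ι ℂ (e i))) • (ι ℂ (e i) * ι ℂ (e j)) := by
    change a ∈ LinearMap.range (ι ℂ) ^ 2 at ha
    rw [pow_two] at ha
    clear h
    induction ha using Submodule.mul_induction_on' with
    | mem_mul_mem x hx y hy =>
      obtain ⟨u, rfl⟩ := hx
      obtain ⟨w, rfl⟩ := hy
      have h1 : ∀ u i, ⟪J u, e i⟫_ℂ = ⟪e i, u⟫_ℂ := fun u i => by rw [J.inner_left, he]
      simp only [inner_two, h1, sub_smul, Finset.sum_sub_distrib]
      have h2 : ∀ u w : E, ∑ i, ∑ j, (⟪e i, u⟫_ℂ * ⟪e j, w⟫_ℂ) • (ι ℂ (e i) * ι ℂ (e j)) =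
          ι ℂ u * ι ℂ w := by
        intro u w
        conv_rhs => rw [← e.sum_repr' u, ← e.sum_repr' w]
        simp only [map_sum, map_smul, Finset.sum_mul_sum, smul_mul_smul_comm]
      have h3 := h2 u w
      simp only [mul_comm ⟪e _, u⟫_ℂ] at h3
      rw [h3, h2, ι_anticomm w u, sub_neg_eq_add, two_smul]
    | add x _ y _ hx hy =>
      rw [smul_add, hx, hy]
      simp only [map_add, LinearMap.add_apply, add_smul, Finset.sum_add_distrib]
  simp only [h, zero_smul, Finset.sum_const_zero] at key
  exact (smul_eq_zero.1 key).resolve_left two_ne_zero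

theorem IsTwoForm.twoForm_eq [FiniteDimensional ℂ E] {A : E →L[ℂ] E} {a : ExteriorAlgebra ℂ E}
    (h : J.IsTwoForm A a) : J.twoForm A = a := by
  have h' : J.IsTwoForm A (J.twoForm A) := Classical.epsilon_spec (p := J.IsTwoForm A) ⟨a, h⟩
  refine sub_eq_zero.1 (J.eq_zero_of_inner_two (Submodule.sub_mem _ h'.1 h.1) fun f g => ?_)
  have h1 := h'.2 f g
  have h2 := h.2 f g
  rw [extInner, extStar_extStar] at h1 h2
  rw [map_sub, LinearMap.sub_apply, map_sub, h1, h2, sub_self]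

section Pairs

variable {J} {n : ℕ} {f : Fin n → E} (hf : J.IsPairBasis f)
include hf

/-- The operator 1 - 2P is -1 on f_i and 1 on J f_i. Expanding h in the pair basis produces the two
terms of the contraction with f_i ∧ J f_i. -/
theorem IsPairBasis.isTwoForm {P : E →L[ℂ] E} (h1 : ∀ i, P (f i) = f i)
    (h2 : ∀ i, P (J (f i)) = 0) :
    J.IsTwoForm (1 - 2 * P) (∑ i, ι ℂ (f i) * ι ℂ (J (f i))) := by
  refine ⟨Submodule.sum_mem _ fun i _ => by simpa using list_prod_ι_mem [f i, J (f i)],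
    fun g h => ?_⟩
  rw [extInner, extStar_extStar, map_sum, LinearMap.sum_apply, map_sum]
  conv_rhs => rw [hf.complete h]
  rw [map_sum, inner_sum]
  refine Finset.sum_congr rfl fun i _ => ?_
  have e1 : (1 - 2 * P) (f i) = -f i := by
    have : (2 * P) (f i) = f i + f i := by
      rw [two_mul, add_apply, h1]
    rw [sub_apply, this]
    simp
  have e2 : (1 - 2 * P) (J (f i)) = J (f i) := by
    have : (2 * P) (J (f i)) = 0 := by
      rw [two_mul, add_apply, h2, add_zero]
    rw [sub_apply, this]
    simp
  rw [inner_two, J.involutive, map_add, map_smul, map_smul, e1, e2, inner_add_right,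
    inner_smul_right, inner_smul_right, inner_neg_right, J.inner_map_map, J.inner_left g]
  ring

-- The two-forms of the pairs commute and have square zero. The resulting factorial cancels the
-- normalization of the Pfaffian.
omit hf in
theorem sum_pairs_pow :
    (∑ i, ι ℂ (f i) * ι ℂ (J (f i))) ^ n =
      (n ! : ℂ) • ((List.finRange n).map fun i => ι ℂ (f i) * ι ℂ (J (f i))).prod := by
  have hsq : ∀ u v : E, ι ℂ u * ι ℂ v * (ι ℂ u * ι ℂ v) = 0 := fun u v => by
    rw [mul_assoc, ← mul_assoc (ι ℂ v), ι_anticomm v u, neg_mul, mul_assoc, ι_sq_zero]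
    simp
  have h := (list_sum_pow_of_sq_zero
    ((List.finRange n).map fun i => ι ℂ (f i) * ι ℂ (J (f i))) (by
      intro r hr
      obtain ⟨i, -, rfl⟩ := List.mem_map.1 hr
      exact hsq _ _) (by
      intro r hr s hs
      obtain ⟨i, -, rfl⟩ := List.mem_map.1 hr
      obtain ⟨j, -, rfl⟩ := List.mem_map.1 hs
      exact ι_pair_comm _ _ _ _)).1
  rw [List.length_map, List.length_finRange, ← List.ofFn_eq_map, List.sum_ofFn,
    List.ofFn_eq_map] at h
  rw [h, Nat.cast_smul_eq_nsmul]

omit hf in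
/-- The product of the two-forms of all pairs. -/
noncomputable def pairProd (J : Conjugation E) (f : Fin n → E) : ExteriorAlgebra ℂ E :=
  ((List.finRange n).map fun i => ι ℂ (f i) * ι ℂ (J (f i))).prod

omit hf in
theorem pairProd_eq_list_prod :
    pairProd J f = (((List.finRange n).flatMap fun i => [f i, J (f i)]).map (ι ℂ)).prod := by
  rw [pairProd]
  induction List.finRange n with
  | nil => simp
  | cons i l ih =>
    rw [List.map_cons, List.prod_cons, ih, List.flatMap_cons, List.map_append, List.prod_append]
    simp

-- Each f ∧ J f is fixed by the involution, and these two-forms commute, so reversing their order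
-- changes nothing.
omit hf in
theorem extStar_pairProd : J.extStar (pairProd J f) = pairProd J f := by
  rw [pairProd]
  induction List.finRange n with
  | nil => simpa using J.extStar_algebraMap 1
  | cons i l ih =>
    rw [List.map_cons, List.prod_cons, extStar_mul, ih, extStar_mul, extStar_ι, extStar_ι,
      J.involutive]
    refine (Commute.list_prod_right _ _ fun r hr => ?_).eq.symm
    obtain ⟨j, -, rfl⟩ := List.mem_map.1 hr
    exact ι_pair_comm _ _ _ _

theorem IsPairBasis.extInner_pairProd : J.extInner (pairProd J f) (pairProd J f) = 1 := by
  rw [pairProd_eq_list_prod]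
  refine J.extInner_prod_self (fun u hu => ?_) ?_
  · obtain ⟨i, -, hi⟩ := List.mem_flatMap.1 hu
    rcases List.mem_pair.1 hi with rfl | rfl
    · exact hf.norm_eq i
    · rw [J.map.norm_map, hf.norm_eq i]
  · rw [List.pairwise_flatMap]
    refine ⟨fun i _ => by simpa using hf.inner_conj i i, ?_⟩
    refine (List.nodup_finRange n).imp fun {i j} hij u hu v hv => ?_
    rcases List.mem_pair.1 hu with rfl | rfl <;> rcases List.mem_pair.1 hv with rfl | rfl
    · rw [hf.inner_eq, if_neg hij]
    · exact hf.inner_conj i j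
    · exact hf.conj_inner i j
    · rw [hf.conj_inner_conj, if_neg hij]

variable [FiniteDimensional ℂ E]

theorem IsPairBasis.pfaffian_eq (hn : Module.finrank ℂ E = 2 * n) {P : E →L[ℂ] E}
    (h1 : ∀ i, P (f i) = f i) (h2 : ∀ i, P (J (f i)) = 0) (v : ExteriorAlgebra ℂ E) :
    J.pfaffian v (1 - 2 * P) = J.extInner v (pairProd J f) := by
  rw [pfaffian, (hf.isTwoForm h1 h2).twoForm_eq J, hn, Nat.mul_div_cancel_left _ two_pos,
    sum_pairs_pow, extInner_smul_right, ← mul_assoc, inv_mul_cancel₀, one_mul, pairProd]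
  exact_mod_cast Nat.factorial_ne_zero n

/-- The sign of a volume form relative to a product of pairs, in coordinates. -/
theorem IsPairBasis.exists_volume_coord (hn : Module.finrank ℂ E = 2 * n)
    (e : OrthonormalBasis (Fin (Module.finrank ℂ E)) ℂ E) (he : ∀ i, J (e i) = e i)
    {v : ExteriorAlgebra ℂ E} (hv : J.IsVolumeForm v) {c : ℂ} (hc : v = c • ιMulti ℂ _ e) :
    ∃ d : ℂ, pairProd J f = d • ιMulti ℂ _ e ∧ J.extInner v (pairProd J f) = c * (-1) ^ n * d ∧
      (J.extInner v (pairProd J f) = 1 ∨ J.extInner v (pairProd J f) = -1) := by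
  have hlen : ((List.finRange n).flatMap fun i => [f i, J (f i)]).length =
      Module.finrank ℂ E := by
    rw [hn, List.length_flatMap]
    simp [mul_comm]
  have hy : pairProd J f ∈ ⋀[ℂ]^(Module.finrank ℂ E) E := by
    rw [pairProd_eq_list_prod, ← hlen]
    exact list_prod_ι_mem _
  obtain ⟨d, hd⟩ := J.exists_eq_smul_top e hy
  set x := ιMulti ℂ (Module.finrank ℂ E) e with hx
  have hxx : J.extInner x x = 1 := J.extInner_top e
  have hinj : ∀ {a b : ℂ}, a • x = b • x → a = b := fun {a b} h => by
    have := congrArg (J.extInner x) h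
    rwa [extInner_smul_right, extInner_smul_right, hxx, mul_one, mul_one] at this
  have hxs : J.extStar x = (-1 : ℂ) ^ n • x := J.extStar_top e he hn
  -- Selfadjointness makes both coefficients c and d real or both imaginary, according to the parity
  -- of n, and normalization gives them modulus 1. Hence conj(c) d is a sign.
  have c1 : starRingEnd ℂ c * (-1) ^ n = c := hinj (by
    have := hv.selfadjoint
    rwa [hc, extStar_smul, hxs, smul_smul] at this)
  have c2 : starRingEnd ℂ c * c = 1 := by
    have := hv.normalized
    rwa [hc, extInner_smul_left, extInner_smul_right, hxx, mul_one] at this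
  have d1 : starRingEnd ℂ d * (-1) ^ n = d := hinj (by
    have := extStar_pairProd (J := J) (f := f)
    rwa [hd, extStar_smul, hxs, smul_smul] at this)
  have d2 : starRingEnd ℂ d * d = 1 := by
    have := hf.extInner_pairProd
    rwa [hd, extInner_smul_left, extInner_smul_right, hxx, mul_one] at this
  have s2 : ((-1 : ℂ) ^ n) * (-1) ^ n = 1 := by
    rw [← mul_pow]
    norm_num
  have e1 : J.extInner v (pairProd J f) = starRingEnd ℂ c * d := by
    rw [hc, hd, extInner_smul_left, extInner_smul_right, hxx, mul_one]
  refine ⟨d, hd, ?_, ?_⟩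
  · rw [e1]
    linear_combination -(starRingEnd ℂ c * d) * s2 + ((-1) ^ n * d) * c1
  · rw [e1]
    refine mul_self_eq_one_iff.1 ?_
    generalize starRingEnd ℂ c = c' at *
    generalize starRingEnd ℂ d = d' at *
    generalize (-1 : ℂ) ^ n = s at *
    rw [← c1] at c2
    rw [← d1] at d2
    rw [← d1]
    linear_combination (d' * (d' * s)) * c2 + d2

end Pairs

end Conjugation

end GAR

/-! ### Exponentials of nilpotent elements; evaluation of forms on phase space -/

namespace GAR

theorem exp_of_sq_zero {R : Type*} [NormedRing R] [NormedAlgebra ℂ R] [CompleteSpace R] {z : R}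
    (hz : z * z = 0) : NormedSpace.exp z = 1 + z := by
  have h1 := NormedSpace.exp_series_hasSum_exp' (𝕂 := ℂ) z
  have h2 : HasSum (fun m => (m ! : ℂ)⁻¹ • z ^ m)
      (∑ m ∈ Finset.range 2, (m ! : ℂ)⁻¹ • z ^ m) := by
    refine hasSum_sum_of_ne_finset_zero fun m hm => ?_
    obtain ⟨k, rfl⟩ : ∃ k, m = k + 2 := ⟨m - 2, by simp at hm; omega⟩
    rw [pow_add, pow_two, hz, mul_zero, smul_zero]
  rw [h1.unique h2]
  simp [Finset.sum_range_succ]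

theorem exp_list_sum_of_sq_zero {R : Type*} [NormedRing R] [NormedAlgebra ℂ R] [CompleteSpace R]
    (l : List R) (hsq : ∀ z ∈ l, z * z = 0) (hc : ∀ z ∈ l, ∀ w ∈ l, z * w = w * z) :
    NormedSpace.exp l.sum = (l.map fun z => 1 + z).prod := by
  induction l with
  | nil => simp
  | cons z l ih =>
    rw [List.sum_cons, exp_add_complex (Commute.list_sum_right z l fun w hw =>
      hc z (by simp) w (by simp [hw])), exp_of_sq_zero (hsq z (by simp)),
      ih (fun w hw => hsq w (by simp [hw])) fun w hw t ht => hc w (by simp [hw]) t (by simp [ht]),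
      List.map_cons, List.prod_cons]

namespace CARAlgebra

open ExteriorAlgebra

variable {H : Type*} [NormedAddCommGroup H] [InnerProductSpace ℂ H] {T : Triple H}
  {𝔄 : Type*} [CStarAlgebra 𝔄] (C : CARAlgebra T.conjQ 𝔄) [CompleteSpace H]
  (hinf : ¬ FiniteDimensional ℂ T.QHᗮ)

omit [CompleteSpace H] in
theorem component_add (u : T.QH) (ξ η : C.EvenPhaseSpace) :
    C.component u (ξ + η) = C.component u ξ + C.component u η := by
  rw [component, map_add, map_add, component, component]

omit [CompleteSpace H] in
theorem component_smul (u : T.QH) (c : ℂ) (ξ : C.EvenPhaseSpace) :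
    C.component u (c • ξ) = c • C.component u ξ := by
  rw [component, map_smul, map_smul, component]

include hinf in
theorem component_mem_graded (u : T.QH) (ξ : C.EvenPhaseSpace) :
    C.component u ξ ∈ C.grassGraded 1 := by
  induction ξ using TensorProduct.induction_on with
  | zero => rw [component, map_zero, map_zero]; exact zero_mem _
  | add ξ η hξ hη => rw [component_add]; exact add_mem hξ hη
  | tmul f a =>
    rw [C.component_tmul hinf]
    exact Submodule.smul_mem _ _ a.2

/-- The evaluation of forms at a point of the even phase space. -/
noncomputable def coordHom (η : C.EvenPhaseSpace) : ExteriorAlgebra ℂ T.QH →ₐ[ℂ] C.grass :=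
  ExteriorAlgebra.lift ℂ
    ⟨{ toFun := fun u => C.component (T.JQ u) η
       map_add' := fun u w => by
        simp only [component, map_add, TensorProduct.add_tmul, LinearMap.add_apply]
       map_smul' := fun c u => by
        have h : T.JQ (c • u) = starRingEnd ℂ c • T.JQ u := map_smulₛₗ _ _ _
        rw [component, h, ← TensorProduct.smul_tmul', map_smulₛₗ, LinearMap.smul_apply,
          Complex.conj_conj, RingHom.id_apply, component] },
      fun u => C.graded_mul_self (C.component_mem_graded hinf _ η)⟩

theorem coordHom_ι (η : C.EvenPhaseSpace) (u : T.QH) :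
    C.coordHom hinf η (ι ℂ u) = C.component (T.JQ u) η :=
  ExteriorAlgebra.lift_ι_apply _ _ _ _

theorem coordHom_ι_mem (η : C.EvenPhaseSpace) (u : T.QH) :
    C.coordHom hinf η (ι ℂ u) ∈ C.grassGraded 1 := by
  rw [coordHom_ι]
  exact C.component_mem_graded hinf _ _

theorem coordHom_ι_smul (c : ℂ) (η : C.EvenPhaseSpace) (u : T.QH) :
    C.coordHom hinf (c • η) (ι ℂ u) = c • C.coordHom hinf η (ι ℂ u) := by
  rw [coordHom_ι, coordHom_ι, component_smul]

theorem coordHom_ι_tmul (f u : T.QH) (a : C.grassGraded 1) :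
    C.coordHom hinf (f ⊗ₜ a) (ι ℂ u) = ⟪T.JQ u, f⟫_ℂ • (a : C.grass) := by
  rw [coordHom_ι, C.component_tmul hinf]

theorem coordHom_ι_add (ξ η : C.EvenPhaseSpace) (u : T.QH) :
    C.coordHom hinf (ξ + η) (ι ℂ u) = C.coordHom hinf ξ (ι ℂ u) + C.coordHom hinf η (ι ℂ u) := by
  rw [coordHom_ι, coordHom_ι, coordHom_ι, component_add]

theorem coordHom_ι_zero (u : T.QH) : C.coordHom hinf 0 (ι ℂ u) = 0 := by
  have := C.coordHom_ι_smul hinf 0 0 u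
  rwa [zero_smul, zero_smul] at this

theorem monomial_eq {N : ℕ} {e : Fin N → T.QH} (he : ∀ i, T.JQ (e i) = e i) (I : Finset (Fin N))
    (η : C.EvenPhaseSpace) :
    C.monomial e I η = C.coordHom hinf η (sortedProd (fun i => ι ℂ (e i)) I) := by
  rw [monomial, sortedProd, map_list_prod, List.map_map]
  congr 1
  refine List.map_congr_left fun i _ => ?_
  rw [Function.comp_apply, coordHom_ι, he]

theorem coordHom_list_smul (c : ℂ) (η : C.EvenPhaseSpace) (l : List T.QH) :
    C.coordHom hinf (c • η) (l.map (ι ℂ)).prod =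
      c ^ l.length • C.coordHom hinf η (l.map (ι ℂ)).prod := by
  induction l with
  | nil => simp
  | cons u l ih =>
    rw [List.map_cons, List.prod_cons, map_mul, map_mul, ih, coordHom_ι_smul, smul_mul_smul_comm,
      List.length_cons, pow_succ']

omit [CompleteSpace H] in
theorem sortedProd_ι {N : ℕ} (e : Fin N → T.QH) (I : Finset (Fin N)) :
    sortedProd (fun i => ι ℂ (e i)) I = ((I.sort.map e).map (ι ℂ)).prod := by
  rw [sortedProd, List.map_map]
  rfl

omit [CompleteSpace H] in
theorem sortedProd_ι_univ {N : ℕ} (e : Fin N → T.QH) :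
    sortedProd (fun i => ι ℂ (e i)) Finset.univ = ιMulti ℂ N e := by
  rw [sortedProd_ι, Conjugation.ιMulti_eq_list_prod, Fin.sort_univ, List.ofFn_eq_map]

/-- The highest coefficient of a polynomial, as a limit. -/
theorem tendsto_top_coeff {N : ℕ} (e : Fin N → T.QH) (coeff : Finset (Fin N) → C.grass)
    (η : C.EvenPhaseSpace) :
    Filter.Tendsto (fun s : ℂ => s ^ N • ∑ I, coeff I *
        C.coordHom hinf (s⁻¹ • η) (sortedProd (fun i => ι ℂ (e i)) I))
      (nhdsWithin 0 {0}ᶜ) (nhds (coeff Finset.univ * C.coordHom hinf η (ιMulti ℂ N e))) := by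
  -- Scaling η by 1/s and multiplying by s^N leaves s^(N - |I|) in front of the monomial I; at s = 0
  -- only the full index set survives.
  have hcont : Continuous fun s : ℂ => ∑ I : Finset (Fin N), s ^ (N - I.card) •
      (coeff I * C.coordHom hinf η (sortedProd (fun i => ι ℂ (e i)) I)) := by fun_prop
  have h0 := (hcont.tendsto 0).mono_left (nhdsWithin_le_nhds (s := {0}ᶜ))
  have h1 : ∑ I : Finset (Fin N), (0 : ℂ) ^ (N - I.card) •
      (coeff I * C.coordHom hinf η (sortedProd (fun i => ι ℂ (e i)) I)) =
      coeff Finset.univ * C.coordHom hinf η (ιMulti ℂ N e) := by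
    rw [Finset.sum_eq_single Finset.univ, sortedProd_ι_univ]
    · simp
    · intro I _ hI
      have : I.card < N := by
        simpa using Finset.card_lt_card (Finset.ssubset_univ_iff.2 hI)
      rw [zero_pow (by omega), zero_smul]
    · simp
  rw [h1] at h0
  refine h0.congr' ?_
  filter_upwards [self_mem_nhdsWithin] with s hs
  have hs : s ≠ 0 := hs
  rw [Finset.smul_sum]
  refine Finset.sum_congr rfl fun I _ => ?_
  have hI : I.card ≤ N := by simpa using Finset.card_le_univ I
  rw [sortedProd_ι, coordHom_list_smul, mul_smul_comm, smul_smul, List.length_map,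
    Finset.length_sort, inv_pow, ← div_eq_mul_inv, pow_sub₀ _ hs hI, div_eq_mul_inv]

include hinf in
/-- An element of the Grassmann part that is annihilated by all products of `k` generators. -/
theorem eq_zero_of_mul_list {a : C.grass} (k : ℕ)
    (h : ∀ l : List T.QHᗮ, l.length = k → a * (l.map C.grassField).prod = 0) : a = 0 := by
  induction k generalizing a with
  | zero => simpa using h []
  | succ k ih =>
    refine C.eq_zero_of_mul_grassField hinf fun g => ih fun l hl => ?_
    have := h (g :: l) (by simp [hl])
    rwa [List.map_cons, List.prod_cons, ← mul_assoc] at this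

/-- A phase space point can have arbitrary generators as coordinates, so every product of N
generators is a value of the top form. This makes the top coefficient of a polynomial unique. -/
theorem eq_zero_of_mul_top {N : ℕ} {e : Fin N → T.QH} (he : Orthonormal ℂ e)
    (hJ : ∀ i, T.JQ (e i) = e i) {a : C.grass}
    (h : ∀ η, a * C.coordHom hinf η (ιMulti ℂ N e) = 0) : a = 0 := by
  refine C.eq_zero_of_mul_list hinf N fun l hl => ?_
  set η : C.EvenPhaseSpace := ∑ i : Fin N, e i ⊗ₜ
    (⟨C.grassField (l.get (i.cast hl.symm)), C.grassField_mem_graded _⟩ : C.grassGraded 1) with hη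
  have hi : ∀ i, C.coordHom hinf η (ι ℂ (e i)) = C.grassField (l.get (i.cast hl.symm)) := by
    intro i
    have hadd : ∀ s : Finset (Fin N), C.coordHom hinf (∑ i ∈ s, e i ⊗ₜ
        (⟨C.grassField (l.get (i.cast hl.symm)), C.grassField_mem_graded _⟩ : C.grassGraded 1))
        (ι ℂ (e i)) = ∑ j ∈ s, ⟪e i, e j⟫_ℂ • C.grassField (l.get (j.cast hl.symm)) := by
      intro s
      classical
      induction s using Finset.induction_on with
      | empty => rw [Finset.sum_empty, Finset.sum_empty, coordHom_ι_zero]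
      | insert j s hj ih =>
        rw [Finset.sum_insert hj, Finset.sum_insert hj, coordHom_ι_add, ih, coordHom_ι_tmul, hJ]
    rw [hη, hadd, Finset.sum_eq_single i, inner_self_eq_norm_sq_to_K, he.1 i]
    · simp
    · intro j _ hj
      rw [he.2 hj.symm, zero_smul]
    · simp
  have h1 := h η
  rw [ιMulti_apply, map_list_prod, List.map_ofFn] at h1
  have h2 : List.ofFn (C.coordHom hinf η ∘ fun i => ι ℂ (e i)) = l.map C.grassField := by
    subst hl
    rw [← List.ofFn_get (l.map C.grassField)]
    refine List.ext_get (by simp) fun i h1 h2 => ?_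
    simp [hi]
  rwa [h2] at h1

/-! ### Polynomials on phase space -/

/-- The function is a polynomial in the coordinates of the basis `e`. -/
def IsPolynomial {N : ℕ} (e : Fin N → T.QH) (F : C.EvenPhaseSpace → C.grass) : Prop :=
  ∃ coeff : Finset (Fin N) → C.grass, ∀ η,
    F η = ∑ I, coeff I * C.coordHom hinf η (sortedProd (fun i => ι ℂ (e i)) I)

section Polynomial

variable {C hinf} {N : ℕ} {e : Fin N → T.QH} {F G : C.EvenPhaseSpace → C.grass}

theorem IsPolynomial.add (hF : C.IsPolynomial hinf e F) (hG : C.IsPolynomial hinf e G) :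
    C.IsPolynomial hinf e fun η => F η + G η := by
  obtain ⟨a, ha⟩ := hF
  obtain ⟨b, hb⟩ := hG
  exact ⟨fun I => a I + b I, fun η => by
    simp only [ha, hb, add_mul, Finset.sum_add_distrib]⟩

theorem IsPolynomial.sum {κ : Type*} (s : Finset κ) {F : κ → C.EvenPhaseSpace → C.grass}
    (hF : ∀ k ∈ s, C.IsPolynomial hinf e (F k)) :
    C.IsPolynomial hinf e fun η => ∑ k ∈ s, F k η := by
  classical
  induction s using Finset.induction_on with
  | empty => exact ⟨0, fun η => by simp⟩
  | insert k s hk ih =>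
    simp only [Finset.sum_insert hk]
    exact (hF k (by simp)).add (ih fun j hj => hF j (by simp [hj]))

theorem IsPolynomial.const_mul (a : C.grass) (hF : C.IsPolynomial hinf e F) :
    C.IsPolynomial hinf e fun η => a * F η := by
  obtain ⟨b, hb⟩ := hF
  exact ⟨fun I => a * b I, fun η => by simp only [hb, Finset.mul_sum, mul_assoc]⟩

/-- Coefficients stand on the left, so an odd constant has to be moved through each monomial, at the
cost of the sign of its degree. -/
theorem IsPolynomial.mul_const (hF : C.IsPolynomial hinf e F) {a : C.grass}
    (ha : a ∈ C.grassGraded 1) : C.IsPolynomial hinf e fun η => F η * a := by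
  obtain ⟨b, hb⟩ := hF
  refine ⟨fun I => b I * ((-1 : ℂ) ^ I.card • a), fun η => ?_⟩
  simp only [hb, Finset.sum_mul]
  refine Finset.sum_congr rfl fun I _ => ?_
  have h1 := anticomm_list_prod (x := a) (y := fun i => C.coordHom hinf η (ι ℂ (e i))) I.sort
    fun i _ => C.graded_anticomm ha (C.coordHom_ι_mem hinf η _)
  rw [sortedProd, map_list_prod, List.map_map, mul_assoc, mul_assoc, smul_mul_assoc]
  change _ * (((I.sort.map fun i => C.coordHom hinf η (ι ℂ (e i))).prod) * a) =
    _ * ((-1 : ℂ) ^ I.card • (a * (I.sort.map fun i => C.coordHom hinf η (ι ℂ (e i))).prod))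
  rw [h1, smul_smul, Finset.length_sort, ← mul_pow]
  norm_num

/-- The ordered products of a spanning family span the exterior algebra, because they are stable
under left multiplication by vectors. -/
theorem isPolynomial_coordHom (he : Submodule.span ℂ (Set.range e) = ⊤)
    (z : ExteriorAlgebra ℂ T.QH) : C.IsPolynomial hinf e fun η => C.coordHom hinf η z := by
  have hz : z ∈ Submodule.span ℂ (Set.range (sortedProd fun i => ι ℂ (e i))) := by
    set K := Submodule.span ℂ (Set.range (sortedProd fun i => ι ℂ (e i))) with hK
    have hmul : ∀ u : T.QH, ∀ x ∈ K, ι ℂ u * x ∈ K := by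
      intro u x hx
      have hu : u ∈ Submodule.span ℂ (Set.range e) := he ▸ Submodule.mem_top
      induction hu using Submodule.span_induction with
      | mem u hu =>
        obtain ⟨i, rfl⟩ := hu
        exact mul_mem_span_sortedProd (y := fun i => ι ℂ (e i))
          (fun i => ⟨0, by rw [ι_sq_zero, zero_smul]⟩)
          (fun i j _ => Conjugation.ι_anticomm _ _) i hx
      | zero => simp
      | add u w _ _ hu hw => rw [map_add, add_mul]; exact add_mem hu hw
      | smul c u _ hu => rw [map_smul, smul_mul_assoc]; exact K.smul_mem c hu
    have hone : (1 : ExteriorAlgebra ℂ T.QH) ∈ K :=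
      Submodule.subset_span ⟨∅, sortedProd_empty _⟩
    have hall : ∀ x ∈ K, z * x ∈ K := by
      induction z using ExteriorAlgebra.induction with
      | algebraMap c => exact fun x hx => by rw [← Algebra.smul_def]; exact K.smul_mem c hx
      | ι u => exact hmul u
      | mul a b ha hb => exact fun x hx => by rw [mul_assoc]; exact ha _ (hb _ hx)
      | add a b ha hb => exact fun x hx => by rw [add_mul]; exact add_mem (ha _ hx) (hb _ hx)
    simpa using hall 1 hone
  obtain ⟨c, rfl⟩ := (Submodule.mem_span_range_iff_exists_fun ℂ).1 hz
  exact ⟨fun I => algebraMap ℂ _ (c I), fun η => by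
    simp only [map_sum]
    exact Finset.sum_congr rfl fun I _ => by rw [map_smul, Algebra.smul_def]⟩

theorem IsPolynomial.mul_coordHom (he : Submodule.span ℂ (Set.range e) = ⊤)
    (hF : C.IsPolynomial hinf e F) (z : ExteriorAlgebra ℂ T.QH) :
    C.IsPolynomial hinf e fun η => F η * C.coordHom hinf η z := by
  obtain ⟨b, hb⟩ := hF
  simp only [hb, Finset.sum_mul, mul_assoc, ← map_mul]
  exact IsPolynomial.sum _ fun I _ => (isPolynomial_coordHom he _).const_mul _

end Polynomial

end CARAlgebra

end GAR

/-! ### Gaussian integrals over phase space -/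

namespace GAR

namespace CARAlgebra

open ExteriorAlgebra

variable {H : Type*} [NormedAddCommGroup H] [InnerProductSpace ℂ H] {T : Triple H}
  {𝔄 : Type*} [CStarAlgebra 𝔄] (C : CARAlgebra T.conjQ 𝔄) [CompleteSpace H]
  (hinf : ¬ FiniteDimensional ℂ T.QHᗮ)

section Gauss

variable {n : ℕ} {f : Fin n → T.QH} (hf : T.JQ.IsPairBasis f)
include hf

/-- Insert the completeness relation of the pair basis between the two arguments. The variant with P
below retains only the terms for which P does not vanish. -/
theorem form_eq_sum (ξ η : C.EvenPhaseSpace) :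
    C.form ξ η = ∑ i, (C.coordHom hinf ξ (ι ℂ (f i)) * C.coordHom hinf η (ι ℂ (T.JQ (f i))) +
      C.coordHom hinf ξ (ι ℂ (T.JQ (f i))) * C.coordHom hinf η (ι ℂ (f i))) := by
  rw [← formₗ_apply]
  induction ξ using TensorProduct.induction_on with
  | zero => simp [coordHom_ι_zero]
  | add ξ ξ' h h' =>
    rw [map_add, LinearMap.add_apply, h, h', ← Finset.sum_add_distrib]
    refine Finset.sum_congr rfl fun i _ => ?_
    rw [coordHom_ι_add, coordHom_ι_add]
    noncomm_ring
  | tmul u a =>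
    induction η using TensorProduct.induction_on with
    | zero => simp [coordHom_ι_zero]
    | add η η' h h' =>
      rw [map_add, h, h', ← Finset.sum_add_distrib]
      refine Finset.sum_congr rfl fun i _ => ?_
      rw [coordHom_ι_add, coordHom_ι_add]
      noncomm_ring
    | tmul w b =>
      simp only [coordHom_ι_tmul, T.JQ.involutive, smul_mul_smul_comm, ← add_smul]
      rw [formₗ_apply, C.form_tmul hinf, ← Finset.sum_smul]
      congr 1
      conv_lhs => rw [hf.complete w]
      rw [inner_sum]
      refine Finset.sum_congr rfl fun i _ => ?_
      rw [inner_add_right, inner_smul_right, inner_smul_right, T.JQ.inner_left u,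
        T.JQ.inner_left u, T.JQ.involutive]
      ring

theorem form_act_eq_sum {P : T.QH →L[ℂ] T.QH} (h1 : ∀ i, P (f i) = f i)
    (h2 : ∀ i, P (T.JQ (f i)) = 0) (ξ η : C.EvenPhaseSpace) :
    C.form ξ (C.act P η) =
      ∑ i, C.coordHom hinf ξ (ι ℂ (f i)) * C.coordHom hinf η (ι ℂ (T.JQ (f i))) := by
  rw [← formₗ_apply]
  induction ξ using TensorProduct.induction_on with
  | zero => simp [coordHom_ι_zero]
  | add ξ ξ' h h' =>
    rw [map_add, LinearMap.add_apply, h, h', ← Finset.sum_add_distrib]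
    refine Finset.sum_congr rfl fun i _ => ?_
    rw [coordHom_ι_add, add_mul]
  | tmul u a =>
    induction η using TensorProduct.induction_on with
    | zero => simp [coordHom_ι_zero]
    | add η η' h h' =>
      rw [map_add, map_add, h, h', ← Finset.sum_add_distrib]
      refine Finset.sum_congr rfl fun i _ => ?_
      rw [coordHom_ι_add, mul_add]
    | tmul w b =>
      simp only [coordHom_ι_tmul, T.JQ.involutive, smul_mul_smul_comm]
      rw [act_tmul, formₗ_apply, C.form_tmul hinf, ← Finset.sum_smul]
      congr 1
      conv_lhs => rw [hf.complete w]
      rw [map_sum, inner_sum]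
      refine Finset.sum_congr rfl fun i _ => ?_
      rw [map_add, map_smul, map_smul, h1, h2, smul_zero, add_zero, inner_smul_right,
        T.JQ.inner_left u, mul_comm]

omit hf in
/-- A quadratic factor of a shifted Gaussian function. -/
noncomputable def pairForm (f : Fin n → T.QH) (ξ η : C.EvenPhaseSpace) (i : Fin n) : C.grass :=
  -((C.coordHom hinf η (ι ℂ (f i)) - C.coordHom hinf ξ (ι ℂ (f i))) *
    (C.coordHom hinf η (ι ℂ (T.JQ (f i))) + C.coordHom hinf ξ (ι ℂ (T.JQ (f i)))))

/-- Completing the square. -/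
theorem gaussian_eq_prod {P : T.QH →L[ℂ] T.QH} (h1 : ∀ i, P (f i) = f i)
    (h2 : ∀ i, P (T.JQ (f i)) = 0) (ξ η : C.EvenPhaseSpace) :
    NormedSpace.exp (-C.form η (C.act P η)) * NormedSpace.exp (C.form ξ η) =
      NormedSpace.exp (-C.form ξ (C.act P ξ)) *
        ((List.finRange n).map fun i => 1 + C.pairForm hinf f ξ η i).prod := by
  have hm := fun ζ u => C.coordHom_ι_mem hinf ζ u
  have hodd1 : ∀ i, C.coordHom hinf η (ι ℂ (f i)) - C.coordHom hinf ξ (ι ℂ (f i)) ∈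
      C.grassGraded 1 := fun i => sub_mem (hm _ _) (hm _ _)
  have hodd2 : ∀ i, C.coordHom hinf η (ι ℂ (T.JQ (f i))) + C.coordHom hinf ξ (ι ℂ (T.JQ (f i))) ∈
      C.grassGraded 1 := fun i => add_mem (hm _ _) (hm _ _)
  have heven : ∀ i, C.pairForm hinf f ξ η i ∈ C.grassGraded 0 := fun i => by
    rw [C.grassGraded_congr (show 0 ≡ 1 + 1 [MOD 2] from rfl)]
    exact neg_mem (C.graded_mul_mem (hodd1 i) (hodd2 i))
  have hsq : ∀ i, C.pairForm hinf f ξ η i * C.pairForm hinf f ξ η i = 0 := fun i => by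
    rw [pairForm, neg_mul_neg, mul_assoc, ← mul_assoc (C.coordHom hinf η (ι ℂ (T.JQ (f i))) + _),
      C.graded_anticomm (hodd2 i) (hodd1 i), neg_mul, mul_assoc, C.graded_mul_self (hodd2 i),
      mul_zero, neg_zero, mul_zero]
  have hf0 := C.form_mem_graded hinf
  rw [← exp_add_complex (C.even_comm_grass (neg_mem (hf0 _ _)) _)]
  -- In each mode, with a prime for the coordinate along J f_i, this is -ηη' + ξη' + ξ'η = -ξξ' - (η
  -- - ξ)(η' + ξ'), where ξ'η = -ηξ' because both are odd.
  have hsum : -C.form η (C.act P η) + C.form ξ η = -C.form ξ (C.act P ξ) +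
      ((List.finRange n).map fun i => C.pairForm hinf f ξ η i).sum := by
    rw [← Fin.sum_univ_def, C.form_act_eq_sum hinf hf h1 h2, C.form_act_eq_sum hinf hf h1 h2,
      C.form_eq_sum hinf hf, ← Finset.sum_neg_distrib, ← Finset.sum_neg_distrib,
      ← Finset.sum_add_distrib, ← Finset.sum_add_distrib]
    refine Finset.sum_congr rfl fun i _ => ?_
    rw [pairForm, C.graded_anticomm (hm ξ (T.JQ (f i))) (hm η (f i))]
    noncomm_ring
  rw [hsum, exp_add_complex (C.even_comm_grass (neg_mem (hf0 _ _)) _),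
    exp_list_sum_of_sq_zero, List.map_map]
  · rfl
  · intro z hz
    obtain ⟨i, -, rfl⟩ := List.mem_map.1 hz
    exact hsq i
  · intro z hz w _
    obtain ⟨i, -, rfl⟩ := List.mem_map.1 hz
    exact C.even_comm_grass (heven i) w

-- F is kept general so that the factors can be absorbed into it one after another. Expanding a
-- factor leaves only right multiplications by coordinates of η and by the odd constants coming from
-- ξ.
omit hf in
theorem isPolynomial_prod_pairForm {N : ℕ} {e : Fin N → T.QH}
    (he : Submodule.span ℂ (Set.range e) = ⊤) (ξ : C.EvenPhaseSpace) (l : List (Fin n))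
    {F : C.EvenPhaseSpace → C.grass} (hF : C.IsPolynomial hinf e F) :
    C.IsPolynomial hinf e fun η =>
      F η * (l.map fun i => 1 + C.pairForm hinf f ξ η i).prod := by
  induction l generalizing F with
  | nil => simpa using hF
  | cons i l ih =>
    have hm := fun u => C.coordHom_ι_mem hinf ξ u
    have h1 := (hF.mul_coordHom he (-ι ℂ (f i))).add (hF.mul_const (hm (f i)))
    have h2 := hF.add ((h1.mul_coordHom he (ι ℂ (T.JQ (f i)))).add
      (h1.mul_const (hm (T.JQ (f i)))))
    have h3 := ih h2
    simp only [List.map_cons, List.prod_cons, ← mul_assoc]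
    convert h3 using 4
    rw [pairForm, map_neg]
    noncomm_ring

-- Giving each factor its share s² of the power of s makes it polynomial in s. At s = 0 the constant
-- 1 and the shifts by ξ disappear, and each pair contributes minus the product of its two
-- coordinates of η.
omit hf in
theorem tendsto_prod_pairForm (f : Fin n → T.QH) (ξ η : C.EvenPhaseSpace) :
    Filter.Tendsto (fun s : ℂ => s ^ (2 * n) •
        ((List.finRange n).map fun i => 1 + C.pairForm hinf f ξ (s⁻¹ • η) i).prod)
      (nhdsWithin 0 {0}ᶜ)
      (nhds ((-1 : ℂ) ^ n • C.coordHom hinf η (T.JQ.pairProd f))) := by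
  set g : ℂ → Fin n → C.grass := fun s i => s ^ 2 • 1 -
    (C.coordHom hinf η (ι ℂ (f i)) - s • C.coordHom hinf ξ (ι ℂ (f i))) *
    (C.coordHom hinf η (ι ℂ (T.JQ (f i))) + s • C.coordHom hinf ξ (ι ℂ (T.JQ (f i)))) with hg
  have hcont : Continuous fun s : ℂ => ((List.finRange n).map (g s)).prod := by
    refine continuous_list_prod _ fun i _ => ?_
    fun_prop
  have h0 := (hcont.tendsto 0).mono_left (nhdsWithin_le_nhds (s := {0}ᶜ))
  have h1 : ((List.finRange n).map (g 0)).prod =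
      (-1 : ℂ) ^ n • C.coordHom hinf η (T.JQ.pairProd f) := by
    have : ∀ l : List (Fin n), (l.map (g 0)).prod = (-1 : ℂ) ^ l.length •
        C.coordHom hinf η (l.map fun i => ι ℂ (f i) * ι ℂ (T.JQ (f i))).prod := by
      intro l
      induction l with
      | nil => simp
      | cons i l ih =>
        rw [List.map_cons, List.prod_cons, ih, List.map_cons, List.prod_cons, map_mul, map_mul,
          List.length_cons, pow_succ]
        simp [hg]
    rw [this, List.length_finRange, Conjugation.pairProd]
  rw [h1] at h0
  refine h0.congr' ?_
  filter_upwards [self_mem_nhdsWithin] with s hs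
  have hs : s ≠ 0 := hs
  have : ∀ l : List (Fin n), (l.map (g s)).prod = s ^ (2 * l.length) •
      (l.map fun i => 1 + C.pairForm hinf f ξ (s⁻¹ • η) i).prod := by
    intro l
    induction l with
    | nil => simp
    | cons i l ih =>
      have h2 : g s i = s ^ 2 • (1 + C.pairForm hinf f ξ (s⁻¹ • η) i) := by
        have h3 : ∀ a b : C.grass, s • (s⁻¹ • a + b) = a + s • b := fun a b => by
          rw [smul_add, smul_inv_smul₀ hs]
        have h4 : ∀ a b : C.grass, s • (s⁻¹ • a - b) = a - s • b := fun a b => by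
          rw [smul_sub, smul_inv_smul₀ hs]
        simp only [hg]
        rw [pairForm, coordHom_ι_smul, coordHom_ι_smul, smul_add, smul_neg, pow_two s,
          ← smul_mul_smul_comm, h3, h4, sub_eq_add_neg]
      rw [List.map_cons, List.prod_cons, ih, h2, smul_mul_smul_comm, ← pow_add, List.map_cons,
        List.prod_cons, List.length_cons]
      congr 2
      ring
  rw [this, List.length_finRange]

variable [FiniteDimensional ℂ T.QH]

include hinf in
/-- The Fourier transform of a Gaussian function. -/
theorem integral_gaussian (hn : Module.finrank ℂ T.QH = 2 * n) {P : T.QH →L[ℂ] T.QH}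
    (h1 : ∀ i, P (f i) = f i) (h2 : ∀ i, P (T.JQ (f i)) = 0) {v : ExteriorAlgebra ℂ T.QH}
    (hv : T.JQ.IsVolumeForm v) (ξ : C.EvenPhaseSpace) :
    C.integral v (fun η => NormedSpace.exp (-C.form η (C.act P η)) *
      NormedSpace.exp (C.form ξ η)) =
    T.JQ.pfaffian v (1 - 2 * P) • NormedSpace.exp (-C.form ξ (C.act P ξ)) := by
  simp only [C.gaussian_eq_prod hinf hf h1 h2]
  set K := NormedSpace.exp (-C.form ξ (C.act P ξ)) with hK
  set F : C.EvenPhaseSpace → C.grass := fun η =>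
    K * ((List.finRange n).map fun i => 1 + C.pairForm hinf f ξ η i).prod with hF
  have hex : ∃ X, C.HasIntegral v F X := by
    obtain ⟨e, he⟩ := T.JQ.exists_real_orthonormalBasis
    obtain ⟨c, hc⟩ := T.JQ.exists_eq_smul_top e hv.mem
    have hspan : Submodule.span ℂ (Set.range e) = ⊤ := by
      rw [← e.coe_toBasis]
      exact e.toBasis.span_eq
    have hone : C.IsPolynomial hinf e fun _ => K := by
      simpa using (isPolynomial_coordHom (hinf := hinf) hspan 1).const_mul K
    obtain ⟨coeff, hcoeff⟩ := C.isPolynomial_prod_pairForm hinf (f := f) hspan ξ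
      (List.finRange n) hone
    refine ⟨_, e, c, coeff, he, hc, fun η => ?_, rfl⟩
    simp only [C.monomial_eq hinf he]
    exact hcoeff η
  obtain ⟨e, c, coeff, he, hc, hcoeff, hX⟩ := Classical.epsilon_spec (p := C.HasIntegral v F) hex
  obtain ⟨d, hd, hvd, -⟩ := hf.exists_volume_coord hn e he hv hc
  -- The polynomial representation comes from an arbitrary choice, so its top coefficient is found
  -- by computing one rescaled limit in two ways, from the coefficients and from the product of pair
  -- factors. Both limits are multiples of the value of the top form, which can be cancelled because
  -- η is arbitrary.
  have htop : coeff Finset.univ - ((-1 : ℂ) ^ n * d) • K = 0 := by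
    refine C.eq_zero_of_mul_top hinf e.orthonormal he fun η => ?_
    have t1 := C.tendsto_top_coeff hinf e coeff η
    have t2 := ((C.tendsto_prod_pairForm hinf f ξ η).const_mul K)
    have h3 : ∀ s : ℂ, s ^ (Module.finrank ℂ T.QH) • ∑ I, coeff I *
        C.coordHom hinf (s⁻¹ • η) (sortedProd (fun i => ι ℂ (e i)) I) =
        K * s ^ (2 * n) • ((List.finRange n).map fun i =>
          1 + C.pairForm hinf f ξ (s⁻¹ • η) i).prod := by
      intro s
      have h4 := hcoeff (s⁻¹ • η)
      simp only [C.monomial_eq hinf he] at h4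
      rw [← h4, mul_smul_comm, hF, hn]
    simp only [h3] at t1
    have h5 := tendsto_nhds_unique t1 t2
    rw [hd, map_smul, smul_smul, mul_smul_comm, ← smul_mul_assoc] at h5
    rw [sub_mul, h5, sub_self]
  change C.integral v F = _
  -- The scalar c (-1)^n d left by the integral is the scalar product of v with the product of
  -- pairs, which is the Pfaffian.
  rw [integral, hX, sub_eq_zero.1 htop, smul_smul, hf.pfaffian_eq hn h1 h2, hvd, mul_assoc]

end Gauss

end CARAlgebra

end GAR

theorem mainTheorem2 {H : Type*} [NormedAddCommGroup H] [InnerProductSpace ℂ H] [CompleteSpace H]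
    (T : GAR.Triple H) [FiniteDimensional ℂ T.QH] (hfin : Even (Module.finrank ℂ T.QH))
    (hinf : ¬ FiniteDimensional ℂ T.QHᗮ)
    {𝔄 : Type*} [CStarAlgebra 𝔄] (C : GAR.CARAlgebra T.conjQ 𝔄) :
    (∀ S : T.QH →L[ℂ] T.QH, T.JQ.IsCovariance S → ∀ ξ : C.EvenPhaseSpace,
      C.fourierHom (C.gExtension (C.quasifree S)) ξ =
        NormedSpace.exp (-(1 / 2 : ℂ) • C.form ξ (C.act S ξ))) ∧
    (∀ P : T.QH →L[ℂ] T.QH, T.JQ.IsBasisProjection P →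
      ∀ v : ExteriorAlgebra ℂ T.QH, T.JQ.IsVolumeForm v →
        (T.JQ.pfaffian v (1 - 2 * P) = 1 ∨ T.JQ.pfaffian v (1 - 2 * P) = -1) ∧
        ∀ ξ : C.EvenPhaseSpace,
          C.fourierFun v (C.convolution (C.gExtension (C.quasifree P))
              (C.fermIncl (C.support (C.quasifree P)))) ξ =
            T.JQ.pfaffian v (1 - 2 * P) • NormedSpace.exp (-C.form ξ (C.act P ξ))) := by
  obtain ⟨n, hn⟩ := hfin.exists_two_nsmul
  rw [smul_eq_mul] at hn
  refine ⟨fun S hS ξ => ?_, fun P hP v hv => ?_⟩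
  · exact (C.isGExtension_gExtension hinf _).map_exp C hinf hS (C.isQuasifree_quasifree hn hS) ξ
  · obtain ⟨f, hf, h1, h2⟩ := hP.exists_isPairBasis hn
    refine ⟨?_, fun ξ => ?_⟩
    · obtain ⟨e, he⟩ := T.JQ.exists_real_orthonormalBasis
      obtain ⟨c, hc⟩ := T.JQ.exists_eq_smul_top e hv.mem
      obtain ⟨d, -, -, hd⟩ := hf.exists_volume_coord hn e he hv hc
      rwa [hf.pfaffian_eq hn h1 h2]
    · rw [GAR.CARAlgebra.fourierFun, ← C.integral_gaussian hinf hf hn h1 h2 hv ξ]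
      simp only [C.convolution_quasifree hinf hf hP h1]
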